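/- Let $M=\mathbb H^3/\Gamma$ be a complete hyperbolic 3-manifold ($\Gamma$ a group of isometries acting freely and properly discontinuously on $\mathbb H^3$), let $F$ be a smooth two-sided surface properly embedded in $M$ (a closed embedded surface without boundary), let $\Delta$ be a (nondegenerate) geodesic tetrahedron embedded in $M$, and let $\eta>0$. For $x\in M$, $T_xM$ carries its Euclidean inner product, and for $A\subseteq M$ write $\tilde A=\exp_x^{-1}(A)\cap B(0,\eta)\subset T_xM$, where $B(0,\eta)$ is the open ball. Angles between vectors based at different points of $T_xM$ are measured by parallel translation in the Euclidean space $T_xM$. Suppose that $F$ is *sufficiently transverse* to $\Delta$ at scale $\eta$: $F$ contains no vertex of $\Delta$, and either $F\cap\Delta=\emptyset$, or there are a point $x\in\Delta$ and a number $\delta\in(0,\pi/6)$ such that $\eta$ is less than the injectivity radius of $M$ at $x$ and 1. every point of $\Delta$ is at distance at most $\eta/4$ from $x$; 2. $F$ has $(\eta,\delta/5)$-almost constant normals near $x$: the angle between any two normal vectors to $\tilde F$ (at any points of $\tilde F$) is at most $\delta/5$ or at least $\pi-\delta/5$; 3. some unit normal vector $v$ to $\tilde F$ at some point of $\tilde F\cap\tilde\Delta$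 is $(\eta,2\delta)$-nonperpendicular to the edges of $\Delta$: for every edge $e$ of $\Delta$ and every point $\tilde y\in\tilde e$, the angle between $v$ and a tangent vector to $\tilde e$ at $\tilde y$ is less than $\pi/2-2\delta$ or more than $\pi/2+2\delta$; 4. for every 2-dimensional face $R$ of $\Delta$, the angle between the unit normals to $\tilde R$ (taken up to sign) at any two points of $\tilde R$ is at most $\delta$; 5. for every edge $e$ of $\Delta$, the angle between the unit tangent vectors to $\tilde e$ (taken up to sign) at any two points of $\tilde e$ is at most $\delta$. Then $F\cap\Delta$ has finitely many connected components, and each of them is a normal triangle or a normal square of $\Delta$. Moreover, for every $p\in F$, the open ball of radius $\eta/2$ about $p$ in $F$, with respect to the path metric of the Riemannian metric that $F$ inherits from $M$, meets at most one of these normal discs. Here a normal triangle (respectively square) is a closed disc $D$ properly embedded in $\Delta$, with $D\cap\partial\Delta=\partial D$, that misses the vertices, and for which there is a set $S$ consisting of one vertex (respectively two vertices) of $\Delta$ such that $D$ meets each edge joining a vertex in $S$ to a vertex outside $S$ in exactly one point and meets no other edge, and $D$ meets each face having vertices both in $S$ and outside $S$ in a single normal arc and meets no other face. A normal arc is an arc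 properly embedded in a face, with endpoints in the interiors of two distinct edges of this face. -/

import Mathlib

open Set Topology
open scoped ContDiff ENNReal NNReal

/-! ### Hyperbolic 3-space: the hyperboloid model -/

/-- Euclidean 3-space. -/
abbrev E3 : Type := EuclideanSpace ℝ (Fin 3)

/-- Minkowski space `ℝ^{1,3}`; the first coordinate is the time coordinate. -/
abbrev MinkSpace : Type := ℝ × E3

/-- The Minkowski form, of signature `(-,+,+,+)`. -/
noncomputable def mink (u v : MinkSpace) : ℝ := inner ℝ u.2 v.2 - u.1 * v.1

/-- Hyperbolic 3-space, the upper sheet of the hyperboloid. Its tangent space at `u` is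
`{t | mink u t = 0}`, and its Riemannian metric is the restriction of `mink` to it. -/
def Hyp3 : Set MinkSpace := {u | mink u u = -1 ∧ 0 < u.1}

/-- The hyperbolic distance. -/
noncomputable def hdist (u v : Hyp3) : ℝ := Real.arcosh (-mink u.1 v.1)

/-- The isometry group of hyperbolic 3-space: the linear automorphisms of Minkowski space that
preserve the Minkowski form and the upper sheet of the hyperboloid. -/
def LorentzGroup : Subgroup (MinkSpace ≃ₗ[ℝ] MinkSpace) where
  carrier := {g | (∀ u v, mink (g u) (g v) = mink u v) ∧ ∀ u, g u ∈ Hyp3 ↔ u ∈ Hyp3}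
  mul_mem' := by
    rintro a b ⟨ha, ha2⟩ ⟨hb, hb2⟩
    refine ⟨fun u v => ?_, fun u => ?_⟩
    · rw [LinearEquiv.mul_apply, LinearEquiv.mul_apply, ha, hb]
    · rw [LinearEquiv.mul_apply, ha2, hb2]
  one_mem' := ⟨fun _ _ => rfl, fun _ => Iff.rfl⟩
  inv_mem' := by
    rintro a ⟨ha, ha2⟩
    have key : ∀ u, a (a⁻¹ u) = u := fun u => a.apply_symm_apply u
    refine ⟨fun u v => ?_, fun u => ?_⟩
    · rw [← ha, key, key]
    · rw [← ha2, key]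

noncomputable instance instMulActionLorentzHyp3 : MulAction LorentzGroup Hyp3 where
  smul g u := ⟨g.1 u.1, (g.2.2 u.1).2 u.2⟩
  one_smul _ := rfl
  mul_smul _ _ _ := rfl

theorem hyp_exp_mem (w : E3) :
    ((Real.cosh ‖w‖, (Real.sinh ‖w‖ / ‖w‖) • w) : MinkSpace) ∈ Hyp3 := by
  refine ⟨?_, Real.cosh_pos _⟩
  have h := Real.cosh_sq ‖w‖
  by_cases hw : ‖w‖ = 0
  · simp [mink, hw]
  · simp only [mink, inner_smul_left, inner_smul_right, real_inner_self_eq_norm_sq]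
    simp only [conj_trivial]
    field_simp
    nlinarith

/-- A Lorentz transformation `A` is the same thing as a point `A (1, 0)` of hyperbolic space
together with the orthonormal basis `A (0, e₁), A (0, e₂), A (0, e₃)` of the tangent space there.
This basis identifies the tangent space isometrically with `E3`, and under this identification
`hypExp A` is the Riemannian exponential map of hyperbolic space at the point `A (1, 0)`:
for a unit vector `e`, the curve `r ↦ hypExp A (r • e) = cosh r • A (1, 0) + sinh r • A (0, e)`
is the unit speed geodesic with initial velocity `A (0, e)`. -/
noncomputable def hypExp (A : LorentzGroup) (w : E3) : Hyp3 :=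
  A • (⟨(Real.cosh ‖w‖, (Real.sinh ‖w‖ / ‖w‖) • w), hyp_exp_mem w⟩ : Hyp3)

/-- The geodesic simplex of hyperbolic space spanned by the points `v i` with `i ∈ S`: the radial
projection to the hyperboloid of their linear convex hull. -/
def hypSimplex (v : Fin 4 → Hyp3) (S : Finset (Fin 4)) : Set Hyp3 :=
  {u | ∃ a : Fin 4 → ℝ, (∀ i ∈ S, 0 ≤ a i) ∧ u.1 = ∑ i ∈ S, a i • (v i).1}

/-- The relative interior of the geodesic simplex spanned by the points `v i` with `i ∈ S`. -/
def hypOpenSimplex (v : Fin 4 → Hyp3) (S : Finset (Fin 4)) : Set Hyp3 :=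
  {u | ∃ a : Fin 4 → ℝ, (∀ i ∈ S, 0 < a i) ∧ u.1 = ∑ i ∈ S, a i • (v i).1}

/-! ### Complete hyperbolic 3-manifolds -/

/-- `Γ` is a group of isometries acting freely and properly discontinuously on hyperbolic
3-space. -/
structure IsFreeKleinian (Γ : Subgroup LorentzGroup) : Prop where
  free : ∀ γ ∈ Γ, ∀ u : Hyp3, γ • u = u → γ = 1
  properlyDiscontinuous : ProperlyDiscontinuousSMul Γ Hyp3

/-- The complete hyperbolic 3-manifold `ℍ³ / Γ`. -/
abbrev HypManifold (Γ : Subgroup LorentzGroup) : Type := MulAction.orbitRel.Quotient Γ Hyp3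

/-- The universal covering map of the hyperbolic manifold, a local isometry. -/
noncomputable def hypProj (Γ : Subgroup LorentzGroup) (u : Hyp3) : HypManifold Γ :=
  Quotient.mk (MulAction.orbitRel Γ Hyp3) u

/-- The Riemannian distance of the hyperbolic manifold. -/
noncomputable def manifoldDist (Γ : Subgroup LorentzGroup) (x y : HypManifold Γ) : ℝ :=
  sInf {d | ∃ u v : Hyp3, hypProj Γ u = x ∧ hypProj Γ v = y ∧ d = hdist u v}

/-- The exponential map of the hyperbolic manifold at the point `x` covered by `A (1, 0)`, where
`T_x M` is identified isometrically with `E3` through the orthonormal frame given by `A`. -/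
noncomputable def manifoldExp (Γ : Subgroup LorentzGroup) (A : LorentzGroup) (w : E3) :
    HypManifold Γ :=
  hypProj Γ (hypExp A w)

/-- The injectivity radius at the point `manifoldExp Γ A 0`: the supremum of the radii `r` such
that the exponential map is injective on the ball of radius `r` about the origin. (As this map is
a local diffeomorphism, it is then a diffeomorphism from this ball onto its image.) -/
noncomputable def injRadius (Γ : Subgroup LorentzGroup) (A : LorentzGroup) : ℝ≥0∞ :=
  ⨆ (r : ℝ≥0) (_ : InjOn (manifoldExp Γ A) (Metric.ball 0 (r : ℝ))), (r : ℝ≥0∞)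

/-- The pull-back of `X` by the exponential map, inside the open ball of radius `η` in the tangent
space. -/
def pullBack (Γ : Subgroup LorentzGroup) (A : LorentzGroup) (η : ℝ) (X : Set (HypManifold Γ)) :
    Set E3 :=
  {w | manifoldExp Γ A w ∈ X ∧ ‖w‖ < η}

/-! ### Geodesic tetrahedra -/

/-- A geodesic tetrahedron embedded in the hyperbolic manifold: the homeomorphic image, under the
covering map, of a nondegenerate geodesic tetrahedron of hyperbolic space. -/
structure GeodesicTetrahedron (Γ : Subgroup LorentzGroup) where
  /-- The vertices of a lift to hyperbolic space. -/
  vertex : Fin 4 → Hyp3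
  nondegenerate : LinearIndependent ℝ (fun i => (vertex i).1)
  embedded : InjOn (hypProj Γ) (hypSimplex vertex Finset.univ)

namespace GeodesicTetrahedron

variable {Γ : Subgroup LorentzGroup} (Δ : GeodesicTetrahedron Γ)

/-- The closed face of the tetrahedron spanned by the vertices in `S`. -/
def cell (S : Finset (Fin 4)) : Set (HypManifold Γ) := hypProj Γ '' hypSimplex Δ.vertex S

/-- The relative interior of the face spanned by the vertices in `S`. -/
def openCell (S : Finset (Fin 4)) : Set (HypManifold Γ) := hypProj Γ '' hypOpenSimplex Δ.vertex S

/-- The tetrahedron, as a subset of the manifold. -/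
def carrier : Set (HypManifold Γ) := Δ.cell Finset.univ

/-- The edge joining the vertices `i` and `j`. -/
def edge (i j : Fin 4) : Set (HypManifold Γ) := Δ.cell {i, j}

/-- The 2-dimensional face opposite to the vertex `k`. -/
def face (k : Fin 4) : Set (HypManifold Γ) := Δ.cell (Finset.univ.erase k)

/-- The boundary of the tetrahedron. -/
def boundary : Set (HypManifold Γ) := ⋃ k, Δ.face k

end GeodesicTetrahedron

/-! ### Normal discs -/

section NormalDiscs

variable {Γ : Subgroup LorentzGroup} (Δ : GeodesicTetrahedron Γ)

/-- A normal arc in the face opposite to `k`: an arc properly embedded in this face, whose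
endpoints lie in the interiors of two distinct edges of the face. -/
def IsNormalArc (k : Fin 4) (α : Set (HypManifold Γ)) : Prop :=
  ∃ a b c : Fin 4, a ≠ b ∧ a ≠ c ∧ b ≠ c ∧ a ≠ k ∧ b ≠ k ∧ c ≠ k ∧
    ∃ h : unitInterval ≃ₜ α,
      (h 0 : HypManifold Γ) ∈ Δ.openCell {c, a} ∧
      (h 1 : HypManifold Γ) ∈ Δ.openCell {c, b} ∧
      ∀ t, t ≠ 0 → t ≠ 1 → (h t : HypManifold Γ) ∈ Δ.openCell (Finset.univ.erase k)

/-- `D` is a closed disc properly embedded in the tetrahedron. -/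
def IsProperDisc (D : Set (HypManifold Γ)) : Prop :=
  D ⊆ Δ.carrier ∧
    ∃ h : Metric.closedBall (0 : EuclideanSpace ℝ (Fin 2)) 1 ≃ₜ D,
      ∀ z, (h z : HypManifold Γ) ∈ Δ.boundary ↔ ‖(z : EuclideanSpace ℝ (Fin 2))‖ = 1

/-- `D` is a normal disc separating the vertices in `S` from the other vertices: a properly
embedded disc that misses the vertices, meets each edge from `S` to its complement exactly once
and no other edge, and meets each face whose vertices it separates in a single normal arc and no
other face. -/
def IsNormalDiscOfType (S : Finset (Fin 4)) (D : Set (HypManifold Γ)) : Prop :=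
  IsProperDisc Δ D ∧
  (∀ i, hypProj Γ (Δ.vertex i) ∉ D) ∧
  (∀ i ∈ S, ∀ j ∉ S, ∃ p, D ∩ Δ.edge i j = {p}) ∧
  (∀ i j, (i ∈ S ↔ j ∈ S) → D ∩ Δ.edge i j = ∅) ∧
  (∀ k, (∃ i j, i ≠ k ∧ j ≠ k ∧ i ∈ S ∧ j ∉ S) → IsNormalArc Δ k (D ∩ Δ.face k)) ∧
  (∀ k, ¬ (∃ i j, i ≠ k ∧ j ≠ k ∧ i ∈ S ∧ j ∉ S) → D ∩ Δ.face k = ∅)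

/-- A normal triangle: it separates one vertex from the other three. -/
def IsNormalTriangle (D : Set (HypManifold Γ)) : Prop :=
  ∃ i, IsNormalDiscOfType Δ {i} D

/-- A normal square: it separates two vertices from the other two. -/
def IsNormalSquare (D : Set (HypManifold Γ)) : Prop :=
  ∃ S : Finset (Fin 4), S.card = 2 ∧ IsNormalDiscOfType Δ S D

end NormalDiscs

/-- The set of connected components of a subset of a topological space. -/
def componentsOf {X : Type*} [TopologicalSpace X] (Y : Set X) : Set (Set X) :=
  {D | ∃ p ∈ Y, D = connectedComponentIn Y p}

/-! ### Surfaces -/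

section Surfaces

variable (Γ : Subgroup LorentzGroup) (F : Set (HypManifold Γ))

/-- The preimage of `F` in hyperbolic space, as a subset of Minkowski space. -/
def surfaceLift : Set MinkSpace := {u | ∃ h : u ∈ Hyp3, hypProj Γ ⟨u, h⟩ ∈ F}

/-- `F` is a properly embedded smooth surface: a closed subset that is locally the regular zero
set of a smooth function. (The covering map is a local diffeomorphism, so this may be expressed
through the preimage in hyperbolic space. The manifold has no boundary, so neither has `F`.) -/
def IsProperSurface : Prop :=
  IsClosed F ∧
  ∀ u ∈ surfaceLift Γ F, ∃ (U : Set MinkSpace) (g : MinkSpace → ℝ),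
    IsOpen U ∧ u ∈ U ∧ ContDiffOn ℝ ∞ g U ∧
    (∀ w ∈ U ∩ Hyp3, w ∈ surfaceLift Γ F ↔ g w = 0) ∧
    ∃ t, mink u t = 0 ∧ fderiv ℝ g u t ≠ 0

/-- `F` is two-sided: it has a continuous unit normal field in the manifold, that is, its preimage
in hyperbolic space has a continuous unit normal field invariant under `Γ`. -/
def IsTwoSided : Prop :=
  ∃ n : MinkSpace → MinkSpace, ContinuousOn n (surfaceLift Γ F) ∧
    ∀ u ∈ surfaceLift Γ F,
      mink u (n u) = 0 ∧ mink (n u) (n u) = 1 ∧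
      (∀ t ∈ tangentConeAt ℝ (surfaceLift Γ F) u, mink (n u) t = 0) ∧
      ∀ γ ∈ Γ, n (γ.1 u) = γ.1 (n u)

/-- The length of a `C¹` curve in the hyperboloid, parametrised by `[0, 1]`. -/
noncomputable def hypLength (c : ℝ → MinkSpace) : ℝ :=
  ∫ t in (0 : ℝ)..1,
    Real.sqrt (mink (derivWithin c (Icc 0 1) t) (derivWithin c (Icc 0 1) t))

/-- The distance between two points of `F` in its induced Riemannian metric: the infimum of the
lengths of the `C¹` curves in `F` that join them (`∞` if there are none). A curve in `F` is given
by a lift to hyperbolic space. -/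
noncomputable def surfaceDist (p q : HypManifold Γ) : ℝ≥0∞ :=
  ⨅ (c : ℝ → MinkSpace) (_ : ContDiffOn ℝ 1 c (Icc 0 1) ∧ MapsTo c (Icc 0 1) (surfaceLift Γ F) ∧
      (∃ h, hypProj Γ ⟨c 0, h⟩ = p) ∧ (∃ h, hypProj Γ ⟨c 1, h⟩ = q)),
    ENNReal.ofReal (hypLength c)

/-- The open ball of radius `r` about `p` in `F` with its induced Riemannian metric. -/
def surfaceBall (p : HypManifold Γ) (r : ℝ) : Set (HypManifold Γ) :=
  {q | q ∈ F ∧ surfaceDist Γ F p q < ENNReal.ofReal r}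

end Surfaces

/-! ### Tangent and normal vectors of subsets of Euclidean space

For a smoothly embedded submanifold `X`, possibly with boundary and corners, `tangentConeAt ℝ X y`
consists of the tangent vectors `t` at `y` such that `t` or `-t` is a limit of rescaled
differences of points of `X`; it spans the tangent space of `X` at `y`, and is equal to it where
`y` is not a corner. -/

/-- `t` is a nonzero tangent vector to `X` at `y`. -/
def IsTangentVector (X : Set E3) (y t : E3) : Prop :=
  y ∈ X ∧ t ≠ 0 ∧ t ∈ tangentConeAt ℝ X y

/-- `n` is a nonzero normal vector to `X` at `y`. -/
def IsNormalVector (X : Set E3) (y n : E3) : Prop :=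
  y ∈ X ∧ n ≠ 0 ∧ ∀ t ∈ tangentConeAt ℝ X y, inner ℝ n t = 0

/-! ### Sufficient transversality -/

section Transversality

open Real InnerProductGeometry

variable (Γ : Subgroup LorentzGroup)

/-- `F` has `(η, δ)`-almost constant normals near the point `x = manifoldExp Γ A 0`. -/
def HasAlmostConstantNormals (F : Set (HypManifold Γ)) (A : LorentzGroup) (η δ : ℝ) : Prop :=
  ∀ y₁ y₂ n₁ n₂ : E3, IsNormalVector (pullBack Γ A η F) y₁ n₁ →
    IsNormalVector (pullBack Γ A η F) y₂ n₂ → angle n₁ n₂ ≤ δ ∨ π - δ ≤ angle n₁ n₂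

/-- The vector `v`, tangent to the manifold at `manifoldExp Γ A 0`, is
`(η, δ)`-nonperpendicular to the edges of `Δ`. -/
def IsNonperpendicular (Δ : GeodesicTetrahedron Γ) (A : LorentzGroup) (η δ : ℝ) (v : E3) : Prop :=
  ∀ i j, i ≠ j → ∀ y t : E3, IsTangentVector (pullBack Γ A η (Δ.edge i j)) y t →
    angle t v < π / 2 - δ ∨ π / 2 + δ < angle t v

/-- `F` is sufficiently transverse to `Δ` at scale `η`. The point `x` of the definition is
`manifoldExp Γ A 0`. Unit normals of a face and unit tangents of an edge are defined up to sign,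
so the angles between them are compared up to sign. -/
def IsSufficientlyTransverse (F : Set (HypManifold Γ)) (Δ : GeodesicTetrahedron Γ) (η : ℝ) :
    Prop :=
  0 < η ∧ (∀ i, hypProj Γ (Δ.vertex i) ∉ F) ∧
  (F ∩ Δ.carrier = ∅ ∨
    ∃ (A : LorentzGroup) (δ : ℝ),
      manifoldExp Γ A 0 ∈ Δ.carrier ∧ 0 < δ ∧ δ < π / 6 ∧
      ENNReal.ofReal η < injRadius Γ A ∧
      (∀ p ∈ Δ.carrier, manifoldDist Γ (manifoldExp Γ A 0) p ≤ η / 4) ∧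
      HasAlmostConstantNormals Γ F A η (δ / 5) ∧
      (∃ y v : E3, y ∈ pullBack Γ A η Δ.carrier ∧ IsNormalVector (pullBack Γ A η F) y v ∧
        ‖v‖ = 1 ∧ IsNonperpendicular Γ Δ A η (2 * δ) v) ∧
      (∀ k, ∀ y₁ y₂ n₁ n₂ : E3, IsNormalVector (pullBack Γ A η (Δ.face k)) y₁ n₁ →
        IsNormalVector (pullBack Γ A η (Δ.face k)) y₂ n₂ →
        angle n₁ n₂ ≤ δ ∨ π - δ ≤ angle n₁ n₂) ∧
      (∀ i j, i ≠ j → ∀ y₁ y₂ t₁ t₂ : E3,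
        IsTangentVector (pullBack Γ A η (Δ.edge i j)) y₁ t₁ →
        IsTangentVector (pullBack Γ A η (Δ.edge i j)) y₂ t₂ →
        angle t₁ t₂ ≤ δ ∨ π - δ ≤ angle t₁ t₂))

end Transversality

/-! Work in exponential coordinates at `x`. By condition 2 all normals of the surface there are, up
to sign, within `δ / 5 < π / 30` of one unit vector `v`. Hence each point of the surface in the
tetrahedron lies on a sheet, an isolated graph of small slope over the disc of radius `3 / 4 * η`
orthogonal to `v` (`exists_isSheet`). By condition 3 each edge, suitably oriented, descends with
respect to all vectors of the cone around `v` at once (`descends_of_isNonperpendicular`).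

Geodesics off the origin are curved in these coordinates, so it is not evident that descent along
edges forces descent along other geodesics of the tetrahedron. This is the heart of the proof,
`inner_kleinTangent_join_neg`: if a linear function descends along all geodesics from the points of
`A` to those of `B`, it does so along all geodesics between their convex hulls. In the Klein model
geodesics are line segments, and exponential coordinates arise by multiplying `k` by `stretch (‖k‖ ^
2)`. The derivative of `inner ν` at `b`, in the direction away from `a`, has the sign of `inner ν b
* tilt a b - inner ν a`. Since `tilt a b` is affine in `a` and `1 / tilt a b` is concave in `b`
(`tilt_mul_le_one`), negativity passes to convex combinations. The concavity holds because `tilt` is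
a limit of sums `∑ m / q` in which every `q` is a concave quotient of a Lorentzian form by a linear
form. Such sums come from Riemann sums by diagonalising a rank one perturbation of a diagonal
matrix.

A sheet that meets the tetrahedron therefore has vertices on both sides, and every geodesic from the
face spanned by the upper vertices to the face spanned by the lower ones crosses it exactly once,
downward (`existsUnique_join`). So the sheet is parametrised by the product of two opposite faces: a
triangle for the splitting 1 + 3, a square for 2 + 2 (`isNormal_of_meetsJoinsOnce`). Sheets are
relatively open and closed in the surface, so these discs are the components, and compactness leaves
finitely many.

A curve in the surface of length less than `η / 2` that ends in the tetrahedron, which lies within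
`η / 4` of the origin, stays within `3 / 4 * η`. There it cannot change sheets; hence two discs near
the same point `p` of the surface coincide. -/

/-! ### Concave quotients, parallel sums and rank one perturbations. -/

section Core

variable {V : Type*} [NormedAddCommGroup V] [InnerProductSpace ℝ V]

theorem inner_lt_one_of_norm {v b : V} (hv : ‖v‖ ≤ 1) (hb : ‖b‖ < 1) : inner ℝ v b < 1 := by
  have h1 := real_inner_le_norm v b
  have h2 : ‖v‖ * ‖b‖ ≤ 1 * ‖b‖ := mul_le_mul_of_nonneg_right hv (norm_nonneg b)
  linarith

theorem one_sub_mul_inner_pos {v b : V} (hv : ‖v‖ ≤ 1) (hb : ‖b‖ < 1) {k : ℝ} (hk0 : 0 ≤ k)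
    (hk1 : k ≤ 1) : 0 < 1 - k * inner ℝ v b := by
  have h := inner_lt_one_of_norm hv hb
  rcases le_or_gt (inner ℝ v b) 0 with h0 | h0
  · nlinarith
  · nlinarith

theorem one_sub_mul_normSq_pos {V : Type*} [NormedAddCommGroup V] {b : V} (hb : ‖b‖ < 1) {k : ℝ}
    (hk1 : k ≤ 1) : 0 < 1 - k * ‖b‖ ^ 2 := by
  have h : ‖b‖ ^ 2 < 1 := by nlinarith [norm_nonneg b]
  nlinarith [sq_nonneg ‖b‖]

/-- The quotient of a Lorentzian quadratic form by a timelike linear form is concave. -/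
theorem lorentz_quotient_concave {v b₁ b₂ : V} (hv : ‖v‖ ≤ 1) (h₁ : ‖b₁‖ < 1) (h₂ : ‖b₂‖ < 1)
    {k c d : ℝ} (hk0 : 0 ≤ k) (hk1 : k ≤ 1) (hc : 0 ≤ c) (hd : 0 ≤ d) (hcd : c + d = 1)
    (hb : ‖c • b₁ + d • b₂‖ < 1) :
    c * ((1 - k * ‖b₁‖ ^ 2) / (1 - k * inner ℝ v b₁)) +
      d * ((1 - k * ‖b₂‖ ^ 2) / (1 - k * inner ℝ v b₂)) ≤
      (1 - k * ‖c • b₁ + d • b₂‖ ^ 2) / (1 - k * inner ℝ v (c • b₁ + d • b₂)) := by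
  have n1 := one_sub_mul_inner_pos hv h₁ hk0 hk1
  have n2 := one_sub_mul_inner_pos hv h₂ hk0 hk1
  have n := one_sub_mul_inner_pos hv hb hk0 hk1
  have hn : 1 - k * inner ℝ v (c • b₁ + d • b₂) =
      c * (1 - k * inner ℝ v b₁) + d * (1 - k * inner ℝ v b₂) := by
    rw [inner_add_right, inner_smul_right, inner_smul_right]
    linear_combination (-1) * hcd
  have hq : 1 - k * ‖c • b₁ + d • b₂‖ ^ 2 = c ^ 2 * (1 - k * ‖b₁‖ ^ 2) +
      d ^ 2 * (1 - k * ‖b₂‖ ^ 2) + 2 * c * d * (1 - k * inner ℝ b₁ b₂) := by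
    rw [← real_inner_self_eq_norm_sq, ← real_inner_self_eq_norm_sq, ← real_inner_self_eq_norm_sq]
    simp only [inner_add_right, inner_smul_right, inner_add_left, inner_smul_left, conj_trivial]
    rw [real_inner_comm b₁ b₂]
    linear_combination (-(c + d) - 1) * hcd
  set x₁ := 1 - k * inner ℝ v b₁ with hx1
  set x₂ := 1 - k * inner ℝ v b₂ with hx2
  -- In homogeneous coordinates the vector `x₂ • (1, b₁) - x₁ • (1, b₂)` is annihilated by a
  -- timelike linear form, so it is not timelike itself. The defect in the concavity inequality is
  -- `c * d` times the defect here, over positive factors.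
  have key : (x₂ - x₁) ^ 2 ≤ k * ‖x₂ • b₁ - x₁ • b₂‖ ^ 2 := by
    have e : x₂ - x₁ = k * inner ℝ v (x₂ • b₁ - x₁ • b₂) := by
      rw [inner_sub_right, inner_smul_right, inner_smul_right]
      have e1 : k * inner ℝ v b₁ = 1 - x₁ := by rw [hx1]; ring
      have e2 : k * inner ℝ v b₂ = 1 - x₂ := by rw [hx2]; ring
      linear_combination (-x₂) * e1 + x₁ * e2
    rw [e, mul_pow]
    have hcs : (inner ℝ v (x₂ • b₁ - x₁ • b₂)) ^ 2 ≤ ‖x₂ • b₁ - x₁ • b₂‖ ^ 2 := by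
      have := abs_real_inner_le_norm v (x₂ • b₁ - x₁ • b₂)
      have h3 : |inner ℝ v (x₂ • b₁ - x₁ • b₂)| ≤ ‖x₂ • b₁ - x₁ • b₂‖ :=
        this.trans (mul_le_of_le_one_left (norm_nonneg _) hv)
      rw [← sq_abs]
      exact pow_le_pow_left₀ (abs_nonneg _) h3 2
    have : k ^ 2 ≤ k := by nlinarith
    calc _ ≤ k ^ 2 * ‖x₂ • b₁ - x₁ • b₂‖ ^ 2 := by gcongr
      _ ≤ _ := by gcongr
  have hexp : ‖x₂ • b₁ - x₁ • b₂‖ ^ 2 =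
      x₂ ^ 2 * ‖b₁‖ ^ 2 - 2 * x₁ * x₂ * inner ℝ b₁ b₂ + x₁ ^ 2 * ‖b₂‖ ^ 2 := by
    rw [← real_inner_self_eq_norm_sq, ← real_inner_self_eq_norm_sq, ← real_inner_self_eq_norm_sq]
    simp only [inner_sub_right, inner_smul_right, inner_sub_left, inner_smul_left, conj_trivial]
    rw [real_inner_comm b₁ b₂]
    ring
  rw [hexp] at key
  rw [hn, hq]
  rw [hn] at n
  rw [le_div_iff₀ n]
  have e : c * ((1 - k * ‖b₁‖ ^ 2) / x₁) + d * ((1 - k * ‖b₂‖ ^ 2) / x₂) =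
      (c * (1 - k * ‖b₁‖ ^ 2) * x₂ + d * (1 - k * ‖b₂‖ ^ 2) * x₁) / (x₁ * x₂) := by
    field_simp
  rw [e, div_mul_eq_mul_div, div_le_iff₀ (mul_pos n1 n2)]
  have hcd0 : 0 ≤ c * d := mul_nonneg hc hd
  nlinarith [mul_le_mul_of_nonneg_left key hcd0]

end Core

/-- Parallel sums of concave functions are concave. -/
theorem parallel_sum_concave {ι : Type*} (s : Finset ι) (m p q r : ι → ℝ) {c d : ℝ}
    (hm : ∀ i ∈ s, 0 ≤ m i) (hp : ∀ i ∈ s, 0 < p i) (hq : ∀ i ∈ s, 0 < q i)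
    (hc : 0 ≤ c) (hd : 0 ≤ d) (hcd : c + d = 1)
    (hr : ∀ i ∈ s, c * p i + d * q i ≤ r i)
    (hP : 0 < ∑ i ∈ s, m i / p i) (hQ : 0 < ∑ i ∈ s, m i / q i) :
    (∑ i ∈ s, m i / r i) * (c / (∑ i ∈ s, m i / p i) + d / (∑ i ∈ s, m i / q i)) ≤ 1 := by
  set P := ∑ i ∈ s, m i / p i
  set Q := ∑ i ∈ s, m i / q i
  set R := c / P + d / Q with hR
  have hRpos : 0 < R := by
    rcases hc.lt_or_eq with h | h
    · have : 0 ≤ d / Q := by positivity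
      have : 0 < c / P := by positivity
      linarith
    · have : d = 1 := by linarith
      rw [hR, ← h, this]; simpa using hQ
  have step : ∀ i ∈ s, m i / r i * R ^ 2 ≤ c / P ^ 2 * (m i / p i) + d / Q ^ 2 * (m i / q i) := by
    intro i hi
    have p0 := hp i hi
    have q0 := hq i hi
    have hx : 0 < c * p i + d * q i := by
      rcases hc.lt_or_eq with h | h
      · have : 0 ≤ d * q i := by positivity
        have : 0 < c * p i := by positivity
        linarith
      · have : d = 1 := by linarith
        rw [← h, this]; simpa using q0
    have h1 : m i / r i ≤ m i / (c * p i + d * q i) :=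
      div_le_div_of_nonneg_left (hm i hi) hx (hr i hi)
    -- The Cauchy–Schwarz inequality. Summed with the weights `m i`, its right-hand side becomes `c
    -- / P + d / Q = R`.
    have h2 : R ^ 2 / (c * p i + d * q i) ≤ c / P ^ 2 / p i + d / Q ^ 2 / q i := by
      rw [div_le_iff₀ hx, hR]
      have : (c / P ^ 2 / p i + d / Q ^ 2 / q i) * (c * p i + d * q i) - (c / P + d / Q) ^ 2
          = c * d * ((1 / P) * q i - (1 / Q) * p i) ^ 2 / (p i * q i) := by
        field_simp
        ring
      have h3 : 0 ≤ c * d * ((1 / P) * q i - (1 / Q) * p i) ^ 2 / (p i * q i) := by positivity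
      linarith
    calc m i / r i * R ^ 2 ≤ m i / (c * p i + d * q i) * R ^ 2 := by gcongr
      _ = m i * (R ^ 2 / (c * p i + d * q i)) := by ring
      _ ≤ m i * (c / P ^ 2 / p i + d / Q ^ 2 / q i) := mul_le_mul_of_nonneg_left h2 (hm i hi)
      _ = _ := by ring
  have hsum := Finset.sum_le_sum step
  rw [← Finset.sum_mul, Finset.sum_add_distrib, ← Finset.mul_sum, ← Finset.mul_sum] at hsum
  have e : c / P ^ 2 * P + d / Q ^ 2 * Q = R := by rw [hR]; field_simp
  have : (∑ i ∈ s, m i / r i) * R * R ≤ 1 * R := by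
    calc _ = (∑ i ∈ s, m i / r i) * R ^ 2 := by ring
      _ ≤ c / P ^ 2 * P + d / Q ^ 2 * Q := hsum
      _ = _ := by rw [e, one_mul]
  exact le_of_mul_le_mul_right this hRpos

/-- Rank one perturbation of a diagonal resolvent, diagonalised. -/
theorem exists_stieltjes_of_rank_one {n : ℕ} (t w : Fin n → ℝ) (ht : ∀ i, 0 ≤ t i ∧ t i ≤ 1)
    (hw : ∀ i, 0 ≤ w i) (hw1 : ∑ i, w i ≤ 1) :
    ∃ k m : Fin n → ℝ, (∀ j, 0 ≤ k j ∧ k j ≤ 1) ∧ (∀ j, 0 ≤ m j) ∧ ∑ j, m j ≤ 1 ∧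
      ∀ s : ℝ, 0 ≤ s → s < 1 →
        (∑ i, w i * (1 - t i) / (1 - s * t i)) =
          (∑ j, m j * k j / (1 - s * k j)) *
            (1 - s * ∑ i, w i * (1 - t i) / (1 - s * t i)) := by
  -- With `T = diag t`, the given sum is `p = ⟨e, (1 - s T)⁻¹ e⟩`. For `K = T + e ⊗ e` the
  -- Sherman–Morrison formula gives `⟨e, (1 - s K)⁻¹ e⟩ = p / (1 - s p)`, and an eigenbasis of `K`
  -- turns the left side into partial fractions.
  set e : EuclideanSpace ℝ (Fin n) := WithLp.toLp 2 fun i => √(w i * (1 - t i)) with he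
  have hwt : ∀ i, 0 ≤ w i * (1 - t i) := fun i => mul_nonneg (hw i) (by linarith [(ht i).2])
  have hee : ∀ i, e i * e i = w i * (1 - t i) := fun i => Real.mul_self_sqrt (hwt i)
  let K : EuclideanSpace ℝ (Fin n) →ₗ[ℝ] EuclideanSpace ℝ (Fin n) :=
    { toFun := fun f => WithLp.toLp 2 fun i => t i * f i + inner ℝ e f * e i
      map_add' := fun f g => by
        ext i; simp [inner_add_right]; ring
      map_smul' := fun a f => by
        ext i; simp [inner_smul_right]; ring }
  have hK : ∀ f g, inner ℝ (K f) g = ∑ i, t i * f i * g i + inner ℝ e f * inner ℝ e g := by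
    intro f g
    simp only [PiLp.inner_apply, K, LinearMap.coe_mk, AddHom.coe_mk, Finset.mul_sum,
      ← Finset.sum_add_distrib]
    refine Finset.sum_congr rfl fun i _ => ?_
    simp
    ring
  have hsym : K.IsSymmetric := by
    intro f g
    rw [real_inner_comm (K g) f, hK, hK]
    rw [mul_comm (inner ℝ e f)]
    congr 1
    exact Finset.sum_congr rfl fun i _ => by ring
  have hn : Module.finrank ℝ (EuclideanSpace ℝ (Fin n)) = n := by simp
  set b := hsym.eigenvectorBasis hn with hb
  set k := hsym.eigenvalues hn with hk
  have hKb : ∀ j, K (b j) = k j • b j := fun j => by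
    exact hsym.apply_eigenvectorBasis hn j
  set c : Fin n → ℝ := fun j => inner ℝ e (b j) with hc
  have hnorm : ∀ j, inner ℝ (b j) (b j) = (1 : ℝ) := fun j => by
    rw [real_inner_self_eq_norm_sq, b.orthonormal.1 j]; norm_num
  have hkj : ∀ j, k j = ∑ i, t i * b j i * b j i + c j * c j := fun j => by
    rw [← hK, hKb, inner_smul_left, hnorm]; simp
  have hsq : ∀ f : EuclideanSpace ℝ (Fin n), inner ℝ f f = ∑ i, f i * f i := fun f => by
    rw [PiLp.inner_apply]; exact Finset.sum_congr rfl fun i _ => rfl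
  have hkc : ∀ j, c j * c j ≤ k j := fun j => by
    rw [hkj]
    have : 0 ≤ ∑ i, t i * b j i * b j i := Finset.sum_nonneg fun i _ => by
      rw [mul_assoc]; exact mul_nonneg (ht i).1 (mul_self_nonneg _)
    linarith
  -- This says `e ⊗ e ≤ 1 - T`, whence `K ≤ 1`. It is the Cauchy–Schwarz inequality for the weights
  -- `w`, whose total mass is at most one.
  have hcs : ∀ f : EuclideanSpace ℝ (Fin n), (inner ℝ e f) ^ 2 ≤ ∑ i, (1 - t i) * f i * f i := by
    intro f
    have h1 : inner ℝ e f = ∑ i, √(w i) * (√(1 - t i) * f i) := by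
      simp only [PiLp.inner_apply, he]
      refine Finset.sum_congr rfl fun i _ => ?_
      simp [Real.sqrt_mul (hw i)]
      ring
    rw [h1]
    refine (Finset.sum_mul_sq_le_sq_mul_sq _ _ _).trans ?_
    have h2 : ∑ i, √(w i) ^ 2 ≤ 1 := by
      refine le_trans (le_of_eq ?_) hw1
      exact Finset.sum_congr rfl fun i _ => Real.sq_sqrt (hw i)
    have h3 : ∑ i, (√(1 - t i) * f i) ^ 2 = ∑ i, (1 - t i) * f i * f i := by
      refine Finset.sum_congr rfl fun i _ => ?_
      rw [mul_pow, Real.sq_sqrt (by linarith [(ht i).2])]; ring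
    rw [h3]
    refine mul_le_of_le_one_left (Finset.sum_nonneg fun i _ => ?_) h2
    rw [mul_assoc]; exact mul_nonneg (by linarith [(ht i).2]) (mul_self_nonneg _)
  have hk1 : ∀ j, k j ≤ 1 := fun j => by
    have h1 := hcs (b j)
    have h2 := hnorm j
    rw [hsq] at h2
    rw [hkj]
    have h3 : ∑ i, (1 - t i) * b j i * b j i = 1 - ∑ i, t i * b j i * b j i := by
      rw [eq_sub_iff_add_eq, ← Finset.sum_add_distrib]
      refine Eq.trans ?_ h2
      exact Finset.sum_congr rfl fun i _ => by ring
    rw [h3] at h1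
    have : c j * c j = (inner ℝ e (b j)) ^ 2 := by rw [hc]; ring
    linarith
  have hk0 : ∀ j, 0 ≤ k j := fun j => (mul_self_nonneg _).trans (hkc j)
  -- If `k j = 0`, the quotient is `0` by convention; this is harmless, since `c j` vanishes as
  -- well.
  set m : Fin n → ℝ := fun j => c j ^ 2 / k j with hm
  have hm0 : ∀ j, 0 ≤ m j := fun j => div_nonneg (sq_nonneg _) (hk0 j)
  have hmk : ∀ j, m j * k j = c j ^ 2 := fun j => by
    rcases (hk0 j).lt_or_eq with h | h
    · simp only [hm]; field_simp
    · have := hkc j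
      rw [← h] at this ⊢
      have : c j = 0 := mul_self_eq_zero.1 (le_antisymm this (mul_self_nonneg _))
      simp [this]
  refine ⟨k, m, fun j => ⟨hk0 j, hk1 j⟩, hm0, ?_, ?_⟩
  · -- the total mass, tested on `z = ∑ (c j / k j) • b j`
    set z : EuclideanSpace ℝ (Fin n) := ∑ j, (c j / k j) • b j with hz
    have hez : inner ℝ e z = ∑ j, m j := by
      rw [hz, inner_sum]
      refine Finset.sum_congr rfl fun j _ => ?_
      rw [inner_smul_right]; simp only [hm, hc]; ring
    have hKz : inner ℝ (K z) z = ∑ j, m j := by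
      rw [hz, map_sum, ← hz, sum_inner]
      refine Finset.sum_congr rfl fun j _ => ?_
      rw [map_smul, hKb, inner_smul_left, inner_smul_left, hz, inner_sum]
      have : ∑ i, inner ℝ (b j) ((c i / k i) • b i) = c j / k j := by
        rw [Finset.sum_eq_single j]
        · rw [inner_smul_right, hnorm]; simp
        · intro i _ hij
          rw [inner_smul_right, b.orthonormal.2 hij.symm, mul_zero]
        · simp
      rw [this]
      simp only [conj_trivial, hm]
      rcases (hk0 j).lt_or_eq with h | h
      · field_simp
      · rw [← h]; simp
    -- `⟨K z, z⟩` and `⟨e, z⟩` both equal the total mass, and `⟨K z, z⟩ ≥ ⟨e, z⟩ ^ 2`; so the mass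
    -- is at least its own square.
    have h1 := hK z z
    rw [hKz, hez] at h1
    have h2 : 0 ≤ ∑ i, t i * z i * z i := Finset.sum_nonneg fun i _ => by
      rw [mul_assoc]; exact mul_nonneg (ht i).1 (mul_self_nonneg _)
    have h3 : 0 ≤ ∑ j, m j := Finset.sum_nonneg fun j _ => hm0 j
    nlinarith
  · intro s hs0 hs1
    set p := ∑ i, w i * (1 - t i) / (1 - s * t i) with hp
    have hd : ∀ i, 0 < 1 - s * t i := fun i => by nlinarith [(ht i).1, (ht i).2]
    have hdk : ∀ j, 0 < 1 - s * k j := fun j => by nlinarith [hk0 j, hk1 j]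
    set z : EuclideanSpace ℝ (Fin n) := WithLp.toLp 2 fun i => e i / (1 - s * t i) with hz
    have hez : inner ℝ e z = p := by
      simp only [PiLp.inner_apply, hp]
      refine Finset.sum_congr rfl fun i _ => ?_
      rw [← hee]
      simp [hz]
      ring
    have hzK : z - s • K z = (1 - s * p) • e := by
      ext i
      have h1 : (K z) i = t i * z i + p * e i := by rw [← hez]; rfl
      have h2 : z i = e i / (1 - s * t i) := rfl
      simp only [PiLp.sub_apply, PiLp.smul_apply, smul_eq_mul, h1, h2]
      have := (hd i).ne'
      field_simp
      ring
    have hzj : ∀ j, inner ℝ z (b j) = (1 - s * p) * c j / (1 - s * k j) := fun j => by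
      have h1 : inner ℝ (z - s • K z) (b j) = (1 - s * p) * c j := by
        rw [hzK, inner_smul_left]; simp [hc]
      rw [inner_sub_left, inner_smul_left, hsym z (b j), hKb, inner_smul_right] at h1
      rw [eq_div_iff (hdk j).ne', ← h1]
      simp only [conj_trivial]
      ring
    have h4 := b.sum_inner_mul_inner e z
    rw [hez] at h4
    rw [← h4, Finset.sum_mul]
    refine Finset.sum_congr rfl fun j _ => ?_
    rw [hmk, real_inner_comm z (b j), hzj, ← h4]
    simp only [hc]
    have := (hdk j).ne'
    rw [h4]
    ring

/-! ### The radial factor between the Klein model and exponential coordinates. -/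

/-- `stretch (r ^ 2) = artanh r / r`: the factor by which the passage from the Klein model to
exponential coordinates stretches a point at Klein distance `r` from the origin. -/
noncomputable def stretch (s : ℝ) : ℝ := ∫ x in (0 : ℝ)..1, 1 / (1 - s * x ^ 2)

/-- An auxiliary integral, which determines the derivative of `stretch`. -/
noncomputable def stretchAux (s : ℝ) : ℝ := ∫ x in (0 : ℝ)..1, (1 - x ^ 2) / (1 - s * x ^ 2)

theorem one_sub_mul_sq_pos {s x : ℝ} (hs : s < 1) (hx : x ∈ Icc (0 : ℝ) 1) :
    0 < 1 - s * x ^ 2 := by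
  have h1 : x ^ 2 ≤ 1 := by nlinarith [hx.1, hx.2]
  rcases le_or_gt s 0 with h | h
  · nlinarith [sq_nonneg x]
  · nlinarith [sq_nonneg x]

theorem continuousOn_stretch_integrand {s : ℝ} (hs : s < 1) {f : ℝ → ℝ} (hf : Continuous f) :
    ContinuousOn (fun x => f x / (1 - s * x ^ 2)) (uIcc 0 1) := by
  rw [uIcc_of_le zero_le_one]
  exact hf.continuousOn.div (by fun_prop) fun x hx => (one_sub_mul_sq_pos hs hx).ne'

/-- Combined with `hasDerivAt_stretch`, this expresses the logarithmic derivative of `stretch`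
through `stretchAux` alone; it is the source of the coefficients in `tilt` and `kleinTangent`. -/
theorem one_sub_mul_stretch {s : ℝ} (hs : s < 1) :
    (1 - s) * stretch s = 1 - s * stretchAux s := by
  have h1 := (continuousOn_stretch_integrand hs (f := fun _ => 1) continuous_const).intervalIntegrable
    (μ := MeasureTheory.volume)
  have h2 := (continuousOn_stretch_integrand hs (f := fun x => 1 - x ^ 2)
    (by fun_prop)).intervalIntegrable (μ := MeasureTheory.volume)
  have h3 : (1 - s) * stretch s + s * stretchAux s = ∫ x in (0 : ℝ)..1, (1 : ℝ) := by
    rw [stretch, stretchAux, ← intervalIntegral.integral_const_mul,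
      ← intervalIntegral.integral_const_mul,
      ← intervalIntegral.integral_add (h1.const_mul _) (h2.const_mul _)]
    refine intervalIntegral.integral_congr fun x hx => ?_
    rw [uIcc_of_le zero_le_one] at hx
    have := (one_sub_mul_sq_pos hs hx).ne'
    field_simp
    ring
  simp at h3
  linarith

theorem stretchAux_nonneg {s : ℝ} (hs : s < 1) : 0 ≤ stretchAux s := by
  refine intervalIntegral.integral_nonneg zero_le_one fun x hx => ?_
  exact div_nonneg (by nlinarith [hx.1, hx.2]) (one_sub_mul_sq_pos hs hx).le

theorem stretchAux_le_one {s : ℝ} (hs : s < 1) : stretchAux s ≤ 1 := by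
  have h : stretchAux s ≤ ∫ x in (0 : ℝ)..1, (1 : ℝ) := by
    refine intervalIntegral.integral_mono_on zero_le_one
      ((continuousOn_stretch_integrand hs (f := fun x => 1 - x ^ 2)
        (by fun_prop)).intervalIntegrable) (by simp) fun x hx => ?_
    rw [div_le_one (one_sub_mul_sq_pos hs hx)]
    nlinarith [sq_nonneg x]
  simpa using h

theorem stretch_pos {s : ℝ} (hs : s < 1) : 0 < stretch s :=
  intervalIntegral.intervalIntegral_pos_of_pos_on
    ((continuousOn_stretch_integrand hs (f := fun _ => 1) continuous_const).intervalIntegrable)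
    (fun _ hx => one_div_pos.2 (one_sub_mul_sq_pos hs (Ioo_subset_Icc_self hx))) zero_lt_one

theorem one_sub_mul_stretchAux_pos {s : ℝ} (hs : s < 1) : 0 < 1 - s * stretchAux s := by
  rw [← one_sub_mul_stretch hs]
  exact mul_pos (by linarith) (stretch_pos hs)

theorem hasDerivAt_stretch {s : ℝ} (hs : s < 1) :
    HasDerivAt stretch (stretchAux s / (2 * (1 - s))) s := by
  set r := (1 + s) / 2 with hr
  have hr1 : r < 1 := by rw [hr]; linarith
  have hsr : s < r := by rw [hr]; linarith
  have key := intervalIntegral.hasDerivAt_integral_of_dominated_loc_of_deriv_le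
    (μ := MeasureTheory.volume) (a := 0) (b := 1) (x₀ := s) (s := Iio r)
    (F := fun s x => 1 / (1 - s * x ^ 2)) (F' := fun s x => x ^ 2 / (1 - s * x ^ 2) ^ 2)
    (bound := fun x => x ^ 2 / (1 - r * x ^ 2) ^ 2) (Iio_mem_nhds hsr)
    (by
      filter_upwards [Iio_mem_nhds hs] with y hy
      exact ((continuousOn_stretch_integrand hy (f := fun _ => 1)
        continuous_const).mono uIoc_subset_uIcc).aestronglyMeasurable measurableSet_uIoc)
    ((continuousOn_stretch_integrand hs (f := fun _ => 1) continuous_const).intervalIntegrable)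
    (by
      refine ContinuousOn.aestronglyMeasurable ?_ measurableSet_uIoc
      refine ContinuousOn.div (by fun_prop) (by fun_prop) fun x hx => ?_
      rw [uIoc_of_le zero_le_one] at hx
      exact (pow_pos (one_sub_mul_sq_pos hs (Ioc_subset_Icc_self hx)) 2).ne')
    (by
      refine Filter.Eventually.of_forall fun x hx y hy => ?_
      rw [uIoc_of_le zero_le_one] at hx
      have h1 := one_sub_mul_sq_pos hr1 (Ioc_subset_Icc_self hx)
      have h2 : 1 - r * x ^ 2 ≤ 1 - y * x ^ 2 := by
        have : y ≤ r := le_of_lt hy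
        nlinarith [sq_nonneg x]
      rw [Real.norm_of_nonneg (by positivity)]
      gcongr)
    (by
      refine ContinuousOn.intervalIntegrable ?_
      rw [uIcc_of_le zero_le_one]
      exact ContinuousOn.div (by fun_prop) (by fun_prop) fun x hx =>
        (pow_pos (one_sub_mul_sq_pos hr1 hx) 2).ne')
    (by
      refine Filter.Eventually.of_forall fun x hx y hy => ?_
      rw [uIoc_of_le zero_le_one] at hx
      have h1 := (one_sub_mul_sq_pos ((mem_Iio.1 hy).trans hr1) (Ioc_subset_Icc_self hx)).ne'
      have h2 : HasDerivAt (fun y : ℝ => 1 - y * x ^ 2) (-(x ^ 2)) y := by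
        simpa using ((hasDerivAt_id y).mul_const (x ^ 2)).const_sub 1
      have h3 := h2.inv h1
      simp only [neg_neg] at h3
      refine HasDerivAt.congr_of_eventuallyEq h3 (Filter.Eventually.of_forall fun z => ?_)
      simp [one_div])
  -- Integration by parts: the integrand is the derivative of `-x (1 - x ^ 2) / (1 - s x ^ 2)`,
  -- which vanishes at both endpoints.
  have h2 : ∫ x in (0 : ℝ)..1, (2 * (1 - s) * (x ^ 2 / (1 - s * x ^ 2) ^ 2) -
      (1 - x ^ 2) / (1 - s * x ^ 2)) = 0 := by
    have hd : ∀ x ∈ uIcc (0 : ℝ) 1, HasDerivAt (fun x : ℝ => -(x * (1 - x ^ 2) / (1 - s * x ^ 2)))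
        (2 * (1 - s) * (x ^ 2 / (1 - s * x ^ 2) ^ 2) - (1 - x ^ 2) / (1 - s * x ^ 2)) x := by
      intro x hx
      rw [uIcc_of_le zero_le_one] at hx
      have h0 := (one_sub_mul_sq_pos hs hx).ne'
      have hn : HasDerivAt (fun x : ℝ => x * (1 - x ^ 2)) (1 * (1 - x ^ 2) + x * (-(2 * x))) x := by
        refine ((hasDerivAt_id x).fun_mul (((hasDerivAt_pow 2 x)).const_sub 1)).congr_deriv ?_
        simp
      have hm : HasDerivAt (fun x : ℝ => 1 - s * x ^ 2) (-(s * (2 * x))) x := by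
        simpa using ((hasDerivAt_pow 2 x).const_mul s).const_sub 1
      refine (hn.div hm h0).neg.congr_deriv ?_
      field_simp
      ring
    rw [intervalIntegral.integral_eq_sub_of_hasDerivAt hd]
    · simp
    · refine ContinuousOn.intervalIntegrable ?_
      rw [uIcc_of_le zero_le_one]
      refine ContinuousOn.sub (ContinuousOn.mul continuousOn_const ?_) ?_
      · exact ContinuousOn.div (by fun_prop) (by fun_prop) fun x hx =>
          (pow_pos (one_sub_mul_sq_pos hs hx) 2).ne'
      · exact ContinuousOn.div (by fun_prop) (by fun_prop) fun x hx =>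
          (one_sub_mul_sq_pos hs hx).ne'
  rw [intervalIntegral.integral_sub (key.1.const_mul _)
    ((continuousOn_stretch_integrand hs (f := fun x => 1 - x ^ 2)
      (by fun_prop)).intervalIntegrable), intervalIntegral.integral_const_mul] at h2
  refine key.2.congr_deriv ?_
  have : (1 - s) ≠ 0 := by linarith
  rw [eq_div_iff (by positivity)]
  rw [stretchAux]
  linarith

theorem mul_stretch_sq {r : ℝ} (hr0 : 0 ≤ r) (hr : r < 1) :
    r * stretch (r ^ 2) = Real.artanh r := by
  have hlog : ∀ y ∈ Ico (0 : ℝ) 1, Real.artanh y = (Real.log (1 + y) - Real.log (1 - y)) / 2 := by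
    intro y hy
    rw [Real.artanh_eq_half_log ⟨by linarith [hy.1], hy.2.le⟩,
      Real.log_div (by linarith [hy.1]) (by linarith [hy.2])]
    ring
  rw [hlog r ⟨hr0, hr⟩, stretch, ← intervalIntegral.integral_const_mul]
  have hd : ∀ x ∈ uIcc (0 : ℝ) 1, HasDerivAt
      (fun x : ℝ => (Real.log (1 + r * x) - Real.log (1 - r * x)) / 2)
      (r * (1 / (1 - r ^ 2 * x ^ 2))) x := by
    intro x hx
    rw [uIcc_of_le zero_le_one] at hx
    have h0 : 0 ≤ r * x := mul_nonneg hr0 hx.1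
    have h1 : r * x < 1 := by nlinarith [hx.1, hx.2]
    have a1 : HasDerivAt (fun x : ℝ => 1 + r * x) r x := by
      simpa using ((hasDerivAt_id x).const_mul r).const_add 1
    have a2 : HasDerivAt (fun x : ℝ => 1 - r * x) (-r) x := by
      simpa using ((hasDerivAt_id x).const_mul r).const_sub 1
    refine (((a1.log (by linarith)).sub (a2.log (by linarith))).div_const 2).congr_deriv ?_
    have e : 1 - r ^ 2 * x ^ 2 = (1 + r * x) * (1 - r * x) := by ring
    rw [e]
    have p1 : (1 + r * x) ≠ 0 := by linarith
    have p2 : (1 - r * x) ≠ 0 := by linarith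
    field_simp
    ring
  rw [intervalIntegral.integral_eq_sub_of_hasDerivAt hd]
  · simp
  · refine (ContinuousOn.intervalIntegrable ?_)
    exact continuousOn_const.mul
      (continuousOn_stretch_integrand (s := r ^ 2) (by nlinarith) (f := fun _ => 1) continuous_const)

/-- A Riemann sum for `stretchAux`. -/
noncomputable def stretchSum (n : ℕ) (s : ℝ) : ℝ :=
  ∑ i : Fin n, (1 / n : ℝ) * (1 - ((i : ℝ) / n) ^ 2) / (1 - s * ((i : ℝ) / n) ^ 2)

/-- The integrand decreases from `1` to `0`, so the left Riemann sum exceeds the integral by at most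
`1 / n`. Discretising makes the finite-dimensional spectral theorem applicable. -/
theorem tendsto_stretchSum {s : ℝ} (hs : s < 1) :
    Filter.Tendsto (fun n => stretchSum n s) Filter.atTop (𝓝 (stretchAux s)) := by
  have bound : ∀ n : ℕ, 0 < n → stretchAux s ≤ stretchSum n s ∧
      stretchSum n s ≤ stretchAux s + 1 / n := by
    intro n hn
    have hn' : (0 : ℝ) < n := by exact_mod_cast hn
    set f : ℝ → ℝ := fun x => (1 - x ^ 2) / (1 - s * x ^ 2) with hf
    set g : ℝ → ℝ := fun y => f (y / n) with hg
    have hanti : AntitoneOn g (Icc 0 (0 + n)) := by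
      intro x hx y hy hxy
      have hx' : x / n ∈ Icc (0 : ℝ) 1 :=
        ⟨div_nonneg hx.1 hn'.le, (div_le_one hn').2 (by simpa using hx.2)⟩
      have hy' : y / n ∈ Icc (0 : ℝ) 1 :=
        ⟨div_nonneg hy.1 hn'.le, (div_le_one hn').2 (by simpa using hy.2)⟩
      have hxy' : x / n ≤ y / n := by gcongr
      simp only [hg, hf]
      rw [div_le_div_iff₀ (one_sub_mul_sq_pos hs hy') (one_sub_mul_sq_pos hs hx')]
      have : (x / n) ^ 2 ≤ (y / n) ^ 2 := pow_le_pow_left₀ hx'.1 hxy' 2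
      nlinarith
    have hint : ∫ y in (0 : ℝ)..(0 + n), g y = n * stretchAux s := by
      rw [hg, intervalIntegral.integral_comp_div f hn'.ne']
      simp [stretchAux, hf, hn'.ne']
    have h1 := hanti.integral_le_sum
    have h2 := hanti.sum_le_integral
    rw [hint] at h1 h2
    simp only [zero_add] at h1 h2
    have hsum : stretchSum n s = (1 / n) * ∑ i ∈ Finset.range n, g i := by
      rw [stretchSum, Finset.mul_sum, Finset.sum_range]
      refine Finset.sum_congr rfl fun i _ => ?_
      simp only [hg, hf]
      ring
    have hshift : ∑ i ∈ Finset.range n, g i = ∑ i ∈ Finset.range n, g ((i + 1 : ℕ)) + g 0 - g n := by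
      have a := Finset.sum_range_succ (fun i : ℕ => g i) n
      have b := Finset.sum_range_succ' (fun i : ℕ => g i) n
      simp only [Nat.cast_zero] at b
      linarith
    have g0 : g 0 = 1 := by simp [hg, hf]
    have gn : g n = 0 := by simp [hg, hf, hn'.ne']
    rw [hsum]
    constructor
    · rw [div_mul_eq_mul_div, le_div_iff₀ hn']; linarith
    · rw [div_mul_eq_mul_div, div_le_iff₀ hn', add_mul]
      have : (1 / (n : ℝ)) * n = 1 := by field_simp
      rw [this]
      linarith
  refine tendsto_of_tendsto_of_tendsto_of_le_of_le' tendsto_const_nhds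
    (h := fun n : ℕ => stretchAux s + 1 / n) ?_ ?_ ?_
  · have := (tendsto_const_nhds (x := stretchAux s) (f := Filter.atTop (α := ℕ))).add
      (tendsto_one_div_atTop_nhds_zero_nat (𝕜 := ℝ))
    simpa using this
  · filter_upwards [Filter.eventually_gt_atTop 0] with n hn using (bound n hn).1
  · filter_upwards [Filter.eventually_gt_atTop 0] with n hn using (bound n hn).2

/-! ### Concavity of the reciprocal of `tilt`. -/

section Core

variable {V : Type*} [NormedAddCommGroup V] [InnerProductSpace ℝ V]

/-- Up to a positive factor, the derivative at `b` of the logarithm of `1 / stretch (‖b‖ ^ 2)`,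
extended to a homogeneous function, in the direction of `v`. -/
noncomputable def tilt (v b : V) : ℝ :=
  (1 - stretchAux (‖b‖ ^ 2) * inner ℝ v b) / (1 - ‖b‖ ^ 2 * stretchAux (‖b‖ ^ 2))

theorem sq_norm_lt_one {V : Type*} [NormedAddCommGroup V] {b : V} (hb : ‖b‖ < 1) : ‖b‖ ^ 2 < 1 := by
  nlinarith [norm_nonneg b]

theorem tilt_pos {v b : V} (hv : ‖v‖ ≤ 1) (hb : ‖b‖ < 1) : 0 < tilt v b :=
  div_pos (one_sub_mul_inner_pos hv hb (stretchAux_nonneg (sq_norm_lt_one hb))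
    (stretchAux_le_one (sq_norm_lt_one hb))) (one_sub_mul_stretchAux_pos (sq_norm_lt_one hb))

/-- `1 / tilt v` is concave. -/
theorem tilt_mul_le_one {v b₁ b₂ : V} (hv : ‖v‖ ≤ 1) (h₁ : ‖b₁‖ < 1) (h₂ : ‖b₂‖ < 1)
    {c d : ℝ} (hc : 0 ≤ c) (hd : 0 ≤ d) (hcd : c + d = 1) :
    tilt v (c • b₁ + d • b₂) * (c / tilt v b₁ + d / tilt v b₂) ≤ 1 := by
  set b := c • b₁ + d • b₂ with hb
  have hb1 : ‖b‖ < 1 := by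
    have := (convex_ball (0 : V) 1) (mem_ball_zero_iff.2 h₁) (mem_ball_zero_iff.2 h₂) hc hd hcd
    exact mem_ball_zero_iff.1 this
  set W : ℕ → V → ℝ := fun n b =>
    (1 - stretchSum n (‖b‖ ^ 2) * inner ℝ v b) / (1 - ‖b‖ ^ 2 * stretchSum n (‖b‖ ^ 2)) with hW
  have hlim : ∀ x : V, ‖x‖ < 1 → Filter.Tendsto (fun n => W n x) Filter.atTop (𝓝 (tilt v x)) := by
    intro x hx
    have h1 := tendsto_stretchSum (sq_norm_lt_one hx)
    exact ((h1.mul_const _).const_sub 1).div ((h1.const_mul _).const_sub 1)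
      (one_sub_mul_stretchAux_pos (sq_norm_lt_one hx)).ne'
  have hden : ∀ x : V, ‖x‖ < 1 → ∀ᶠ n in Filter.atTop,
      0 < 1 - ‖x‖ ^ 2 * stretchSum n (‖x‖ ^ 2) := by
    intro x hx
    have h1 := tendsto_stretchSum (sq_norm_lt_one hx)
    exact ((h1.const_mul _).const_sub 1).eventually_const_lt
      (one_sub_mul_stretchAux_pos (sq_norm_lt_one hx))
  have hlimit : Filter.Tendsto (fun n => W n b * (c / W n b₁ + d / W n b₂)) Filter.atTop
      (𝓝 (tilt v b * (c / tilt v b₁ + d / tilt v b₂))) :=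
    (hlim b hb1).mul ((tendsto_const_nhds.div (hlim b₁ h₁) (tilt_pos hv h₁).ne').add
      (tendsto_const_nhds.div (hlim b₂ h₂) (tilt_pos hv h₂).ne'))
  refine le_of_tendsto hlimit ?_
  filter_upwards [hden b hb1, hden b₁ h₁, hden b₂ h₂,
    (hlim b₁ h₁).eventually_const_lt (tilt_pos hv h₁),
    (hlim b₂ h₂).eventually_const_lt (tilt_pos hv h₂), Filter.eventually_gt_atTop 0] with
    n e0 e1 e2 w1 w2 hn
  have hn' : (0 : ℝ) < n := by exact_mod_cast hn
  obtain ⟨k, m, hk, hm, hm1, hres⟩ := exists_stieltjes_of_rank_one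
    (fun i : Fin n => ((i : ℝ) / n) ^ 2) (fun _ => (1 / n : ℝ))
    (fun i => ⟨sq_nonneg _, by
      have : (i : ℝ) / n ≤ 1 := (div_le_one hn').2 (by exact_mod_cast i.2.le)
      have h0 : 0 ≤ (i : ℝ) / n := by positivity
      nlinarith⟩)
    (fun _ => by positivity) (by simp [hn'.ne'])
  -- `W n` is a parallel sum of Lorentzian quotients, indexed by `Option (Fin n)`
  set m' : Option (Fin n) → ℝ := fun o => o.elim (1 - ∑ j, m j) m with hm'
  set k' : Option (Fin n) → ℝ := fun o => o.elim 0 k with hk'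
  have hk'' : ∀ o, 0 ≤ k' o ∧ k' o ≤ 1 := by
    rintro (_ | j)
    · simp [hk']
    · exact hk j
  have hm'' : ∀ o, 0 ≤ m' o := by
    rintro (_ | j)
    · simpa [hm'] using hm1
    · exact hm j
  set p : V → Option (Fin n) → ℝ := fun x o =>
    (1 - k' o * ‖x‖ ^ 2) / (1 - k' o * inner ℝ v x) with hp
  -- With `s = ‖x‖ ^ 2`, `α = inner v x` and `p` the Riemann sum, `W n x = 1 + (s - α) * p / (1 - s
  -- p)`. A term of the parallel sum is `m + (s - α) * m k / (1 - s k)`, so the identity reduces to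
  -- `hres`. The index `none`, with `k = 0`, fills up the mass to `1`.
  have hWp : ∀ x : V, ‖x‖ < 1 → 0 < 1 - ‖x‖ ^ 2 * stretchSum n (‖x‖ ^ 2) →
      W n x = ∑ o, m' o / p x o := by
    intro x hx hpos
    have h := hres (‖x‖ ^ 2) (sq_nonneg _) (sq_norm_lt_one hx)
    change stretchSum n (‖x‖ ^ 2) = _ * (1 - ‖x‖ ^ 2 * stretchSum n (‖x‖ ^ 2)) at h
    rw [Fintype.sum_option]
    have e : ∀ j, m j / ((1 - k j * ‖x‖ ^ 2) / (1 - k j * inner ℝ v x)) =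
        m j + (‖x‖ ^ 2 - inner ℝ v x) * (m j * k j / (1 - ‖x‖ ^ 2 * k j)) := by
      intro j
      have p1 := (one_sub_mul_inner_pos hv hx (hk j).1 (hk j).2).ne'
      have p2 := (one_sub_mul_normSq_pos hx (hk j).2).ne'
      have p3 : 1 - ‖x‖ ^ 2 * k j ≠ 0 := by rwa [mul_comm]
      rw [mul_comm (k j) (‖x‖ ^ 2)]
      field_simp
      ring
    simp only [hp, hm', hk', Option.elim_none, Option.elim_some, zero_mul, sub_zero, div_one]
    rw [Finset.sum_congr rfl fun j _ => e j, Finset.sum_add_distrib, ← Finset.mul_sum]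
    set κ := ∑ j, m j * k j / (1 - ‖x‖ ^ 2 * k j)
    simp only [hW]
    rw [div_eq_iff hpos.ne']
    linear_combination (‖x‖ ^ 2 - inner ℝ v x) * h
  have hppos : ∀ x : V, ‖x‖ < 1 → ∀ o, 0 < p x o := fun x hx o =>
    div_pos (one_sub_mul_normSq_pos hx (hk'' o).2)
      (one_sub_mul_inner_pos hv hx (hk'' o).1 (hk'' o).2)
  rw [hWp b hb1 e0, hWp b₁ h₁ e1, hWp b₂ h₂ e2]
  rw [hWp b₁ h₁ e1] at w1
  rw [hWp b₂ h₂ e2] at w2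
  exact parallel_sum_concave Finset.univ m' (p b₁) (p b₂) (p b) (fun o _ => hm'' o)
    (fun o _ => hppos b₁ h₁ o) (fun o _ => hppos b₂ h₂ o) hc hd hcd
    (fun o _ => lorentz_quotient_concave hv h₁ h₂ (hk'' o).1 (hk'' o).2 hc hd hcd hb1) w1 w2

end Core

/-! ### Descent along geodesics between convex hulls. -/

section Join

variable {V : Type*} [NormedAddCommGroup V] [InnerProductSpace ℝ V]

/-- The passage from the Klein model of hyperbolic space to exponential coordinates at the
origin. -/
noncomputable def kleinExp (k : V) : V := stretch (‖k‖ ^ 2) • k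

/-- Up to the positive factor `stretch (‖k‖ ^ 2)`, the derivative of `kleinExp` at `k`. -/
noncomputable def kleinTangent (k u : V) : V :=
  u + (stretchAux (‖k‖ ^ 2) / (1 - ‖k‖ ^ 2 * stretchAux (‖k‖ ^ 2)) * inner ℝ k u) • k

theorem kleinTangent_smul (k : V) (c : ℝ) (u : V) :
    kleinTangent k (c • u) = c • kleinTangent k u := by
  simp only [kleinTangent, inner_smul_right, smul_add, smul_smul]
  congr 2
  ring

/-- Descent at `b` along the geodesic coming from `v` thus amounts to `inner ν b * tilt v b < inner
ν v`, an inequality well suited to convex combinations in either variable. -/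
theorem inner_kleinTangent_sub {ν v b : V} (hb : ‖b‖ < 1) :
    inner ℝ ν (kleinTangent b (b - v)) = inner ℝ ν b * tilt v b - inner ℝ ν v := by
  have h := (one_sub_mul_stretchAux_pos (sq_norm_lt_one hb)).ne'
  rw [kleinTangent, inner_add_right, inner_smul_right, inner_sub_right, inner_sub_right,
    real_inner_self_eq_norm_sq, real_inner_comm v b, tilt]
  field_simp
  ring

theorem tilt_self {v : V} (hv : ‖v‖ < 1) : tilt v v = 1 := by
  rw [tilt, real_inner_self_eq_norm_sq, mul_comm,
    div_self (one_sub_mul_stretchAux_pos (sq_norm_lt_one hv)).ne']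

/-- Affineness in the starting point is immediate, in contrast to the concavity of the reciprocal in
the other variable. -/
theorem tilt_combination {v₁ v₂ b : V} (hb : ‖b‖ < 1) {c d : ℝ} (hcd : c + d = 1) :
    tilt (c • v₁ + d • v₂) b = c * tilt v₁ b + d * tilt v₂ b := by
  have h := (one_sub_mul_stretchAux_pos (sq_norm_lt_one hb)).ne'
  rw [tilt, tilt, tilt, inner_add_left, inner_smul_left, inner_smul_left]
  simp only [conj_trivial]
  field_simp
  linear_combination (-1) * hcd

/-- The inequality that expresses that the level sets of `inner ν` are illuminated from `x` is
inherited by convex combinations. -/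
theorem illuminated_combination {ν x y₁ y₂ : V} (hx : ‖x‖ < 1) (hν : 0 < inner ℝ ν x)
    (h₁ : ‖y₁‖ < 1) (h₂ : ‖y₂‖ < 1) {c d : ℝ} (hc : 0 ≤ c) (hd : 0 < d) (hcd : c + d = 1)
    (i₁ : inner ℝ ν y₁ * tilt x y₁ ≤ inner ℝ ν x) (i₂ : inner ℝ ν y₂ * tilt x y₂ < inner ℝ ν x) :
    inner ℝ ν (c • y₁ + d • y₂) * tilt x (c • y₁ + d • y₂) < inner ℝ ν x := by
  have t1 := tilt_pos hx.le h₁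
  have t2 := tilt_pos hx.le h₂
  have hb : ‖c • y₁ + d • y₂‖ < 1 :=
    mem_ball_zero_iff.1 ((convex_ball (0 : V) 1) (mem_ball_zero_iff.2 h₁)
      (mem_ball_zero_iff.2 h₂) hc hd.le hcd)
  have t := tilt_pos hx.le hb
  have key := tilt_mul_le_one hx.le h₁ h₂ hc hd.le hcd
  rw [← le_div_iff₀ t1] at i₁
  rw [← lt_div_iff₀ t2] at i₂
  have e : inner ℝ ν (c • y₁ + d • y₂) < inner ℝ ν x * (c / tilt x y₁ + d / tilt x y₂) := by
    rw [inner_add_right, inner_smul_right, inner_smul_right]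
    have a1 := mul_le_mul_of_nonneg_left i₁ hc
    have a2 := mul_lt_mul_of_pos_left i₂ hd
    calc _ < c * (inner ℝ ν x / tilt x y₁) + d * (inner ℝ ν x / tilt x y₂) := by linarith
      _ = _ := by ring
  calc _ < inner ℝ ν x * (c / tilt x y₁ + d / tilt x y₂) * tilt x (c • y₁ + d • y₂) :=
        mul_lt_mul_of_pos_right e t
    _ = inner ℝ ν x * (tilt x (c • y₁ + d • y₂) * (c / tilt x y₁ + d / tilt x y₂)) := by ring
    _ ≤ inner ℝ ν x * 1 := mul_le_mul_of_nonneg_left key hν.le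
    _ = _ := mul_one _

theorem inner_kleinExp (ν k : V) : inner ℝ ν (kleinExp k) = stretch (‖k‖ ^ 2) * inner ℝ ν k :=
  inner_smul_right _ _ _

/-- The descent inequality at the far endpoints is extended from `B` to `b`, from `A` to `a`, and
then from `b` back along the segment. The sign condition ensures `inner ν a > 0`, without which
concavity of `1 / tilt a` would give nothing. -/
theorem inner_kleinTangent_join_neg_of_nonneg {A B : Set V} (hA : A ⊆ Metric.ball 0 1)
    (hB : B ⊆ Metric.ball 0 1) {ν : V}
    (hH : ∀ x ∈ A, ∀ y ∈ B, inner ℝ ν (kleinExp y) < inner ℝ ν (kleinExp x))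
    (h₁ : ∀ x ∈ A, ∀ y ∈ B, inner ℝ ν (kleinTangent y (y - x)) < 0)
    {a b : V} (ha : a ∈ convexHull ℝ A) (hb : b ∈ convexHull ℝ B) {c d : ℝ} (hc : 0 < c)
    (hd : 0 < d) (hcd : c + d = 1) (hk : 0 ≤ inner ℝ ν (c • a + d • b)) :
    inner ℝ ν (kleinTangent (c • a + d • b) (b - a)) < 0 := by
  have a1 : ‖a‖ < 1 := mem_ball_zero_iff.1 (convexHull_min hA (convex_ball _ _) ha)
  have b1 : ‖b‖ < 1 := mem_ball_zero_iff.1 (convexHull_min hB (convex_ball _ _) hb)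
  have hA1 : ∀ x ∈ A, ‖x‖ < 1 := fun x hx => mem_ball_zero_iff.1 (hA hx)
  have hB1 : ∀ x ∈ B, ‖x‖ < 1 := fun x hx => mem_ball_zero_iff.1 (hB hx)
  have hlin : IsLinearMap ℝ (fun x : V => inner ℝ ν x) :=
    ⟨fun x y => inner_add_right _ _ _, fun r x => inner_smul_right _ _ _⟩
  -- below a nonpositive point of `A` everything in `B` is negative
  have hneg : ∀ x ∈ A, inner ℝ ν x ≤ 0 → inner ℝ ν b < 0 := by
    intro x hx hx0
    refine convexHull_min (s := B) (t := {y | inner ℝ ν y < 0}) (fun y hy => ?_)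
      (convex_halfSpace_lt hlin 0) hb
    have h := hH x hx y hy
    rw [inner_kleinExp, inner_kleinExp] at h
    have hx' : stretch (‖x‖ ^ 2) * inner ℝ ν x ≤ 0 :=
      mul_nonpos_of_nonneg_of_nonpos (stretch_pos (sq_norm_lt_one (hA1 x hx))).le hx0
    exact (pos_iff_neg_of_mul_neg (h.trans_le hx')).1 (stretch_pos (sq_norm_lt_one (hB1 y hy)))
  have ha0 : 0 < inner ℝ ν a := by
    by_contra hcon
    have : ∃ x ∈ A, inner ℝ ν x ≤ 0 := by
      by_contra! hall
      exact hcon (convexHull_min (s := A) (t := {y | 0 < inner ℝ ν y}) hall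
        (convex_halfSpace_gt hlin 0) ha)
    obtain ⟨x, hx, hx0⟩ := this
    have := hneg x hx hx0
    rw [inner_add_right, inner_smul_right, inner_smul_right] at hk
    nlinarith
  have hill : inner ℝ ν b * tilt a b < inner ℝ ν a := by
    rcases le_or_gt (inner ℝ ν b) 0 with hb0 | hb0
    · exact (mul_nonpos_of_nonpos_of_nonneg hb0 (tilt_pos a1.le b1).le).trans_lt ha0
    -- For fixed `x` the points `y` that satisfy the inequality form a convex set, by concavity of
    -- `1 / tilt x`. Afterwards, for fixed `b`, the inequality is affine in `x`.
    · have step : ∀ x ∈ A, inner ℝ ν b * tilt x b < inner ℝ ν x := by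
        intro x hx
        have hx0 : 0 < inner ℝ ν x := by
          by_contra hcon
          exact absurd (hneg x hx (not_lt.1 hcon)) (not_lt.2 hb0.le)
        have hconv : Convex ℝ {y : V | ‖y‖ < 1 ∧ inner ℝ ν y * tilt x y < inner ℝ ν x} := by
          rw [convex_iff_forall_pos]
          rintro y₁ ⟨n1, i1⟩ y₂ ⟨n2, i2⟩ c d hc hd hcd
          exact ⟨mem_ball_zero_iff.1 ((convex_ball (0 : V) 1) (mem_ball_zero_iff.2 n1)
            (mem_ball_zero_iff.2 n2) hc.le hd.le hcd),
            illuminated_combination (hA1 x hx) hx0 n1 n2 hc.le hd hcd i1.le i2⟩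
        refine (convexHull_min (t := {y : V | ‖y‖ < 1 ∧ inner ℝ ν y * tilt x y < inner ℝ ν x})
          (fun y hy => ⟨hB1 y hy, ?_⟩) hconv hb).2
        have := h₁ x hx y hy
        rw [inner_kleinTangent_sub (hB1 y hy)] at this
        linarith
      have hconv : Convex ℝ {x : V | inner ℝ ν b * tilt x b < inner ℝ ν x} := by
        rw [convex_iff_forall_pos]
        intro y₁ i1 y₂ i2 c d hc hd hcd
        have e1 := mul_lt_mul_of_pos_left i1 hc
        have e2 := mul_lt_mul_of_pos_left i2 hd
        change inner ℝ ν b * tilt (c • y₁ + d • y₂) b < inner ℝ ν (c • y₁ + d • y₂)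
        rw [tilt_combination b1 hcd, inner_add_right, inner_smul_right, inner_smul_right]
        linarith
      exact convexHull_min step hconv ha
  have k1 : ‖c • a + d • b‖ < 1 :=
    mem_ball_zero_iff.1 ((convex_ball (0 : V) 1) (mem_ball_zero_iff.2 a1)
      (mem_ball_zero_iff.2 b1) hc.le hd.le hcd)
  -- At the endpoint `a` itself the inequality is an equality, as `tilt a a = 1`; it is strict at
  -- `b`, hence strict in between.
  have hfin := illuminated_combination a1 ha0 a1 b1 hc.le hd hcd (by rw [tilt_self a1, mul_one]) hill
  have e : c • a + d • b - a = d • (b - a) := by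
    have : c = 1 - d := by linarith
    rw [this]; module
  have h2 := inner_kleinTangent_sub (ν := ν) (v := a) k1
  rw [e, kleinTangent_smul, inner_smul_right] at h2
  have h3 : d * inner ℝ ν (kleinTangent (c • a + d • b) (b - a)) < 0 := by rw [h2]; linarith
  exact (pos_iff_neg_of_mul_neg h3).1 hd

/-- If a linear function decreases, in exponential coordinates, along all geodesics from the points
of `A` to the points of `B`, then it decreases along all geodesics from the convex hull of `A` to
the convex hull of `B`. -/
theorem inner_kleinTangent_join_neg {A B : Set V} (hA : A ⊆ Metric.ball 0 1)
    (hB : B ⊆ Metric.ball 0 1) {ν : V}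
    (hH : ∀ x ∈ A, ∀ y ∈ B, inner ℝ ν (kleinExp y) < inner ℝ ν (kleinExp x))
    (h₁ : ∀ x ∈ A, ∀ y ∈ B, inner ℝ ν (kleinTangent y (y - x)) < 0)
    (h₂ : ∀ x ∈ A, ∀ y ∈ B, inner ℝ ν (kleinTangent x (y - x)) < 0)
    {a b : V} (ha : a ∈ convexHull ℝ A) (hb : b ∈ convexHull ℝ B) {c d : ℝ} (hc : 0 < c)
    (hd : 0 < d) (hcd : c + d = 1) :
    inner ℝ ν (kleinTangent (c • a + d • b) (b - a)) < 0 := by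
  rcases le_total 0 (inner ℝ ν (c • a + d • b)) with hk | hk
  · exact inner_kleinTangent_join_neg_of_nonneg hA hB hH h₁ ha hb hc hd hcd hk
  -- Where `inner ν` is nonpositive, the geodesic is reversed and `ν` negated. The hypothesis at the
  -- starting points then plays the role of the one at the endpoints.
  · have flip : ∀ k u w : V, inner ℝ (-ν) (kleinTangent k (u - w)) =
        inner ℝ ν (kleinTangent k (w - u)) := by
      intro k u w
      rw [← neg_sub w u, ← neg_one_smul ℝ (w - u), kleinTangent_smul, inner_smul_right,
        inner_neg_left]
      ring
    have := inner_kleinTangent_join_neg_of_nonneg hB hA (ν := -ν)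
      (fun y hy x hx => by
        rw [inner_neg_left, inner_neg_left]; exact neg_lt_neg (hH x hx y hy))
      (fun y hy x hx => by rw [flip]; exact h₂ x hx y hy) hb ha hd hc (by linarith)
      (by rw [inner_neg_left, add_comm]; linarith)
    rwa [flip, add_comm] at this

end Join

/-! ### Differentiating the passage from Klein to exponential coordinates. -/

section KleinExp

variable {V : Type*} [NormedAddCommGroup V] [InnerProductSpace ℝ V]

theorem hasFDerivAt_kleinExp {k : V} (hk : ‖k‖ < 1) :
    HasFDerivAt kleinExp (stretch (‖k‖ ^ 2) • ContinuousLinearMap.id ℝ V +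
      ((stretchAux (‖k‖ ^ 2) / (1 - ‖k‖ ^ 2)) • innerSL ℝ k).smulRight k) k := by
  have h1 : HasFDerivAt (fun x : V => ‖x‖ ^ 2) (2 • innerSL ℝ k) k :=
    (hasStrictFDerivAt_norm_sq k).hasFDerivAt
  have h2 := (hasDerivAt_stretch (sq_norm_lt_one hk)).comp_hasFDerivAt k h1
  refine (h2.fun_smul (hasFDerivAt_id k)).congr_fderiv ?_
  ext u
  have : (1 - ‖k‖ ^ 2) ≠ 0 := by linarith [sq_norm_lt_one hk]
  simp only [add_apply, smul_apply,
    ContinuousLinearMap.id_apply, ContinuousLinearMap.smulRight_apply, Function.comp_apply, id,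
    nsmul_eq_mul, smul_eq_mul, Nat.cast_ofNat]
  congr 2
  simp
  field_simp

theorem fderiv_kleinExp_apply {k : V} (hk : ‖k‖ < 1) (u : V) :
    (stretch (‖k‖ ^ 2) • ContinuousLinearMap.id ℝ V +
      ((stretchAux (‖k‖ ^ 2) / (1 - ‖k‖ ^ 2)) • innerSL ℝ k).smulRight k) u =
      stretch (‖k‖ ^ 2) • kleinTangent k u := by
  have h0 : (1 - ‖k‖ ^ 2) ≠ 0 := by linarith [sq_norm_lt_one hk]
  have h1 := one_sub_mul_stretch (sq_norm_lt_one hk)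
  have h2 := (stretch_pos (sq_norm_lt_one hk)).ne'
  simp only [add_apply, smul_apply,
    ContinuousLinearMap.id_apply, ContinuousLinearMap.smulRight_apply, kleinTangent, smul_add,
    smul_smul, smul_eq_mul, innerSL_apply_apply, ← h1]
  congr 2
  field_simp

theorem continuousOn_kleinExp : ContinuousOn (kleinExp : V → V) (Metric.ball 0 1) := fun _ hk =>
  (hasFDerivAt_kleinExp (mem_ball_zero_iff.1 hk)).continuousAt.continuousWithinAt

/-- The velocity of a geodesic in exponential coordinates. -/
theorem hasDerivAt_kleinExp_line {a u : V} {t : ℝ} (h : ‖a + t • u‖ < 1) :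
    HasDerivAt (fun t : ℝ => kleinExp (a + t • u))
      (stretch (‖a + t • u‖ ^ 2) • kleinTangent (a + t • u) u) t := by
  have h1 : HasDerivAt (fun t : ℝ => a + t • u) u t := by
    simpa using ((hasDerivAt_id t).smul_const u).const_add a
  have := (hasFDerivAt_kleinExp h).comp_hasDerivAt t h1
  rwa [fderiv_kleinExp_apply h] at this

/-- The correction term is a nonnegative multiple of the projection to `k`, so the inner product
with `u` is at least `‖u‖ ^ 2`. -/
theorem kleinTangent_ne_zero {k u : V} (hk : ‖k‖ < 1) (hu : u ≠ 0) : kleinTangent k u ≠ 0 := by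
  intro h
  have h1 : inner ℝ (kleinTangent k u) u = (0 : ℝ) := by rw [h, inner_zero_left]
  rw [kleinTangent, inner_add_left, inner_smul_left, real_inner_self_eq_norm_sq] at h1
  have h2 : 0 ≤ stretchAux (‖k‖ ^ 2) / (1 - ‖k‖ ^ 2 * stretchAux (‖k‖ ^ 2)) :=
    div_nonneg (stretchAux_nonneg (sq_norm_lt_one hk))
      (one_sub_mul_stretchAux_pos (sq_norm_lt_one hk)).le
  have h3 : 0 < ‖u‖ ^ 2 := by positivity
  simp only [conj_trivial] at h1
  have : 0 ≤ stretchAux (‖k‖ ^ 2) / (1 - ‖k‖ ^ 2 * stretchAux (‖k‖ ^ 2)) * inner ℝ k u *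
      inner ℝ k u := by rw [mul_assoc]; exact mul_nonneg h2 (mul_self_nonneg _)
  linarith

theorem norm_kleinExp {k : V} (hk : ‖k‖ < 1) : ‖kleinExp k‖ = Real.artanh ‖k‖ := by
  rw [kleinExp, norm_smul, Real.norm_of_nonneg (stretch_pos (sq_norm_lt_one hk)).le, mul_comm,
    mul_stretch_sq (norm_nonneg k) hk]

end KleinExp

/-! ### The exponential map at the base point of the hyperboloid. -/

section ExpCoordinates

/-- The exponential map of hyperbolic space at the base point of the hyperboloid. -/
noncomputable def hypVec (w : E3) : MinkSpace := (Real.cosh ‖w‖, (Real.sinh ‖w‖ / ‖w‖) • w)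

/-- The point of the Klein model that corresponds to a point of the hyperboloid. -/
noncomputable def kleinPt (u : MinkSpace) : E3 := u.1⁻¹ • u.2

/-- The inverse of the exponential map at the base point of the hyperboloid. -/
noncomputable def hypLog (u : MinkSpace) : E3 := kleinExp (kleinPt u)

theorem mink_self (u : MinkSpace) : mink u u = ‖u.2‖ ^ 2 - u.1 ^ 2 := by
  rw [mink, real_inner_self_eq_norm_sq, sq u.1]

theorem norm_kleinPt_lt_one {u : MinkSpace} (h0 : 0 < u.1) (h : ‖u.2‖ < u.1) :
    ‖kleinPt u‖ < 1 := by
  rw [kleinPt, norm_smul, norm_inv, Real.norm_of_nonneg h0.le, inv_mul_lt_iff₀ h0]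
  simpa using h

theorem Hyp3.norm_lt {u : MinkSpace} (hu : u ∈ Hyp3) : ‖u.2‖ < u.1 := by
  have h := hu.1
  rw [mink_self] at h
  exact lt_of_pow_lt_pow_left₀ 2 hu.2.le (by linarith)

theorem Hyp3.norm_kleinPt {u : MinkSpace} (hu : u ∈ Hyp3) : ‖kleinPt u‖ < 1 :=
  norm_kleinPt_lt_one hu.2 (Hyp3.norm_lt hu)

theorem hypVec_kleinExp {k : E3} (hk : ‖k‖ < 1) :
    hypVec (kleinExp k) = ((√(1 - ‖k‖ ^ 2))⁻¹, (√(1 - ‖k‖ ^ 2))⁻¹ • k) := by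
  have hmem : ‖k‖ ∈ Ioo (-1 : ℝ) 1 := ⟨by linarith [norm_nonneg k], hk⟩
  rw [hypVec, norm_kleinExp hk, Real.cosh_artanh hmem, Real.sinh_artanh hmem, one_div]
  congr 1
  rcases eq_or_ne k 0 with rfl | h0
  · simp [kleinExp]
  · have hn : ‖k‖ ≠ 0 := norm_ne_zero_iff.2 h0
    have hs := (stretch_pos (sq_norm_lt_one hk)).ne'
    rw [kleinExp, smul_smul, ← mul_stretch_sq (norm_nonneg k) hk]
    congr 1
    field_simp

theorem kleinPt_hypVec (w : E3) : kleinPt (hypVec w) = (Real.tanh ‖w‖ / ‖w‖) • w := by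
  rw [kleinPt, hypVec, smul_smul, Real.tanh_eq_sinh_div_cosh]
  congr 1
  ring

theorem hypLog_hypVec (w : E3) : hypLog (hypVec w) = w := by
  rcases eq_or_ne w 0 with rfl | h0
  · simp [hypLog, kleinPt_hypVec, kleinExp]
  have hn : 0 < ‖w‖ := norm_pos_iff.2 h0
  have ht : 0 < Real.tanh ‖w‖ := by
    rw [Real.tanh_eq_sinh_div_cosh]
    exact div_pos (Real.sinh_pos_iff.2 hn) (Real.cosh_pos _)
  have hk : ‖kleinPt (hypVec w)‖ = Real.tanh ‖w‖ := by
    rw [kleinPt_hypVec, norm_smul, Real.norm_of_nonneg (by positivity)]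
    field_simp
  have h1 : Real.tanh ‖w‖ < 1 := Real.tanh_lt_one _
  rw [hypLog, kleinExp, hk, kleinPt_hypVec, smul_smul]
  have := mul_stretch_sq ht.le h1
  rw [Real.artanh_tanh] at this
  have e : stretch (Real.tanh ‖w‖ ^ 2) * (Real.tanh ‖w‖ / ‖w‖) = 1 := by
    field_simp
    linarith
  rw [e, one_smul]

/-- Klein coordinates are homogeneous, so off the hyperboloid this composition is radial projection.
That permits differentiating along straight lines, which leave the hyperboloid. -/
theorem hypVec_hypLog_of_timelike {u : MinkSpace} (h0 : 0 < u.1) (h : ‖u.2‖ < u.1) :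
    hypVec (hypLog u) = (√(-mink u u))⁻¹ • u := by
  rw [hypLog, hypVec_kleinExp (norm_kleinPt_lt_one h0 h)]
  have e : 1 - ‖kleinPt u‖ ^ 2 = -mink u u / u.1 ^ 2 := by
    rw [mink_self, kleinPt, norm_smul, norm_inv, Real.norm_of_nonneg h0.le]
    field_simp
    ring
  rw [e, Real.sqrt_div' _ (sq_nonneg _), Real.sqrt_sq h0.le, inv_div]
  refine Prod.ext ?_ ?_
  · simp [div_eq_inv_mul]
  · simp only [kleinPt, smul_smul, Prod.smul_snd]
    congr 1
    field_simp

theorem hypVec_hypLog {u : MinkSpace} (hu : u ∈ Hyp3) : hypVec (hypLog u) = u := by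
  rw [hypVec_hypLog_of_timelike hu.2 (Hyp3.norm_lt hu), hu.1]
  simp

theorem hypVec_mem (w : E3) : hypVec w ∈ Hyp3 := hyp_exp_mem w

theorem cosh_norm_hypLog {u : MinkSpace} (hu : u ∈ Hyp3) : Real.cosh ‖hypLog u‖ = u.1 :=
  congrArg Prod.fst (hypVec_hypLog hu)

theorem continuousOn_hypLog : ContinuousOn hypLog Hyp3 := by
  refine continuousOn_kleinExp.comp ?_ fun u hu => mem_ball_zero_iff.2 (Hyp3.norm_kleinPt hu)
  exact (continuousOn_fst.inv₀ fun u hu => (hu.2).ne').smul continuousOn_snd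

open FormalMultilinearSeries in
theorem contDiff_ofScalarsSum {c : ℕ → ℝ} (hc : ∀ n, c n ≠ 0)
    (h : Filter.Tendsto (fun n => ‖c n.succ‖ / ‖c n‖) Filter.atTop (𝓝 0)) {m : WithTop ℕ∞} :
    ContDiff ℝ m (ofScalarsSum c : ℝ → ℝ) := by
  have hr := ofScalars_radius_eq_top_of_tendsto ℝ c (Filter.Eventually.of_forall hc) h
  have hb := (ofScalars ℝ c).hasFPowerSeriesOnBall (by rw [hr]; exact ENNReal.zero_lt_top)
  refine AnalyticOnNhd.contDiff fun x _ => ?_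
  refine hb.analyticAt_of_mem ?_
  rw [hr]
  simp

-- Both `cosh r` and `sinh r / r` are entire functions of `r ^ 2`. This gives smoothness of `hypVec`
-- at the origin, where the norm itself is not differentiable.
open FormalMultilinearSeries Nat in
theorem exists_contDiff_cosh_norm {m : WithTop ℕ∞} :
    ∃ C S : ℝ → ℝ, ContDiff ℝ m C ∧ ContDiff ℝ m S ∧
      ∀ r : ℝ, 0 ≤ r → C (r ^ 2) = Real.cosh r ∧ r * S (r ^ 2) = Real.sinh r := by
  have key : ∀ i : ℕ, Filter.Tendsto (fun n : ℕ => ‖(((2 * n.succ + i)! : ℕ) : ℝ)⁻¹‖ /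
      ‖(((2 * n + i)! : ℕ) : ℝ)⁻¹‖) Filter.atTop (𝓝 0) := by
    intro i
    refine squeeze_zero (fun n => by positivity) (fun n => ?_)
      tendsto_one_div_add_atTop_nhds_zero_nat
    have e : (2 * n.succ + i)! = (2 * n + i + 2) * ((2 * n + i + 1) * (2 * n + i)!) := by
      rw [← Nat.factorial_succ, ← Nat.factorial_succ]; congr 1; simp only [Nat.succ_eq_add_one]; ring
    have hp : (0 : ℝ) < ((2 * n + i)! : ℕ) := by exact_mod_cast Nat.factorial_pos _
    rw [e, norm_inv, norm_inv, Real.norm_of_nonneg (by positivity), Real.norm_of_nonneg hp.le]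
    push_cast
    rw [div_inv_eq_mul, inv_mul_le_iff₀ (by positivity)]
    rw [mul_one_div, le_div_iff₀ (by positivity)]
    have : (0 : ℝ) ≤ n := by positivity
    have hi : (0 : ℝ) ≤ i := by positivity
    nlinarith [mul_nonneg (mul_nonneg this this) hp.le, mul_nonneg this hp.le,
      mul_nonneg (mul_nonneg hi this) hp.le, mul_nonneg hi hp.le, mul_nonneg (mul_nonneg hi hi) hp.le]
  refine ⟨ofScalarsSum (fun n : ℕ => (((2 * n + 0)! : ℕ) : ℝ)⁻¹),
    ofScalarsSum (fun n : ℕ => (((2 * n + 1)! : ℕ) : ℝ)⁻¹),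
    contDiff_ofScalarsSum (fun n => by positivity) (key 0),
    contDiff_ofScalarsSum (fun n => by positivity) (key 1), fun r _ => ⟨?_, ?_⟩⟩
  · rw [ofScalars_sum_eq, Real.cosh_eq_tsum]
    refine tsum_congr fun n => ?_
    rw [smul_eq_mul, ← pow_mul, div_eq_inv_mul, add_zero]
  · rw [ofScalars_sum_eq, Real.sinh_eq_tsum, ← tsum_mul_left]
    refine tsum_congr fun n => ?_
    rw [smul_eq_mul, ← pow_mul, div_eq_inv_mul]
    ring

theorem contDiff_hypVec {m : WithTop ℕ∞} : ContDiff ℝ m hypVec := by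
  obtain ⟨C, S, hC, hS, h⟩ := exists_contDiff_cosh_norm (m := m)
  have e : hypVec = fun w : E3 => (C (‖w‖ ^ 2), S (‖w‖ ^ 2) • w) := by
    funext w
    obtain ⟨h1, h2⟩ := h ‖w‖ (norm_nonneg w)
    rw [hypVec, h1]
    congr 1
    rcases eq_or_ne w 0 with rfl | h0
    · simp
    · have hn : ‖w‖ ≠ 0 := norm_ne_zero_iff.2 h0
      rw [← h2, mul_div_assoc, mul_comm, div_mul_cancel₀ _ hn]
  rw [e]
  exact (hC.comp (contDiff_norm_sq ℝ)).prodMk ((hS.comp (contDiff_norm_sq ℝ)).smul contDiff_id)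

/-- The derivative of the exponential map is onto the tangent space of the hyperboloid. -/
theorem exists_fderiv_hypVec_eq {w : E3} {t : MinkSpace} (ht : mink (hypVec w) t = 0) :
    ∃ τ, fderiv ℝ hypVec w τ = t := by
  set u := hypVec w with hu
  have hu3 : u ∈ Hyp3 := hypVec_mem w
  -- Along this line the normalising factor is constant to first order, because `-mink (c ε) (c ε) =
  -- 1 - ε ^ 2 * mink t t`. So the radial projection of the line has velocity `t`, and the wanted
  -- preimage is the velocity of `hypLog ∘ c`.
  set c : ℝ → MinkSpace := fun ε => u + ε • t with hc
  have hc0 : c 0 = u := by simp [hc]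
  have hcd : HasDerivAt c t 0 := by
    exact (((hasDerivAt_id (0 : ℝ)).smul_const t).const_add u).congr_deriv (one_smul ℝ t)
  have hk : DifferentiableAt ℝ (fun ε => kleinPt (c ε)) 0 := by
    have h1 : DifferentiableAt ℝ (fun ε => (c ε).1) 0 := hcd.differentiableAt.fst
    have h2 : DifferentiableAt ℝ (fun ε => (c ε).2) 0 := hcd.differentiableAt.snd
    exact (h1.inv (by rw [hc0]; exact hu3.2.ne')).smul h2
  have hlog : DifferentiableAt ℝ (fun ε => hypLog (c ε)) 0 := by
    refine DifferentiableAt.comp (0 : ℝ) (g := kleinExp) ?_ hk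
    exact (hasFDerivAt_kleinExp (by rw [hc0]; exact Hyp3.norm_kleinPt hu3)).differentiableAt
  refine ⟨deriv (fun ε => hypLog (c ε)) 0, ?_⟩
  have hl : hypLog (c 0) = w := by rw [hc0, hu, hypLog_hypVec]
  have h1 : HasDerivAt (fun ε => hypVec (hypLog (c ε)))
      (fderiv ℝ hypVec w (deriv (fun ε => hypLog (c ε)) 0)) 0 := by
    have hd : HasFDerivAt hypVec (fderiv ℝ hypVec w) (hypLog (c 0)) := by
      rw [hl]
      exact ((contDiff_hypVec (m := 1)).differentiable one_ne_zero w).hasFDerivAt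
    exact hd.comp_hasDerivAt (0 : ℝ) hlog.hasDerivAt
  have h2 : HasDerivAt (fun ε => (√(-mink (c ε) (c ε)))⁻¹ • c ε) t 0 := by
    have hm : ∀ ε, -mink (c ε) (c ε) = 1 - ε ^ 2 * mink t t := by
      intro ε
      have e1 : mink (c ε) (c ε) = mink u u + 2 * ε * mink u t + ε ^ 2 * mink t t := by
        simp only [hc, mink, Prod.fst_add, Prod.snd_add, Prod.smul_fst, Prod.smul_snd,
          inner_add_left, inner_add_right, inner_smul_left, inner_smul_right, conj_trivial,
          smul_eq_mul]
        rw [real_inner_comm u.2 t.2]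
        ring
      rw [e1, ht, hu3.1]; ring
    have hq : HasDerivAt (fun ε => -mink (c ε) (c ε)) 0 0 := by
      simp_rw [hm]
      simpa using ((hasDerivAt_pow 2 (0 : ℝ)).mul_const (mink t t)).const_sub 1
    have hq0 : -mink (c 0) (c 0) = 1 := by rw [hm]; simp
    have hs : HasDerivAt (fun ε => (√(-mink (c ε) (c ε)))⁻¹) 0 0 := by
      refine ((hq.sqrt (by rw [hq0]; exact one_ne_zero)).fun_inv (by rw [hq0]; simp)).congr_deriv ?_
      simp
    refine (hs.fun_smul hcd).congr_deriv ?_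
    simp [hq0]
  have heq : (fun ε => hypVec (hypLog (c ε))) =ᶠ[𝓝 0]
      fun ε => (√(-mink (c ε) (c ε)))⁻¹ • c ε := by
    have hcc : ContinuousAt c 0 := hcd.continuousAt
    have o1 : ∀ᶠ ε in 𝓝 (0 : ℝ), 0 < (c ε).1 :=
      (continuous_fst.continuousAt.comp hcc).eventually_const_lt (by
        simp only [Function.comp_apply, hc0]; exact hu3.2)
    have o2 : ∀ᶠ ε in 𝓝 (0 : ℝ), ‖(c ε).2‖ < (c ε).1 :=
      ((continuous_snd.norm.continuousAt.comp hcc)).eventually_lt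
        (continuous_fst.continuousAt.comp hcc) (by
          simp only [Function.comp_apply, hc0]; exact Hyp3.norm_lt hu3)
    filter_upwards [o1, o2] with ε p1 p2 using hypVec_hypLog_of_timelike p1 p2
  exact h1.unique (h2.congr_of_eventuallyEq heq)

end ExpCoordinates

/-! ### Surfaces with steep normals: local graphs and their continuation to sheets. -/

section Sheets

variable {V : Type*} [NormedAddCommGroup V] [InnerProductSpace ℝ V]

/-- The orthogonal projection to the orthogonal complement of the unit vector `v`. -/
noncomputable def flat (v x : V) : V := x - inner ℝ x v • v

/-- `X` is, locally, the zero set of functions with gradients in `N`. -/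
def HasChartsIn (X N : Set V) : Prop :=
  ∀ w ∈ X, ∃ (G : V → ℝ) (ν : V), HasStrictFDerivAt G (innerSL ℝ ν) w ∧
    (∀ᶠ x in 𝓝 w, x ∈ X ↔ G x = 0) ∧ ν ∈ N

/-- `N` consists of nonzero vectors whose direction is close to that of the unit vector `v`. -/
def IsSteep (N : Set V) (v : V) : Prop :=
  ∀ ν ∈ N, ν ≠ 0 ∧ 49 / 50 * ‖ν‖ ≤ inner ℝ ν v

/-- Near the point `w` the set `X` is the graph of a function with small slope, over a disc of
radius `r` orthogonal to `v`. -/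
def IsGraphAt (X : Set V) (v w : V) (r : ℝ) : Prop :=
  ∀ d : V, inner ℝ d v = 0 → ‖d‖ < r → ∃ z : ℝ, |z| ≤ 3 / 10 * ‖d‖ ∧ w + d + z • v ∈ X ∧
    ∀ z' : ℝ, |z'| < r → w + d + z' • v ∈ X → z' = z

variable {X N : Set V} {v : V}

theorem IsGraphAt.mono {w : V} {r r' : ℝ} (h : IsGraphAt X v w r) (hr : r' ≤ r) :
    IsGraphAt X v w r' := fun d hd hdr => by
  obtain ⟨z, h1, h2, h3⟩ := h d hd (hdr.trans_le hr)
  exact ⟨z, h1, h2, fun z' hz' => h3 z' (hz'.trans_le hr)⟩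

theorem inner_flat (hv : ‖v‖ = 1) (x : V) : inner ℝ (flat v x) v = 0 := by
  rw [flat, inner_sub_left, inner_smul_left, real_inner_self_eq_norm_sq, hv]
  simp

theorem flat_add_smul (v x : V) : flat v x + inner ℝ x v • v = x := sub_add_cancel _ _

theorem normSq_add_smul {x : V} (h : inner ℝ x v = 0) (hv : ‖v‖ = 1) (z : ℝ) :
    ‖x + z • v‖ ^ 2 = ‖x‖ ^ 2 + z ^ 2 := by
  rw [norm_add_sq_real, inner_smul_right, h, norm_smul, hv, mul_one, Real.norm_eq_abs, sq_abs]
  ring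

theorem norm_flat_le (hv : ‖v‖ = 1) (x : V) : ‖flat v x‖ ≤ ‖x‖ := by
  have h := normSq_add_smul (inner_flat hv x) hv (inner ℝ x v)
  rw [flat_add_smul] at h
  exact (pow_le_pow_iff_left₀ (norm_nonneg _) (norm_nonneg _) two_ne_zero).1 (by nlinarith)

theorem continuous_flat : Continuous (flat v) := by
  unfold flat; fun_prop

/-- A chart with a steep gradient is strictly monotone in the direction of `v`. -/
theorem exists_ball_of_chart {G : V → ℝ} {ν w : V} (hG : HasStrictFDerivAt G (innerSL ℝ ν) w)
    (hν : ν ≠ 0) : ∃ ρ > 0, ∀ x ∈ Metric.ball w ρ, ∀ y ∈ Metric.ball w ρ,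
      |G x - G y - inner ℝ ν (x - y)| ≤ 1 / 20 * ‖ν‖ * ‖x - y‖ := by
  have h := hG.isLittleO.def (c := 1 / 20 * ‖ν‖) (by positivity)
  obtain ⟨ρ, hρ, hb⟩ := Metric.eventually_nhds_iff_ball.1 h
  refine ⟨ρ, hρ, fun x hx y hy => ?_⟩
  have := hb (x, y) (by rw [← ball_prod_same]; exact ⟨hx, hy⟩)
  simpa using this

/-- The component of `ν` orthogonal to `v` has length at most `‖ν‖ / 5`, since `1 - (49 / 50) ^ 2 <
(1 / 5) ^ 2`. -/
theorem abs_inner_le_of_steep {ν d : V} (hv : ‖v‖ = 1) (hd : inner ℝ d v = 0)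
    (hν : 49 / 50 * ‖ν‖ ≤ inner ℝ ν v) : |inner ℝ ν d| ≤ 1 / 5 * ‖ν‖ * ‖d‖ := by
  have h1 : inner ℝ ν d = inner ℝ (flat v ν) d := by
    rw [flat, inner_sub_left, inner_smul_left, real_inner_comm d v, hd]; simp
  have h2 : ‖flat v ν‖ ≤ 1 / 5 * ‖ν‖ := by
    have h := normSq_add_smul (inner_flat hv ν) hv (inner ℝ ν v)
    rw [flat_add_smul] at h
    have h0 := norm_nonneg ν
    refine (pow_le_pow_iff_left₀ (norm_nonneg _) (by positivity) two_ne_zero).1 ?_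
    nlinarith
  rw [h1]
  exact (abs_real_inner_le_norm _ _).trans (mul_le_mul_of_nonneg_right h2 (norm_nonneg d))

/-- On lines parallel to `v` the chart function is strictly monotone and changes sign. Its linear
approximation is uniform on a ball, which yields a common radius for all nearby base points. -/
theorem exists_isGraphAt (hv : ‖v‖ = 1) (hN : IsSteep N v) (hX : HasChartsIn X N) {w : V}
    (hw : w ∈ X) : ∃ r > 0, ∀ w' ∈ X ∩ Metric.ball w r, IsGraphAt X v w' r := by
  obtain ⟨G, ν, hG, hGX, hνN⟩ := hX w hw
  obtain ⟨hν0, hνv⟩ := hN ν hνN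
  obtain ⟨ρ₁, hρ₁, hball⟩ := exists_ball_of_chart hG hν0
  obtain ⟨ρ₂, hρ₂, hzero⟩ := Metric.eventually_nhds_iff_ball.1 hGX
  have hνp : 0 < ‖ν‖ := norm_pos_iff.2 hν0
  set ρ := min ρ₁ ρ₂ with hρ
  have hρ0 : 0 < ρ := lt_min hρ₁ hρ₂
  refine ⟨ρ / 4, by positivity, ?_⟩
  rintro w' ⟨hw'X, hw'⟩ d hd hdr
  have hmem : ∀ z : ℝ, |z| ≤ ρ / 4 → w' + d + z • v ∈ Metric.ball w ρ := by
    intro z hz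
    rw [Metric.mem_ball, dist_eq_norm] at hw' ⊢
    have e : w' + d + z • v - w = (w' - w) + d + z • v := by abel
    rw [e]
    have h1 := norm_add_le (w' - w + d) (z • v)
    have h2 := norm_add_le (w' - w) d
    rw [norm_smul, hv, mul_one, Real.norm_eq_abs] at h1
    linarith
  have hm1 : Metric.ball w ρ ⊆ Metric.ball w ρ₁ := Metric.ball_subset_ball (min_le_left _ _)
  have hm2 : Metric.ball w ρ ⊆ Metric.ball w ρ₂ := Metric.ball_subset_ball (min_le_right _ _)
  have hw'0 : G w' = 0 :=
    (hzero w' (hm2 (Metric.ball_subset_ball (by linarith) hw'))).1 hw'X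
  have hmono : ∀ z₁ z₂ : ℝ, |z₁| ≤ ρ / 4 → |z₂| ≤ ρ / 4 →
      G (w' + d + z₁ • v) = G (w' + d + z₂ • v) → z₁ = z₂ := by
    intro z₁ z₂ h1 h2 he
    have h := hball _ (hm1 (hmem z₁ h1)) _ (hm1 (hmem z₂ h2))
    have e : w' + d + z₁ • v - (w' + d + z₂ • v) = (z₁ - z₂) • v := by module
    rw [e, he, sub_self, zero_sub, abs_neg, inner_smul_right, abs_mul, norm_smul, hv, mul_one,
      Real.norm_eq_abs, abs_of_nonneg (le_trans (by positivity) hνv)] at h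
    by_contra hne
    have hp : 0 < |z₁ - z₂| := abs_pos.2 (sub_ne_zero.2 hne)
    nlinarith [mul_pos hp hνp]
  have hdn := norm_nonneg d
  -- At height `±m` the vertical contribution `3/10 * 49/50 = 0.294` beats the horizontal one,
  -- `1/5`, plus the linearisation error `1/20 * 13/10 = 0.065`, all in units of `‖ν‖ * ‖d‖`.
  set m := 3 / 10 * ‖d‖ with hm
  have hmr : m ≤ ρ / 4 := by rw [hm]; linarith
  have hm0 : 0 ≤ m := by positivity
  have hdν := abs_le.1 (abs_inner_le_of_steep hv hd hνv)
  have hend : ∀ z : ℝ, |z| = m → |G (w' + d + z • v) - (inner ℝ ν d + z * inner ℝ ν v)| ≤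
      1 / 20 * ‖ν‖ * (13 / 10 * ‖d‖) := by
    intro z hz
    have h := hball _ (hm1 (hmem z (hz.trans_le hmr))) w'
      (hm1 (Metric.ball_subset_ball (by linarith) hw'))
    have e : w' + d + z • v - w' = d + z • v := by abel
    rw [e, hw'0, sub_zero, inner_add_right, inner_smul_right] at h
    refine h.trans ?_
    gcongr
    refine (norm_add_le _ _).trans ?_
    rw [norm_smul, hv, mul_one, Real.norm_eq_abs, hz, hm]
    linarith
  have hcont : ContinuousOn (fun z : ℝ => G (w' + d + z • v)) (Icc (-m) m) := by
    refine ContinuousOn.comp (t := Metric.ball w ρ₁) (g := G) ?_ (by fun_prop) ?_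
    · have hlip : LipschitzOnWith (Real.toNNReal (21 / 20 * ‖ν‖)) G (Metric.ball w ρ₁) := by
        refine LipschitzOnWith.of_dist_le_mul fun x hx y hy => ?_
        rw [Real.coe_toNNReal _ (by positivity), Real.dist_eq, dist_eq_norm]
        have h1 := abs_le.1 (hball x hx y hy)
        have h2 := abs_le.1 (abs_real_inner_le_norm ν (x - y))
        rw [abs_le]
        constructor <;> nlinarith
      exact hlip.continuousOn
    · intro z hz
      exact hm1 (hmem z ((abs_le.2 hz).trans hmr))
  have hpos : 0 ≤ G (w' + d + m • v) := by
    have h := abs_le.1 (hend m (abs_of_nonneg hm0))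
    have : m * (49 / 50 * ‖ν‖) ≤ m * inner ℝ ν v := mul_le_mul_of_nonneg_left hνv hm0
    rw [hm] at this h ⊢
    nlinarith [mul_nonneg hdn hνp.le]
  have hneg : G (w' + d + (-m) • v) ≤ 0 := by
    have h := abs_le.1 (hend (-m) (by rw [abs_neg, abs_of_nonneg hm0]))
    have : m * (49 / 50 * ‖ν‖) ≤ m * inner ℝ ν v := mul_le_mul_of_nonneg_left hνv hm0
    rw [hm] at this h ⊢
    nlinarith [mul_nonneg hdn hνp.le]
  obtain ⟨z, hz, hz0⟩ := intermediate_value_Icc (by linarith) hcont ⟨hneg, hpos⟩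
  refine ⟨z, abs_le.2 hz, ?_, ?_⟩
  · exact (hzero _ (hm2 (hmem z ((abs_le.2 hz).trans hmr)))).2 hz0
  · intro z' hz' hX'
    refine hmono z' z hz'.le ((abs_le.2 hz).trans hmr) ?_
    rw [(hzero _ (hm2 (hmem z' hz'.le))).1 hX']
    exact hz0.symm

theorem exists_uniform_isGraphAt (hv : ‖v‖ = 1) (hN : IsSteep N v) (hX : HasChartsIn X N)
    {K : Set V} (hK : IsCompact K) (hKX : K ⊆ X) :
    ∃ r > 0, ∀ w ∈ K, IsGraphAt X v w r := by
  have : ∃ r > 0, ∀ w ∈ K ∩ X, IsGraphAt X v w r := by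
    refine hK.induction_on (p := fun s => ∃ r > 0, ∀ w ∈ s ∩ X, IsGraphAt X v w r) ?_ ?_ ?_ ?_
    · exact ⟨1, one_pos, fun w hw => absurd hw.1 (notMem_empty w)⟩
    · rintro s t hst ⟨r, hr, h⟩
      exact ⟨r, hr, fun w hw => h w ⟨hst hw.1, hw.2⟩⟩
    · rintro s t ⟨r, hr, h⟩ ⟨r', hr', h'⟩
      refine ⟨min r r', lt_min hr hr', ?_⟩
      rintro w ⟨hw | hw, hwX⟩
      · exact (h w ⟨hw, hwX⟩).mono (min_le_left _ _)
      · exact (h' w ⟨hw, hwX⟩).mono (min_le_right _ _)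
    · intro w hw
      obtain ⟨r, hr, h⟩ := exists_isGraphAt hv hN hX (hKX hw)
      exact ⟨Metric.ball w r, mem_nhdsWithin_of_mem_nhds (Metric.ball_mem_nhds w hr), r, hr,
        fun w' hw' => h w' ⟨hw'.2, hw'.1⟩⟩
  obtain ⟨r, hr, h⟩ := this
  exact ⟨r, hr, fun w hw => h w ⟨hw, hKX hw⟩⟩

/-- The disc of radius `ρ` orthogonal to `v`. -/
def flatDisc (v : V) (ρ : ℝ) : Set V := {u | inner ℝ u v = 0 ∧ ‖u‖ ≤ ρ}

/-- A sheet of `X`: the graph over a disc orthogonal to `v` of a function `f`, which is isolated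
from the rest of `X`. -/
structure IsSheet (X : Set V) (v : V) (ρ : ℝ) (f : V → ℝ) : Prop where
  mem : ∀ u ∈ flatDisc v ρ, u + f u • v ∈ X
  continuousOn : ContinuousOn f (flatDisc v ρ)
  isolated : ∀ u ∈ flatDisc v ρ, ∀ᶠ x in 𝓝 (u + f u • v), x ∈ X → flat v x ∈ flatDisc v ρ →
    inner ℝ x v = f (flat v x)

/-- The height above a sheet. -/
noncomputable def height (v : V) (f : V → ℝ) (x : V) : ℝ := inner ℝ x v - f (flat v x)

/-- Continuation along the rays from the projection `u₀` of `w₀`. By compactness the graph property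
holds with one radius `r`, so finitely many short steps reach every point of the disc, and the slope
bound keeps the continuation inside the compact set. -/
theorem exists_isSheet (hv : ‖v‖ = 1) (hN : IsSteep N v) (hX : HasChartsIn X N)
    {η : ℝ} (hη : 0 < η) (hK : IsCompact (X ∩ Metric.closedBall 0 (19 / 20 * η)))
    {w₀ : V} (hw₀ : w₀ ∈ X) (hw₀η : ‖w₀‖ ≤ η / 4) :
    ∃ f, IsSheet X v (3 / 4 * η) f ∧ height v f w₀ = 0 := by
  obtain ⟨r, hr, hgraph⟩ := exists_uniform_isGraphAt hv hN hX hK inter_subset_left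
  set u₀ := flat v w₀ with hu₀
  set z₀ := inner ℝ w₀ v with hz₀
  have hu₀v : inner ℝ u₀ v = 0 := inner_flat hv w₀
  have hu₀η : ‖u₀‖ ≤ η / 4 := (norm_flat_le hv w₀).trans hw₀η
  have hz₀η : |z₀| ≤ η / 4 := by
    have := abs_real_inner_le_norm w₀ v
    rw [hv, mul_one] at this
    exact this.trans hw₀η
  have hdist : ∀ k ∈ flatDisc v (3 / 4 * η), ‖k - u₀‖ ≤ η := fun k hk => by
    have := norm_sub_le k u₀
    linarith [hk.2]
  have horth : ∀ k ∈ flatDisc v (3 / 4 * η), inner ℝ (k - u₀) v = 0 := fun k hk => by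
    rw [inner_sub_left, hk.1, hu₀v, sub_zero]
  -- points above the disc that are not too far from the height `z₀` lie in the compact set
  have hnorm : ∀ k ∈ flatDisc v (3 / 4 * η), ∀ s ∈ Icc (0 : ℝ) 1, ∀ z : ℝ,
      |z - z₀| ≤ 3 / 10 * (s * ‖k - u₀‖) → u₀ + s • (k - u₀) + z • v ∈ X →
      u₀ + s • (k - u₀) + z • v ∈ X ∩ Metric.closedBall 0 (19 / 20 * η) := by
    intro k hk s hs z hz hzX
    refine ⟨hzX, mem_closedBall_zero_iff.2 ?_⟩
    have h1 : inner ℝ (u₀ + s • (k - u₀)) v = 0 := by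
      rw [inner_add_left, inner_smul_left, horth k hk, hu₀v]; simp
    have h2 : ‖u₀ + s • (k - u₀)‖ ≤ 3 / 4 * η := by
      have e : u₀ + s • (k - u₀) = (1 - s) • u₀ + s • k := by module
      rw [e]
      refine (norm_add_le _ _).trans ?_
      rw [norm_smul, norm_smul, Real.norm_of_nonneg hs.1, Real.norm_of_nonneg (by linarith [hs.2])]
      nlinarith [hs.1, hs.2, hk.2]
    have h3 : |z| ≤ 11 / 20 * η := by
      have a1 : s * ‖k - u₀‖ ≤ η :=
        (mul_le_of_le_one_left (norm_nonneg _) hs.2).trans (hdist k hk)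
      have a2 := abs_sub_abs_le_abs_sub z z₀
      linarith
    -- The radii fit because `(3/4) ^ 2 + (11/20) ^ 2 < (19/20) ^ 2`, where `11/20 = 1/4 + 3/10`
    -- bounds the height.
    refine (pow_le_pow_iff_left₀ (norm_nonneg _) (by positivity) two_ne_zero).1 ?_
    rw [normSq_add_smul h1 hv, ← sq_abs z]
    have b1 : ‖u₀ + s • (k - u₀)‖ ^ 2 ≤ (3 / 4 * η) ^ 2 := pow_le_pow_left₀ (norm_nonneg _) h2 2
    have b2 : |z| ^ 2 ≤ (11 / 20 * η) ^ 2 := pow_le_pow_left₀ (abs_nonneg _) h3 2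
    nlinarith
  obtain ⟨M, hM⟩ := exists_nat_gt (4 * η / r)
  have hM0 : (0 : ℝ) < M := lt_trans (by positivity) hM
  have hstep : ∀ k ∈ flatDisc v (3 / 4 * η), (1 / M : ℝ) * ‖k - u₀‖ < r / 4 := fun k hk => by
    rw [div_lt_iff₀ hr] at hM
    rw [one_div, inv_mul_lt_iff₀ hM0]
    linarith [hdist k hk]
  -- `ζ k` is the height reached after the fraction `n / M` of the way from `u₀` to `k`. Heights
  -- over different `k` are chosen independently; the Lipschitz clause shows that neighbouring
  -- choices agree, and it becomes continuity of `f`.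
  have main : ∀ n : ℕ, n ≤ M → ∃ ζ : V → ℝ, ∀ k ∈ flatDisc v (3 / 4 * η),
      u₀ + ((n : ℝ) / M) • (k - u₀) + ζ k • v ∈ X ∧
      |ζ k - z₀| ≤ 3 / 10 * ((n : ℝ) / M * ‖k - u₀‖) ∧
      ∀ k' ∈ flatDisc v (3 / 4 * η), ‖k - k'‖ < r / 4 → |ζ k - ζ k'| ≤ 3 / 10 * ‖k - k'‖ := by
    intro n
    induction n with
    | zero =>
      intro _
      refine ⟨fun _ => z₀, fun k hk => ⟨?_, by simp, fun k' hk' _ => by simp⟩⟩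
      simpa [hu₀, hz₀, flat_add_smul] using hw₀
    | succ n ih =>
      intro hn
      obtain ⟨ζ, hζ⟩ := ih (by omega)
      have hs : ∀ m : ℕ, m ≤ M → (m : ℝ) / M ∈ Icc (0 : ℝ) 1 := fun m hm =>
        ⟨by positivity, (div_le_one hM0).2 (by exact_mod_cast hm)⟩
      have hd : ∀ k ∈ flatDisc v (3 / 4 * η), inner ℝ ((1 / M : ℝ) • (k - u₀)) v = 0 ∧
          ‖(1 / M : ℝ) • (k - u₀)‖ < r / 4 := fun k hk => by
        refine ⟨by rw [inner_smul_left, horth k hk]; simp, ?_⟩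
        rw [norm_smul, Real.norm_of_nonneg (by positivity)]
        exact hstep k hk
      have hex : ∀ k : V, ∃ z : ℝ, k ∈ flatDisc v (3 / 4 * η) →
          (|z| ≤ 3 / 10 * ‖(1 / M : ℝ) • (k - u₀)‖ ∧
          u₀ + ((n : ℝ) / M) • (k - u₀) + ζ k • v + (1 / M : ℝ) • (k - u₀) + z • v ∈ X ∧
          ∀ z' : ℝ, |z'| < r →
            u₀ + ((n : ℝ) / M) • (k - u₀) + ζ k • v + (1 / M : ℝ) • (k - u₀) + z' • v ∈ X →
            z' = z) := by
        intro k
        by_cases hk : k ∈ flatDisc v (3 / 4 * η)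
        · obtain ⟨h1, h2, -⟩ := hζ k hk
          obtain ⟨z, hz⟩ := hgraph _ (hnorm k hk _ (hs n (by omega)) _ h2 h1) _ (hd k hk).1
            ((hd k hk).2.trans (by linarith))
          exact ⟨z, fun _ => hz⟩
        · exact ⟨0, fun h => absurd h hk⟩
      choose z hz using hex
      have hpt : ∀ k : V, ∀ a b : ℝ, u₀ + ((n : ℝ) / M) • (k - u₀) + a • v + (1 / M : ℝ) • (k - u₀) +
          b • v = u₀ + (((n + 1 : ℕ) : ℝ) / M) • (k - u₀) + (a + b) • v := by
        intro k a b
        push_cast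
        rw [add_div]
        module
      have hX1 : ∀ k ∈ flatDisc v (3 / 4 * η),
          u₀ + (((n + 1 : ℕ) : ℝ) / M) • (k - u₀) + (ζ k + z k) • v ∈ X := fun k hk => by
        rw [← hpt]; exact (hz k hk).2.1
      have hzk : ∀ k ∈ flatDisc v (3 / 4 * η), |z k| ≤ 3 / 10 * (1 / M * ‖k - u₀‖) := fun k hk => by
        have := (hz k hk).1
        rwa [norm_smul, Real.norm_of_nonneg (by positivity)] at this
      have hb : ∀ k ∈ flatDisc v (3 / 4 * η),
          |ζ k + z k - z₀| ≤ 3 / 10 * (((n + 1 : ℕ) : ℝ) / M * ‖k - u₀‖) := fun k hk => by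
        have h1 := (hζ k hk).2.1
        have h2 := hzk k hk
        have e : ζ k + z k - z₀ = (ζ k - z₀) + z k := by ring
        rw [e]
        refine (abs_add_le _ _).trans ?_
        push_cast
        rw [add_div, add_mul]
        linarith
      refine ⟨fun k => ζ k + z k, fun k hk => ⟨hX1 k hk, hb k hk, fun k' hk' hkk => ?_⟩⟩
      -- The graph at the new point over `k'` supplies a point of `X` over `k`. Its height is within
      -- `r` of the previous one over `k`, so uniqueness identifies it with the new point chosen
      -- there.
      have hgr := hgraph _ (hnorm k' hk' _ (hs (n + 1) hn) _ (hb k' hk') (hX1 k' hk'))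
      have hsn := hs (n + 1) hn
      have hdd : ‖(((n + 1 : ℕ) : ℝ) / M) • (k - k')‖ ≤ ‖k - k'‖ := by
        rw [norm_smul, Real.norm_of_nonneg hsn.1]
        exact mul_le_of_le_one_left (norm_nonneg _) hsn.2
      obtain ⟨y, hy1, hy2, -⟩ := hgr ((((n + 1 : ℕ) : ℝ) / M) • (k - k'))
        (by rw [inner_smul_left, inner_sub_left, hk.1, hk'.1]; simp)
        (hdd.trans_lt (hkk.trans (by linarith)))
      have e : u₀ + (((n + 1 : ℕ) : ℝ) / M) • (k' - u₀) + (ζ k' + z k') • v +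
          (((n + 1 : ℕ) : ℝ) / M) • (k - k') + y • v =
          u₀ + (((n + 1 : ℕ) : ℝ) / M) • (k - u₀) + (ζ k + (ζ k' + z k' + y - ζ k)) • v := by
        module
      rw [e, ← hpt] at hy2
      have b1 := hzk k' hk'
      have b2 := (hζ k hk).2.2 k' hk' hkk
      have b3 := hstep k' hk'
      have huniq := (hz k hk).2.2 _ (by
        have e2 : ζ k' + z k' + y - ζ k = z k' + y + -(ζ k - ζ k') := by ring
        rw [e2]
        refine (abs_add_three _ _ _).trans_lt ?_
        rw [abs_neg]
        linarith) hy2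
      have e3 : ζ k + z k - (ζ k' + z k') = y := by rw [← huniq]; ring
      change |ζ k + z k - (ζ k' + z k')| ≤ _
      rw [e3]
      linarith
  obtain ⟨f, hf⟩ := main M le_rfl
  have hMM : (M : ℝ) / M = 1 := div_self hM0.ne'
  have hpt : ∀ k : V, u₀ + ((M : ℝ) / M) • (k - u₀) = k := fun k => by rw [hMM]; module
  have hfX : ∀ u ∈ flatDisc v (3 / 4 * η), u + f u • v ∈ X := fun u hu => by
    have := (hf u hu).1; rwa [hpt] at this
  have hcont : ContinuousOn f (flatDisc v (3 / 4 * η)) := by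
    rw [Metric.continuousOn_iff]
    intro u hu ε hε
    refine ⟨min (r / 4) ε, lt_min (by positivity) hε, fun k hk hku => ?_⟩
    rw [dist_eq_norm] at hku
    rw [Real.dist_eq]
    refine ((hf k hk).2.2 u hu (hku.trans_le (min_le_left _ _))).trans_lt ?_
    have := hku.trans_le (min_le_right _ _)
    linarith [norm_nonneg (k - u)]
  have hu₀K : u₀ ∈ flatDisc v (3 / 4 * η) := ⟨hu₀v, by linarith⟩
  refine ⟨f, ⟨hfX, hcont, fun u hu => ?_⟩, ?_⟩
  · have hgr := hgraph (u + f u • v) (by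
      have h1 := hnorm u hu 1 ⟨zero_le_one, le_rfl⟩ (f u)
      have e : u₀ + (1 : ℝ) • (u - u₀) = u := by module
      rw [e] at h1
      exact h1 (by have := (hf u hu).2.1; rwa [hMM] at this) (hfX u hu))
    filter_upwards [Metric.ball_mem_nhds (u + f u • v) (show 0 < r / 4 by positivity)] with x hx hxX
      hxK
    rw [Metric.mem_ball, dist_eq_norm] at hx
    set d := flat v x - u with hd
    have hdv : inner ℝ d v = 0 := by rw [hd, inner_sub_left, inner_flat hv, hu.1, sub_zero]
    have hdec : x - (u + f u • v) = d + (inner ℝ x v - f u) • v := by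
      rw [hd, flat]; module
    have hsq := normSq_add_smul hdv hv (inner ℝ x v - f u)
    rw [← hdec] at hsq
    have hd1 : ‖d‖ < r / 4 := by
      refine lt_of_pow_lt_pow_left₀ 2 (by positivity) ?_
      have := pow_lt_pow_left₀ hx (norm_nonneg _) two_ne_zero
      nlinarith [sq_nonneg (inner ℝ x v - f u)]
    have hd2 : |inner ℝ x v - f u| < r / 4 := by
      refine lt_of_pow_lt_pow_left₀ 2 (by positivity) ?_
      have := pow_lt_pow_left₀ hx (norm_nonneg _) two_ne_zero
      rw [sq_abs]
      nlinarith [sq_nonneg ‖d‖]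
    -- Both `x` and the point of the sheet below or above it lie in the range where the local graph
    -- is unique.
    obtain ⟨z, -, -, hz⟩ := hgr d hdv (by linarith)
    have a1 := hz (inner ℝ x v - f u) (by linarith) (by
      have : u + f u • v + d + (inner ℝ x v - f u) • v = x := by
        rw [add_assoc, ← hdec]; abel
      rwa [this])
    have hfd := (hf (flat v x) hxK).2.2 u hu hd1
    have a2 := hz (f (flat v x) - f u) (by
        change |f (flat v x) - f u| ≤ 3 / 10 * ‖d‖ at hfd
        linarith) (by
      have : u + f u • v + d + (f (flat v x) - f u) • v = flat v x + f (flat v x) • v := by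
        rw [hd]; module
      rw [this]
      exact hfX _ hxK)
    linarith
  · have h := (hf u₀ hu₀K).2.1
    rw [sub_self, norm_zero, mul_zero, mul_zero] at h
    have h' := abs_nonpos_iff.1 h
    rw [height, ← hu₀, ← hz₀]
    linarith

end Sheets

/-! ### Functions that cross zero only downward. -/

section Crossing

variable {g : ℝ → ℝ}

/-- All zeros of `g` in the open unit interval are crossings from positive to negative values. -/
def CrossesDownward (g : ℝ → ℝ) : Prop :=
  ∀ t ∈ Ioo (0 : ℝ) 1, g t = 0 → (∀ᶠ s in 𝓝[>] t, g s < 0) ∧ ∀ᶠ s in 𝓝[<] t, 0 < g s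

theorem CrossesDownward.reflect (h : CrossesDownward g) :
    CrossesDownward fun t => -g (1 - t) := by
  intro t ht h0
  obtain ⟨h1, h2⟩ := h (1 - t) ⟨by linarith [ht.2], by linarith [ht.1]⟩ (by linarith)
  have c1 : Filter.Tendsto (fun s : ℝ => 1 - s) (𝓝[>] t) (𝓝[<] (1 - t)) := by
    refine tendsto_nhdsWithin_iff.2 ⟨?_, ?_⟩
    · exact ((continuous_const.sub continuous_id).tendsto t).mono_left nhdsWithin_le_nhds
    · filter_upwards [self_mem_nhdsWithin] with s hs
      have hs' : t < s := hs
      exact mem_Iio.2 (by linarith)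
  have c2 : Filter.Tendsto (fun s : ℝ => 1 - s) (𝓝[<] t) (𝓝[>] (1 - t)) := by
    refine tendsto_nhdsWithin_iff.2 ⟨?_, ?_⟩
    · exact ((continuous_const.sub continuous_id).tendsto t).mono_left nhdsWithin_le_nhds
    · filter_upwards [self_mem_nhdsWithin] with s hs
      have hs' : s < t := hs
      exact mem_Ioi.2 (by linarith)
  exact ⟨(c1.eventually h2).mono fun s hs => neg_lt_zero.2 hs,
    (c2.eventually h1).mono fun s hs => neg_pos.2 hs⟩

/-- At the first return to a nonnegative value there would be a zero preceded by negative values,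
contrary to a downward crossing. -/
theorem CrossesDownward.neg_after (h : CrossesDownward g) (hg : ContinuousOn g (Icc 0 1)) {t : ℝ}
    (ht : t ∈ Ioo (0 : ℝ) 1) (h0 : g t = 0) {s : ℝ} (hts : t < s) (hs : s < 1) : g s < 0 := by
  by_contra hcon
  obtain ⟨t', ht', htt⟩ : ∃ t' ∈ Ioo t s, g t' < 0 := by
    have h1 := (h t ht h0).1
    have h2 : ∀ᶠ x in 𝓝[>] t, x ∈ Ioo t s := Ioo_mem_nhdsGT hts
    obtain ⟨x, hx1, hx2⟩ := (h1.and h2).exists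
    exact ⟨x, hx2, hx1⟩
  set A := {x ∈ Icc t' s | 0 ≤ g x} with hA
  have hgts : ContinuousOn g (Icc t' s) :=
    hg.mono (Icc_subset_Icc (by linarith [ht.1, ht'.1]) hs.le)
  have hAc : IsClosed A := hgts.preimage_isClosed_of_isClosed isClosed_Icc isClosed_Ici
  have hAn : A.Nonempty := ⟨s, ⟨ht'.2.le, le_rfl⟩, not_lt.1 hcon⟩
  have hAb : BddBelow A := ⟨t', fun x hx => hx.1.1⟩
  have hm := hAc.csInf_mem hAn hAb
  set m := sInf A with hmdef
  have hmt : t' < m := lt_of_le_of_ne hm.1.1 (fun e => by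
    have := hm.2; rw [← e] at this; linarith)
  have hlt : ∀ x ∈ Ico t' m, g x < 0 := by
    intro x hx
    by_contra hx0
    exact absurd (csInf_le hAb ⟨⟨hx.1, hx.2.le.trans hm.1.2⟩, not_lt.1 hx0⟩) (not_le.2 hx.2)
  have hm0 : g m = 0 := by
    refine le_antisymm ?_ hm.2
    have hc : ContinuousWithinAt g (Iio m) m := by
      have : ContinuousAt g m :=
        (hg.continuousAt (Icc_mem_nhds (by linarith [ht.1, ht'.1]) (by linarith [hm.1.2])))
      exact this.continuousWithinAt
    refine le_of_tendsto hc ?_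
    filter_upwards [Ioo_mem_nhdsLT hmt] with x hx
    exact (hlt x ⟨hx.1.le, hx.2⟩).le
  have h3 := (h m ⟨by linarith [ht.1, ht'.1], by linarith [hm.1.2]⟩ hm0).2
  obtain ⟨x, hx1, hx2⟩ := (h3.and (Ioo_mem_nhdsLT hmt)).exists
  exact absurd (hlt x ⟨hx2.1.le, hx2.2⟩) (not_lt.2 hx1.le)

theorem CrossesDownward.pos_before (h : CrossesDownward g) (hg : ContinuousOn g (Icc 0 1)) {t : ℝ}
    (ht : t ∈ Ioo (0 : ℝ) 1) (h0 : g t = 0) {s : ℝ} (hs : 0 < s) (hst : s < t) : 0 < g s := by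
  have hg' : ContinuousOn (fun t => -g (1 - t)) (Icc 0 1) :=
    (hg.comp (by fun_prop) fun x hx => ⟨by linarith [hx.2], by linarith [hx.1]⟩).neg
  have := h.reflect.neg_after hg' (t := 1 - t) ⟨by linarith [ht.2], by linarith [ht.1]⟩
    (by simpa using h0) (s := 1 - s) (by linarith) (by linarith)
  simpa using this

/-- An interior zero would make `g` positive before it, and then nonnegative at `0` in the limit. -/
theorem CrossesDownward.neg_of_neg (h : CrossesDownward g) (hg : ContinuousOn g (Icc 0 1))
    (h0 : g 0 < 0) (h1 : g 1 ≠ 0) : ∀ t ∈ Icc (0 : ℝ) 1, g t < 0 := by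
  intro t ht
  by_contra hcon
  obtain ⟨z, hz, hz0⟩ : ∃ z ∈ Icc 0 t, g z = 0 :=
    intermediate_value_Icc ht.1 (hg.mono (Icc_subset_Icc le_rfl ht.2)) ⟨h0.le, not_lt.1 hcon⟩
  have z0 : 0 < z := lt_of_le_of_ne hz.1 fun e => by rw [← e] at hz0; linarith
  have z1 : z < 1 := lt_of_le_of_ne (hz.2.trans ht.2) fun e => h1 (by rw [← e]; exact hz0)
  have hc : ContinuousWithinAt g (Ioi 0) 0 :=
    (hg 0 ⟨le_rfl, zero_le_one⟩).mono_of_mem_nhdsWithin (Icc_mem_nhdsGT zero_lt_one)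
  have : 0 ≤ g 0 := by
    refine ge_of_tendsto hc ?_
    filter_upwards [Ioo_mem_nhdsGT z0] with x hx
    exact (h.pos_before hg ⟨z0, z1⟩ hz0 hx.1 hx.2).le
  linarith

theorem CrossesDownward.pos_of_pos (h : CrossesDownward g) (hg : ContinuousOn g (Icc 0 1))
    (h0 : g 0 ≠ 0) (h1 : 0 < g 1) : ∀ t ∈ Icc (0 : ℝ) 1, 0 < g t := by
  have hg' : ContinuousOn (fun t => -g (1 - t)) (Icc 0 1) :=
    (hg.comp (by fun_prop) fun x hx => ⟨by linarith [hx.2], by linarith [hx.1]⟩).neg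
  intro t ht
  have := h.reflect.neg_of_neg hg' (by simpa using h1) (by simpa using h0) (1 - t)
    ⟨by linarith [ht.2], by linarith [ht.1]⟩
  simpa using this

theorem CrossesDownward.existsUnique (h : CrossesDownward g) (hg : ContinuousOn g (Icc 0 1))
    (h0 : 0 < g 0) (h1 : g 1 < 0) :
    ∃ t ∈ Ioo (0 : ℝ) 1, g t = 0 ∧ ∀ s ∈ Icc (0 : ℝ) 1, g s = 0 → s = t := by
  obtain ⟨z, hz, hz0⟩ := intermediate_value_Icc' zero_le_one hg ⟨h1.le, h0.le⟩
  have hin : ∀ z ∈ Icc (0 : ℝ) 1, g z = 0 → z ∈ Ioo (0 : ℝ) 1 := fun z hz hz0 =>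
    ⟨lt_of_le_of_ne hz.1 fun e => by rw [← e] at hz0; linarith,
      lt_of_le_of_ne hz.2 fun e => by rw [e] at hz0; linarith⟩
  refine ⟨z, hin z hz hz0, hz0, fun s hs hs0 => ?_⟩
  have hz' := hin z hz hz0
  have hs' := hin s hs hs0
  rcases lt_trichotomy s z with hlt | heq | hlt
  · exact absurd (h.neg_after hg hs' hs0 hlt hz'.2) (by rw [hz0]; exact lt_irrefl 0)
  · exact heq
  · exact absurd (h.neg_after hg hz' hz0 hlt hs'.2) (by rw [hs0]; exact lt_irrefl 0)

end Crossing

/-! ### Height above a sheet; sheets are isolated and crossed in one direction. -/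

section Sheets

variable {V : Type*} [NormedAddCommGroup V] [InnerProductSpace ℝ V] {X N : Set V} {v : V} {ρ : ℝ}
  {f : V → ℝ}

theorem IsSheet.continuousOn_height (h : IsSheet X v ρ f) :
    ContinuousOn (height v f) {x | flat v x ∈ flatDisc v ρ} :=
  ContinuousOn.sub (by fun_prop) (h.continuousOn.comp continuous_flat.continuousOn fun _ hx => hx)

theorem eq_of_height_eq_zero {x : V} (hx : height v f x = 0) :
    flat v x + f (flat v x) • v = x := by
  have : f (flat v x) = inner ℝ x v := by rw [height] at hx; linarith
  rw [this, flat_add_smul]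

theorem IsSheet.mem_of_height_eq_zero (h : IsSheet X v ρ f) {x : V}
    (hx : flat v x ∈ flatDisc v ρ) (h0 : height v f x = 0) : x ∈ X := by
  rw [← eq_of_height_eq_zero h0]
  exact h.mem _ hx

theorem IsSheet.eventually_height_eq_zero (h : IsSheet X v ρ f) {x : V}
    (hx : flat v x ∈ flatDisc v ρ) (h0 : height v f x = 0) :
    ∀ᶠ y in 𝓝 x, y ∈ X → flat v y ∈ flatDisc v ρ → height v f y = 0 := by
  have := h.isolated _ hx
  rw [eq_of_height_eq_zero h0] at this
  filter_upwards [this] with y hy h1 h2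
  rw [height, hy h1 h2, sub_self]

/-- A connected part of `X` that meets a sheet stays in this sheet. -/
theorem IsSheet.height_eq_zero_of_isPreconnected (h : IsSheet X v ρ f) {C : Set V}
    (hC : IsPreconnected C) (hCX : C ⊆ X) (hCρ : ∀ x ∈ C, flat v x ∈ flatDisc v ρ) {x₀ : V}
    (hx₀ : x₀ ∈ C) (h0 : height v f x₀ = 0) : ∀ x ∈ C, height v f x = 0 := by
  have : PreconnectedSpace C := Subtype.preconnectedSpace hC
  have hcont : Continuous fun x : C => height v f x :=
    continuousOn_iff_continuous_domRestrict.1 (h.continuousOn_height.mono hCρ)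
  have hclopen : IsClopen {x : C | height v f x = 0} := by
    refine ⟨isClosed_singleton.preimage hcont, ?_⟩
    rw [isOpen_iff_mem_nhds]
    intro x hx
    have h1 := h.eventually_height_eq_zero (hCρ x x.2) hx
    filter_upwards [continuous_subtype_val.continuousAt.eventually h1] with y hy
    exact hy (hCX y.2) (hCρ y y.2)
  rcases isClopen_iff.1 hclopen with he | he
  · exact absurd (show (⟨x₀, hx₀⟩ : C) ∈ {x : C | height v f x = 0} from h0)
      (by rw [he]; exact notMem_empty _)
  · intro x hx
    have : (⟨x, hx⟩ : C) ∈ {x : C | height v f x = 0} := by rw [he]; exact mem_univ _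
    exact this

/-- A curve whose velocity has negative inner product with the normals crosses a sheet downward. -/
theorem IsSheet.crosses (hv : ‖v‖ = 1) (hN : IsSteep N v) (hX : HasChartsIn X N)
    (h : IsSheet X v ρ f) {γ : ℝ → V} {γ' : V} {t : ℝ} (hγ : HasDerivAt γ γ' t)
    (hγρ : ∀ᶠ s in 𝓝 t, flat v (γ s) ∈ flatDisc v ρ) (h0 : height v f (γ t) = 0)
    (hneg : ∀ ν ∈ N, inner ℝ ν γ' < 0) :
    (∀ᶠ s in 𝓝[>] t, height v f (γ s) < 0) ∧ ∀ᶠ s in 𝓝[<] t, 0 < height v f (γ s) := by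
  have ht := hγρ.self_of_nhds
  have hw := h.mem_of_height_eq_zero ht h0
  obtain ⟨G, ν, hG, hGX, hνN⟩ := hX _ hw
  obtain ⟨hν0, hνv⟩ := hN ν hνN
  have hνp : 0 < ‖ν‖ := norm_pos_iff.2 hν0
  obtain ⟨r, hr, hball⟩ := exists_ball_of_chart hG hν0
  -- near the crossing point the signs of `G` and of the height agree
  have hsign : ∀ᶠ x in 𝓝 (γ t), flat v x ∈ flatDisc v ρ →
      |G x - height v f x * inner ℝ ν v| ≤ 1 / 20 * ‖ν‖ * |height v f x| := by
    set y : V → V := fun x => flat v x + f (flat v x) • v with hy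
    have hycont : ContinuousWithinAt y {x | flat v x ∈ flatDisc v ρ} (γ t) := by
      refine ContinuousWithinAt.add continuous_flat.continuousWithinAt
        (ContinuousWithinAt.smul ?_ continuousWithinAt_const)
      exact (h.continuousOn _ ht).comp continuous_flat.continuousWithinAt fun _ hx => hx
    have hy0 : y (γ t) = γ t := eq_of_height_eq_zero h0
    have e1 : ∀ᶠ z in 𝓝 (γ t), z ∈ Metric.ball (γ t) r ∧ (z ∈ X ↔ G z = 0) :=
      Filter.Eventually.and (Metric.ball_mem_nhds _ hr) hGX
    have e2 := hycont.eventually (by rw [hy0]; exact e1)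
    rw [eventually_nhdsWithin_iff] at e2
    filter_upwards [e1, e2] with x hx hx2 hxρ
    obtain ⟨hyb, hyX⟩ := hx2 hxρ
    have hGy : G (y x) = 0 := hyX.1 (h.mem _ hxρ)
    have hb := hball x hx.1 (y x) hyb
    have e : x - y x = height v f x • v := by
      have e1 : x - flat v x = (inner ℝ x v : ℝ) • v := by rw [flat]; abel
      change x - (flat v x + f (flat v x) • v) = (inner ℝ x v - f (flat v x)) • v
      rw [sub_add_eq_sub_sub, e1, sub_smul]
    rwa [hGy, sub_zero, e, inner_smul_right, norm_smul, hv, mul_one, Real.norm_eq_abs] at hb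
  have hs := (hγ.continuousAt.eventually hsign).and hγρ
  have key : ∀ᶠ s in 𝓝 t, (G (γ s) < 0 → height v f (γ s) < 0) ∧
      (0 < G (γ s) → 0 < height v f (γ s)) := by
    filter_upwards [hs] with s hs
    have hb := abs_le.1 (hs.1 hs.2)
    set a := height v f (γ s)
    constructor
    · intro hg
      by_contra hcon
      rw [abs_of_nonneg (not_lt.1 hcon)] at hb
      nlinarith [mul_le_mul_of_nonneg_left hνv (not_lt.1 hcon), mul_nonneg (not_lt.1 hcon) hνp.le]
    · intro hg
      by_contra hcon
      rw [abs_of_nonpos (not_lt.1 hcon)] at hb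
      nlinarith [mul_le_mul_of_nonpos_left hνv (not_lt.1 hcon),
        mul_nonpos_of_nonpos_of_nonneg (not_lt.1 hcon) hνp.le]
  have hG0 : G (γ t) = 0 := hGX.self_of_nhds.1 hw
  have hd : HasDerivAt (fun s => G (γ s)) (inner ℝ ν γ') t :=
    hG.hasFDerivAt.comp_hasDerivAt t hγ
  have hslope := (hasDerivAt_iff_tendsto_slope.1 hd).eventually_lt_const (hneg ν hνN)
  rw [eventually_nhdsWithin_iff] at hslope
  constructor
  · filter_upwards [nhdsWithin_le_nhds hslope, nhdsWithin_le_nhds key, self_mem_nhdsWithin] with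
      s h1 h2 h3
    have h3' : t < s := h3
    have h4 := h1 (ne_of_gt h3')
    rw [slope_def_field, hG0, sub_zero] at h4
    exact h2.1 ((div_neg_iff.1 h4).elim (fun h => absurd h.2 (by linarith)) fun h => h.1)
  · filter_upwards [nhdsWithin_le_nhds hslope, nhdsWithin_le_nhds key, self_mem_nhdsWithin] with
      s h1 h2 h3
    have h3' : s < t := h3
    have h4 := h1 (ne_of_lt h3')
    rw [slope_def_field, hG0, sub_zero] at h4
    exact h2.2 ((div_neg_iff.1 h4).elim (fun h => h.1) fun h => absurd h.2 (by linarith))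

end Sheets

/-! ### A geodesic simplex with monotone edges against a sheet. -/

section SheetSimplex

variable {V : Type*} [NormedAddCommGroup V] [InnerProductSpace ℝ V]

/-- Along the geodesic from `kleinExp a` to `kleinExp b`, every vector of `N` decreases. -/
def Descends (N : Set V) (a b : V) : Prop :=
  ∀ ν ∈ N, ∀ t ∈ Icc (0 : ℝ) 1, inner ℝ ν (kleinTangent (a + t • (b - a)) (b - a)) < 0

variable {X N : Set V} {v : V} {ρ : ℝ} {f : V → ℝ}

theorem add_smul_sub_mem_convexHull {s : Set V} {a b : V} (ha : a ∈ convexHull ℝ s)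
    (hb : b ∈ convexHull ℝ s) {t : ℝ} (ht : t ∈ Icc (0 : ℝ) 1) :
    a + t • (b - a) ∈ convexHull ℝ s :=
  (convex_convexHull ℝ s).add_smul_sub_mem ha hb ht

theorem norm_add_smul_sub_lt_one {a b : V} (ha : ‖a‖ < 1) (hb : ‖b‖ < 1) {t : ℝ}
    (ht : t ∈ Icc (0 : ℝ) 1) : ‖a + t • (b - a)‖ < 1 :=
  mem_ball_zero_iff.1 ((convex_ball (0 : V) 1).add_smul_sub_mem (mem_ball_zero_iff.2 ha)
    (mem_ball_zero_iff.2 hb) ht)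

theorem Descends.inner_kleinExp_lt {a b ν : V} (h : Descends N a b) (ha : ‖a‖ < 1) (hb : ‖b‖ < 1)
    (hν : ν ∈ N) : inner ℝ ν (kleinExp b) < inner ℝ ν (kleinExp a) := by
  have hd : ∀ t ∈ Icc (0 : ℝ) 1, HasDerivAt (fun t : ℝ => inner ℝ ν (kleinExp (a + t • (b - a))))
      (inner ℝ ν (stretch (‖a + t • (b - a)‖ ^ 2) • kleinTangent (a + t • (b - a)) (b - a))) t := by
    intro t ht
    have := hasDerivAt_kleinExp_line (norm_add_smul_sub_lt_one ha hb ht)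
    exact (innerSL ℝ ν).hasFDerivAt.comp_hasDerivAt t this
  have hanti : StrictAntiOn (fun t : ℝ => inner ℝ ν (kleinExp (a + t • (b - a)))) (Icc 0 1) := by
    refine strictAntiOn_of_deriv_neg (convex_Icc 0 1)
      (fun t ht => (hd t ht).continuousAt.continuousWithinAt) fun t ht => ?_
    have ht' := interior_subset ht
    rw [(hd t ht').deriv, inner_smul_right]
    exact mul_neg_of_pos_of_neg
      (stretch_pos (sq_norm_lt_one (norm_add_smul_sub_lt_one ha hb ht'))) (h ν hν t ht')
  have := hanti ⟨le_rfl, zero_le_one⟩ ⟨zero_le_one, le_rfl⟩ zero_lt_one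
  simpa using this

/-- A sheet of `X`, and the geodesic simplex spanned by the points `kleinExp (k i)`, along the
edges of which all the normals in `N` are monotone. -/
structure IsTransverseSimplex {ι : Type*} (X N : Set V) (v : V) (ρ : ℝ) (f : V → ℝ)
    (k : ι → V) : Prop where
  norm_eq : ‖v‖ = 1
  mem : v ∈ N
  steep : IsSteep N v
  charts : HasChartsIn X N
  sheet : IsSheet X v ρ f
  norm_lt : ∀ i, ‖k i‖ < 1
  norm_le : ∀ x ∈ convexHull ℝ (range k), ‖kleinExp x‖ ≤ ρ
  edge : ∀ i j, i ≠ j → Descends N (k i) (k j) ∨ Descends N (k j) (k i)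
  vertex : ∀ i, height v f (kleinExp (k i)) ≠ 0

namespace IsTransverseSimplex

variable {ι : Type*} {k : ι → V} (h : IsTransverseSimplex X N v ρ f k)
include h

theorem norm_lt_of_mem {x : V} (hx : x ∈ convexHull ℝ (range k)) : ‖x‖ < 1 :=
  mem_ball_zero_iff.1 (convexHull_min (by rintro _ ⟨i, rfl⟩; exact mem_ball_zero_iff.2 (h.norm_lt i))
    (convex_ball (0 : V) 1) hx)

theorem flat_mem {x : V} (hx : x ∈ convexHull ℝ (range k)) :
    flat v (kleinExp x) ∈ flatDisc v ρ :=
  ⟨inner_flat h.norm_eq _, (norm_flat_le h.norm_eq _).trans (h.norm_le x hx)⟩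

theorem continuousOn_height :
    ContinuousOn (fun x => height v f (kleinExp x)) (convexHull ℝ (range k)) :=
  h.sheet.continuousOn_height.comp
    (continuousOn_kleinExp.mono fun _ hx => mem_ball_zero_iff.2 (h.norm_lt_of_mem hx))
    fun _ hx => h.flat_mem hx

theorem continuousOn_join {a b : V} (ha : a ∈ convexHull ℝ (range k))
    (hb : b ∈ convexHull ℝ (range k)) :
    ContinuousOn (fun t : ℝ => height v f (kleinExp (a + t • (b - a)))) (Icc 0 1) :=
  h.continuousOn_height.comp (by fun_prop) fun _ ht => add_smul_sub_mem_convexHull ha hb ht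

/-- Here descent along the edges from `P` to `Q` becomes descent along all geodesics between the two
spanned faces: `inner_kleinTangent_join_neg` is applied to each normal in `N` separately. -/
theorem crossesDownward {P Q : Set ι} (hPQ : ∀ i ∈ P, ∀ j ∈ Q, Descends N (k i) (k j)) {a b : V}
    (ha : a ∈ convexHull ℝ (k '' P)) (hb : b ∈ convexHull ℝ (k '' Q)) :
    CrossesDownward fun t : ℝ => height v f (kleinExp (a + t • (b - a))) := by
  have ha' := convexHull_mono (image_subset_range k P) ha
  have hb' := convexHull_mono (image_subset_range k Q) hb
  have hball : ∀ P : Set ι, k '' P ⊆ Metric.ball 0 1 := fun P => by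
    rintro _ ⟨i, -, rfl⟩; exact mem_ball_zero_iff.2 (h.norm_lt i)
  intro t ht h0
  have htI : t ∈ Icc (0 : ℝ) 1 := Ioo_subset_Icc_self ht
  have hlt := h.norm_lt_of_mem (add_smul_sub_mem_convexHull ha' hb' htI)
  refine h.sheet.crosses h.norm_eq h.steep h.charts (hasDerivAt_kleinExp_line hlt) ?_ h0 ?_
  · filter_upwards [Icc_mem_nhds ht.1 ht.2] with s hs
    exact h.flat_mem (add_smul_sub_mem_convexHull ha' hb' hs)
  · intro ν hν
    rw [inner_smul_right]
    refine mul_neg_of_pos_of_neg (stretch_pos (sq_norm_lt_one hlt)) ?_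
    have e : a + t • (b - a) = (1 - t) • a + t • b := by module
    rw [e]
    refine inner_kleinTangent_join_neg (hball P) (hball Q) ?_ ?_ ?_ ha hb
      (by linarith [ht.2]) ht.1 (by ring)
    · rintro _ ⟨i, hi, rfl⟩ _ ⟨j, hj, rfl⟩
      exact (hPQ i hi j hj).inner_kleinExp_lt (h.norm_lt i) (h.norm_lt j) hν
    · rintro _ ⟨i, hi, rfl⟩ _ ⟨j, hj, rfl⟩
      simpa using hPQ i hi j hj ν hν 1 ⟨zero_le_one, le_rfl⟩
    · rintro _ ⟨i, hi, rfl⟩ _ ⟨j, hj, rfl⟩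
      simpa using hPQ i hi j hj ν hν 0 ⟨le_rfl, zero_le_one⟩

/-- Every nonempty set of vertices has a highest one. -/
theorem exists_top [Finite ι] {T : Set ι} (hT : T.Nonempty) :
    ∃ i ∈ T, ∀ j ∈ T \ {i}, Descends N (k i) (k j) := by
  obtain ⟨i, hi, hmax⟩ := Set.exists_max_image T (fun i => inner ℝ v (kleinExp (k i)))
    T.toFinite hT
  refine ⟨i, hi, fun j hj => ?_⟩
  rcases h.edge i j (fun e => hj.2 e.symm) with hd | hd
  · exact hd
  · exact absurd (hd.inner_kleinExp_lt (h.norm_lt j) (h.norm_lt i) h.mem) (hmax j hj.1).not_gt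

omit h in
theorem exists_join {T : Set ι} {i : ι} (hi : i ∈ T) (hT : (T \ {i}).Nonempty) {x : V}
    (hx : x ∈ convexHull ℝ (k '' T)) :
    ∃ b ∈ convexHull ℝ (k '' (T \ {i})), ∃ t ∈ Icc (0 : ℝ) 1, x = k i + t • (b - k i) := by
  rw [← insert_sdiff_self_of_mem hi, image_insert_eq, convexHull_insert (hT.image k),
    mem_convexJoin] at hx
  obtain ⟨a, ha, b, hb, hx⟩ := hx
  rw [mem_singleton_iff.1 ha, segment_eq_image'] at hx
  obtain ⟨t, ht, rfl⟩ := hx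
  exact ⟨b, hb, t, ht, rfl⟩

/-- Induction on the number of vertices, removing the highest. Each point lies on a geodesic from
the top vertex to the remaining face. Such a geodesic crosses only downward, and its far end is
positive by induction, so there is no crossing at all. -/
theorem height_pos_of_vertices [Finite ι] (T : Set ι)
    (hT : ∀ i ∈ T, 0 < height v f (kleinExp (k i))) :
    ∀ x ∈ convexHull ℝ (k '' T), 0 < height v f (kleinExp x) := by
  induction T using WellFoundedLT.induction with
  | ind T ih =>
    intro x hx
    have hne : T.Nonempty := image_nonempty.1 (convexHull_nonempty_iff.1 ⟨x, hx⟩)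
    obtain ⟨i, hi, htop⟩ := h.exists_top hne
    rcases (T \ {i}).eq_empty_or_nonempty with he | hne'
    · have : T = {i} := Subset.antisymm (sdiff_eq_empty.1 he) (singleton_subset_iff.2 hi)
      rw [this, image_singleton, convexHull_singleton, mem_singleton_iff] at hx
      rw [hx]
      exact hT i hi
    · obtain ⟨b, hb, t, ht, rfl⟩ := exists_join hi hne' hx
      have hpos := ih (T \ {i}) (sdiff_singleton_ssubset.2 hi) (fun j hj => hT j hj.1) b hb
      have hki : k i ∈ convexHull ℝ (k '' {i}) := by simp
      exact (h.crossesDownward (P := {i}) (fun i' hi' j hj => by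
        rw [mem_singleton_iff.1 hi']; exact htop j hj) hki hb).pos_of_pos
        (h.continuousOn_join (convexHull_mono (image_subset_range k _) hki)
          (convexHull_mono (image_subset_range k _) hb)) (by simpa using h.vertex i)
        (by simpa using hpos) t ht

theorem height_neg_of_vertices [Finite ι] (T : Set ι)
    (hT : ∀ i ∈ T, height v f (kleinExp (k i)) < 0) :
    ∀ x ∈ convexHull ℝ (k '' T), height v f (kleinExp x) < 0 := by
  induction T using WellFoundedLT.induction with
  | ind T ih =>
    intro x hx
    have hne : T.Nonempty := image_nonempty.1 (convexHull_nonempty_iff.1 ⟨x, hx⟩)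
    obtain ⟨i, hi, htop⟩ := h.exists_top hne
    rcases (T \ {i}).eq_empty_or_nonempty with he | hne'
    · have : T = {i} := Subset.antisymm (sdiff_eq_empty.1 he) (singleton_subset_iff.2 hi)
      rw [this, image_singleton, convexHull_singleton, mem_singleton_iff] at hx
      rw [hx]
      exact hT i hi
    · obtain ⟨b, hb, t, ht, rfl⟩ := exists_join hi hne' hx
      have hneg := ih (T \ {i}) (sdiff_singleton_ssubset.2 hi) (fun j hj => hT j hj.1) b hb
      have hki : k i ∈ convexHull ℝ (k '' {i}) := by simp
      exact (h.crossesDownward (P := {i}) (fun i' hi' j hj => by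
        rw [mem_singleton_iff.1 hi']; exact htop j hj) hki hb).neg_of_neg
        (h.continuousOn_join (convexHull_mono (image_subset_range k _) hki)
          (convexHull_mono (image_subset_range k _) hb)) (by simpa using hT i hi)
        (by simpa using hneg.ne) t ht

/-- An edge that descends from below the sheet could never reach the upper side. -/
theorem descends_of_height {i j : ι} (hi : 0 < height v f (kleinExp (k i)))
    (hj : height v f (kleinExp (k j)) < 0) : Descends N (k i) (k j) := by
  rcases h.edge i j (by rintro rfl; exact lt_asymm hi hj) with hd | hd
  · exact hd
  · have hm : ∀ i, k i ∈ convexHull ℝ (k '' {i}) := fun i => by simp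
    have := (h.crossesDownward (P := {j}) (Q := {i}) (fun i' hi' j' hj' => by
        rw [mem_singleton_iff.1 hi', mem_singleton_iff.1 hj']; exact hd) (hm j) (hm i)).neg_of_neg
        (h.continuousOn_join (convexHull_mono (image_subset_range k _) (hm j))
          (convexHull_mono (image_subset_range k _) (hm i))) (by simpa using hj)
        (by simpa using hi.ne') 1 ⟨zero_le_one, le_rfl⟩
    simp only [one_smul, add_sub_cancel] at this
    exact absurd this hi.not_gt

/-- The sheet meets each segment from the face spanned by the vertices above it to the face spanned
by the vertices below it exactly once. -/
theorem existsUnique_join [Finite ι] {a b : V}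
    (ha : a ∈ convexHull ℝ (k '' {i | 0 < height v f (kleinExp (k i))}))
    (hb : b ∈ convexHull ℝ (k '' {i | 0 < height v f (kleinExp (k i))}ᶜ)) :
    ∃ t ∈ Ioo (0 : ℝ) 1, height v f (kleinExp (a + t • (b - a))) = 0 ∧
      ∀ s ∈ Icc (0 : ℝ) 1, height v f (kleinExp (a + s • (b - a))) = 0 → s = t := by
  have hneg : ∀ j ∈ {i | 0 < height v f (kleinExp (k i))}ᶜ, height v f (kleinExp (k j)) < 0 :=
    fun j hj => lt_of_le_of_ne (not_lt.1 hj) (h.vertex j)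
  refine (h.crossesDownward (fun i hi j hj => h.descends_of_height hi (hneg j hj)) ha
    hb).existsUnique (h.continuousOn_join (convexHull_mono (image_subset_range k _) ha)
      (convexHull_mono (image_subset_range k _) hb)) ?_ ?_
  · simpa using h.height_pos_of_vertices _ (fun i hi => hi) a ha
  · simpa using h.height_neg_of_vertices _ hneg b hb

end IsTransverseSimplex

end SheetSimplex

/-! ### Compact sets in bijection with convex regions. -/

section CompactHomeomorph

variable {X Y : Type*} [TopologicalSpace X] [TopologicalSpace Y]

theorem exists_homeomorph_of_bijOn [T2Space Y] {s : Set X} {t : Set Y} (hs : IsCompact s)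
    {f : X → Y} (hf : ContinuousOn f s) (hb : BijOn f s t) :
    ∃ h : s ≃ₜ t, ∀ x : s, (h x : Y) = f x := by
  have : CompactSpace s := isCompact_iff_compactSpace.1 hs
  have hc : Continuous (hb.equiv f) :=
    Continuous.subtype_mk (continuousOn_iff_continuous_domRestrict.1 hf) _
  exact ⟨hc.homeoOfEquivCompactToT2, fun x => rfl⟩

end CompactHomeomorph

section ConvexRegion

variable {E : Type*} [NormedAddCommGroup E] [NormedSpace ℝ E]
  {ι : Type*} [Finite ι]

/-- The vector `d` decreases `l m` at unit speed. Moving slightly along it from an interior point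
keeps `l m` nonnegative, so `l m` was positive before. -/
theorem interior_setOf_forall_nonneg {l : ι → E → ℝ} (hl : ∀ m, Continuous (l m))
    (hd : ∀ m, ∃ d : E, ∀ p (s : ℝ), l m (p + s • d) = l m p - s) :
    interior {p | ∀ m, 0 ≤ l m p} = {p | ∀ m, 0 < l m p} := by
  refine Subset.antisymm (fun p hp m => ?_) (interior_maximal (fun p hp m => (hp m).le) ?_)
  · obtain ⟨d, hd⟩ := hd m
    have hcont : Filter.Tendsto (fun s : ℝ => p + s • d) (𝓝[>] 0) (𝓝 p) := by
      have : Continuous fun s : ℝ => p + s • d := by fun_prop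
      have := (this.tendsto 0).mono_left (nhdsWithin_le_nhds (s := Ioi 0))
      simpa using this
    have h1 := hcont.eventually (mem_interior_iff_mem_nhds.1 hp)
    obtain ⟨s, hs, hs0⟩ := (h1.and self_mem_nhdsWithin).exists
    have h2 : 0 ≤ l m (p + s • d) := hs m
    have h3 : 0 < s := hs0
    rw [hd] at h2
    linarith
  · have : {p | ∀ m, 0 < l m p} = ⋂ m, l m ⁻¹' Ioi 0 := by ext p; simp [mem_iInter]
    rw [this]
    exact isOpen_iInter_of_finite fun m => isOpen_Ioi.preimage (hl m)

/-- A compact set with a bijective continuous map to a bounded region that is cut out by affine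
inequalities is parametrised by the unit ball. -/
theorem exists_ball_parametrization {X Y : Type*} [TopologicalSpace X] [TopologicalSpace Y]
    [T2Space Y] {Q : Set X} (hQ : IsCompact Q) {B : X → Y} (hB : ContinuousOn B Q)
    (hBi : InjOn B Q) {l : ι → E → ℝ} (hl : ∀ m, Continuous (l m))
    (hd : ∀ m, ∃ d : E, ∀ p (s : ℝ), l m (p + s • d) = l m p - s)
    (hconv : Convex ℝ {p | ∀ m, 0 ≤ l m p}) (hpos : ∃ p, ∀ m, 0 < l m p) {Ψ : X → E}
    (hΨ : ContinuousOn Ψ Q) (hb : BijOn Ψ Q {p | ∀ m, 0 ≤ l m p}) :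
    ∃ h : Metric.closedBall (0 : E) 1 ≃ₜ B '' Q, ∀ z, ∃ x ∈ Q, (h z : Y) = B x ∧
      ((∃ m, l m (Ψ x) = 0) ↔ ‖(z : E)‖ = 1) := by
  set C := {p | ∀ m, 0 ≤ l m p} with hC
  have hCc : IsCompact C := by rw [← hb.image_eq]; exact hQ.image_of_continuousOn hΨ
  have hint := interior_setOf_forall_nonneg hl hd
  obtain ⟨p₀, hp₀⟩ := hpos
  obtain ⟨g, -, hg2, hg3⟩ := exists_homeomorph_image_interior_closure_frontier_eq_unitBall hconv
    ⟨p₀, by rw [hint]; exact hp₀⟩ hCc.isBounded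
  rw [hCc.isClosed.closure_eq] at hg2
  obtain ⟨h1, hh1⟩ := exists_homeomorph_of_bijOn hQ hΨ hb
  obtain ⟨h2, hh2⟩ := exists_homeomorph_of_bijOn hQ hB hBi.bijOn_image
  obtain ⟨h3, hh3⟩ := exists_homeomorph_of_bijOn hCc g.continuous.continuousOn
    (t := Metric.closedBall 0 1) ⟨fun p hp => hg2 ▸ mem_image_of_mem g hp, g.injective.injOn,
      hg2.symm.subset⟩
  refine ⟨(h3.symm.trans h1.symm).trans h2, fun z => ?_⟩
  set x := h1.symm (h3.symm z) with hx
  refine ⟨x, x.2, hh2 x, ?_⟩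
  have e1 : Ψ x = h3.symm z := by rw [← hh1 x, hx, h1.apply_symm_apply]
  have e2 : g (Ψ x) = z := by rw [e1, ← hh3, h3.apply_symm_apply]
  have hxC : Ψ x ∈ C := hb.mapsTo x.2
  have hfr : ‖(z : E)‖ = 1 ↔ Ψ x ∈ frontier C := by
    rw [← mem_sphere_zero_iff_norm, ← hg3, ← e2, g.injective.mem_set_image]
  rw [hfr, frontier, hCc.isClosed.closure_eq, hint]
  refine ⟨fun ⟨m, hm⟩ => ⟨hxC, fun hcon => ?_⟩, fun hf => ?_⟩
  · exact absurd hm (hcon m).ne'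
  · by_contra hcon
    push Not at hcon
    exact hf.2 fun m => lt_of_le_of_ne (hxC m) (hcon m).symm

end ConvexRegion

/-! ### Subsets of the simplex that meet each join of two opposite faces once. -/

section Joins

variable {ι : Type*} [Fintype ι] [DecidableEq ι]

/-- `Q` meets each segment in the standard simplex from the face spanned by `P` to the opposite
face exactly once, in an interior point. -/
def MeetsJoinsOnce (Q : Set (ι → ℝ)) (P : Finset ι) : Prop :=
  ∀ a ∈ stdSimplex ℝ ι, ∀ b ∈ stdSimplex ℝ ι, (∀ i ∉ P, a i = 0) → (∀ i ∈ P, b i = 0) →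
    ∃ t ∈ Ioo (0 : ℝ) 1, a + t • (b - a) ∈ Q ∧
      ∀ s ∈ Icc (0 : ℝ) 1, a + s • (b - a) ∈ Q → s = t

/-- The normalised part of `x` in the face spanned by `P`. -/
noncomputable def partOn (P : Finset ι) (x : ι → ℝ) : ι → ℝ :=
  fun i => if i ∈ P then x i / ∑ j ∈ P, x j else 0

variable {Q : Set (ι → ℝ)} {P : Finset ι}

theorem MeetsJoinsOnce.compl (h : MeetsJoinsOnce Q P) : MeetsJoinsOnce Q Pᶜ := by
  intro a ha b hb haP hbP
  obtain ⟨t, ht, hQ, huniq⟩ := h b hb a ha (fun i hi => hbP i (Finset.mem_compl.2 hi))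
    (fun i hi => haP i (by simpa using hi))
  have e : ∀ s : ℝ, a + s • (b - a) = b + (1 - s) • (a - b) := fun s => by module
  refine ⟨1 - t, ⟨by linarith [ht.2], by linarith [ht.1]⟩, ?_, fun s hs hsQ => ?_⟩
  · rw [e]; simpa using hQ
  · rw [e] at hsQ
    have := huniq (1 - s) ⟨by linarith [hs.2], by linarith [hs.1]⟩ hsQ
    linarith

theorem partOn_mem {x : ι → ℝ} (hx : x ∈ stdSimplex ℝ ι) (hP : 0 < ∑ j ∈ P, x j) :
    partOn P x ∈ stdSimplex ℝ ι := by
  refine ⟨fun i => ?_, ?_⟩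
  · rw [partOn]
    split_ifs
    · exact div_nonneg (hx.1 i) hP.le
    · exact le_rfl
  · simp only [partOn]
    rw [Finset.sum_ite_mem, Finset.univ_inter, ← Finset.sum_div, div_self hP.ne']

omit [Fintype ι] in
theorem partOn_of_notMem {x : ι → ℝ} {i : ι} (hi : i ∉ P) : partOn P x i = 0 := if_neg hi

omit [Fintype ι] in
theorem partOn_of_mem {x : ι → ℝ} {i : ι} (hi : i ∈ P) : partOn P x i = x i / ∑ j ∈ P, x j :=
  if_pos hi

theorem sum_add_sum_compl_eq_one {x : ι → ℝ} (hx : x ∈ stdSimplex ℝ ι) (P : Finset ι) :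
    ∑ j ∈ P, x j + ∑ j ∈ Pᶜ, x j = 1 := by
  rw [Finset.sum_add_sum_compl, hx.2]

theorem partOn_join {x : ι → ℝ} (hx : x ∈ stdSimplex ℝ ι) (hP : 0 < ∑ j ∈ P, x j)
    (hP' : 0 < ∑ j ∈ Pᶜ, x j) :
    partOn P x + (∑ j ∈ Pᶜ, x j) • (partOn Pᶜ x - partOn P x) = x := by
  have h1 := sum_add_sum_compl_eq_one hx P
  ext i
  simp only [Pi.add_apply, Pi.smul_apply, Pi.sub_apply, smul_eq_mul]
  by_cases hi : i ∈ P
  · rw [partOn_of_mem hi, partOn_of_notMem (by simpa using hi)]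
    have : ∑ j ∈ Pᶜ, x j = 1 - ∑ j ∈ P, x j := by linarith
    rw [this]
    field_simp
    ring
  · rw [partOn_of_notMem hi, partOn_of_mem (by simpa using hi)]
    field_simp
    ring

/-- A point of `Q` in the face opposite to `P` would be the endpoint of a join from a vertex in `P`,
whereas the only meeting point is interior. -/
theorem MeetsJoinsOnce.sum_pos (h : MeetsJoinsOnce Q P) (hP : P.Nonempty)
    (hQ : Q ⊆ stdSimplex ℝ ι) {x : ι → ℝ} (hx : x ∈ Q) : 0 < ∑ j ∈ P, x j := by
  refine lt_of_le_of_ne (Finset.sum_nonneg fun i _ => (hQ hx).1 i) fun h0 => ?_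
  have h0' := (Finset.sum_eq_zero_iff_of_nonneg fun i _ => (hQ hx).1 i).1 h0.symm
  obtain ⟨i₀, hi₀⟩ := hP
  obtain ⟨t, ht, -, huniq⟩ := h (Pi.single i₀ 1) (single_mem_stdSimplex ℝ i₀) x (hQ hx)
    (fun i hi => Pi.single_eq_of_ne (by rintro rfl; exact hi hi₀) 1) h0'
  have := huniq 1 ⟨zero_le_one, le_rfl⟩ (by simpa using hx)
  linarith [ht.2]

-- Surjectivity of the normalised projection of `Q` to the product of the two opposite faces.
omit [DecidableEq ι] in
theorem MeetsJoinsOnce.exists_mem (h : MeetsJoinsOnce Q P) {a b : ι → ℝ}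
    (ha : a ∈ stdSimplex ℝ ι) (hb : b ∈ stdSimplex ℝ ι) (haP : ∀ i ∉ P, a i = 0)
    (hbP : ∀ i ∈ P, b i = 0) :
    ∃ x ∈ Q, ∃ t ∈ Ioo (0 : ℝ) 1, (∀ i ∈ P, x i = (1 - t) * a i) ∧ ∀ i ∉ P, x i = t * b i := by
  obtain ⟨t, ht, hQ, -⟩ := h a ha b hb haP hbP
  refine ⟨_, hQ, t, ht, fun i hi => ?_, fun i hi => ?_⟩
  · simp only [Pi.add_apply, Pi.smul_apply, Pi.sub_apply, smul_eq_mul, hbP i hi]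
    ring
  · simp only [Pi.add_apply, Pi.smul_apply, Pi.sub_apply, smul_eq_mul, haP i hi]
    ring

/-- Injectivity of the same projection: proportional coordinates on each side mean that both points
lie on one join. -/
theorem MeetsJoinsOnce.eq_of_proportional (h : MeetsJoinsOnce Q P) (hP : P.Nonempty)
    (hP' : Pᶜ.Nonempty) (hQ : Q ⊆ stdSimplex ℝ ι) {x y : ι → ℝ} (hx : x ∈ Q) (hy : y ∈ Q)
    {c d : ℝ} (hc : ∀ i ∈ P, x i = c * y i) (hd : ∀ i ∉ P, x i = d * y i) : x = y := by
  have key : ∀ (P : Finset ι) (c : ℝ), 0 < ∑ j ∈ P, x j → 0 < ∑ j ∈ P, y j →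
      (∀ i ∈ P, x i = c * y i) → partOn P x = partOn P y := by
    intro P c hxP hyP hc
    have hs : ∑ j ∈ P, x j = c * ∑ j ∈ P, y j := by
      rw [Finset.mul_sum]; exact Finset.sum_congr rfl hc
    have hc0 : c ≠ 0 := by rintro rfl; simp at hs; linarith
    ext i
    by_cases hi : i ∈ P
    · rw [partOn_of_mem hi, partOn_of_mem hi, hs, hc i hi, mul_div_mul_left _ _ hc0]
    · rw [partOn_of_notMem hi, partOn_of_notMem hi]
  have x1 := h.sum_pos hP hQ hx
  have x2 := h.compl.sum_pos hP' hQ hx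
  have y1 := h.sum_pos hP hQ hy
  have y2 := h.compl.sum_pos hP' hQ hy
  have e1 := key P c x1 y1 hc
  have e2 := key Pᶜ d x2 y2 fun i hi => hd i (Finset.mem_compl.1 hi)
  have jx := partOn_join (hQ hx) x1 x2
  have jy := partOn_join (hQ hy) y1 y2
  obtain ⟨t, -, -, huniq⟩ := h (partOn P x) (partOn_mem (hQ hx) x1) (partOn Pᶜ x)
    (partOn_mem (hQ hx) x2) (fun i hi => partOn_of_notMem hi)
    (fun i hi => partOn_of_notMem (by simpa using hi))
  have hsum := sum_add_sum_compl_eq_one (hQ hx) P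
  have hsum' := sum_add_sum_compl_eq_one (hQ hy) P
  have tx := huniq _ ⟨x2.le, by linarith⟩ (by rw [jx]; exact hx)
  have ty := huniq (∑ j ∈ Pᶜ, y j) ⟨y2.le, by linarith⟩ (by rw [e1, e2, jy]; exact hy)
  rw [← jx, ← jy, ← e1, ← e2, tx, ty]

end Joins

/-! ### Triangles, squares and arcs in the 3-simplex. -/

section Discs

/-- The Euclidean plane. -/
abbrev E2 : Type := EuclideanSpace ℝ (Fin 2)

theorem sum_fin_four {i j k l : Fin 4} (hij : i ≠ j) (hik : i ≠ k) (hil : i ≠ l) (hjk : j ≠ k)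
    (hjl : j ≠ l) (hkl : k ≠ l) (x : Fin 4 → ℝ) : ∑ m, x m = x i + x j + x k + x l := by
  have : (Finset.univ : Finset (Fin 4)) = {i, j, k, l} := by
    revert i j k l; decide
  rw [this, Finset.sum_insert (by simp [*]), Finset.sum_insert (by simp [*]),
    Finset.sum_insert (by simp [*]), Finset.sum_singleton]
  ring

theorem eq_or_eq_of_distinct {i j k l : Fin 4} (hij : i ≠ j) (hik : i ≠ k) (hil : i ≠ l)
    (hjk : j ≠ k) (hjl : j ≠ l) (hkl : k ≠ l) (m : Fin 4) : m = i ∨ m = j ∨ m = k ∨ m = l := by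
  revert i j k l m; decide

variable {Y : Type*} [TopologicalSpace Y] [T2Space Y] {Q : Set (Fin 4 → ℝ)}
  {B : (Fin 4 → ℝ) → Y}

/-- One of the two opposite faces is a point, so `Q` projects bijectively to the other, a triangle.
The coordinate at `i` never vanishes on `Q`, hence a coordinate vanishes exactly over the boundary
of the triangle. -/
theorem exists_disc_of_singleton (hQ : IsCompact Q) (hQs : Q ⊆ stdSimplex ℝ (Fin 4))
    (hB : ContinuousOn B Q) (hBi : InjOn B Q) {i : Fin 4} (h : MeetsJoinsOnce Q {i}) :
    ∃ g : Metric.closedBall (0 : E2) 1 ≃ₜ B '' Q, ∀ z, ∃ x ∈ Q, (g z : Y) = B x ∧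
      ((∃ m, x m = 0) ↔ ‖(z : E2)‖ = 1) := by
  obtain ⟨j, k, l, hij, hik, hil, hjk, hjl, hkl⟩ : ∃ j k l : Fin 4, i ≠ j ∧ i ≠ k ∧ i ≠ l ∧ j ≠ k ∧
      j ≠ l ∧ k ≠ l := by
    clear h; revert i; decide
  have hcases := eq_or_eq_of_distinct hij hik hil hjk hjl hkl
  have hsum : ∀ x ∈ Q, x i + x j + x k + x l = 1 := fun x hx => by
    rw [← sum_fin_four hij hik hil hjk hjl hkl, (hQs hx).2]
  have hi : ∀ x ∈ Q, 0 < x i := fun x hx => by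
    simpa using h.sum_pos (Finset.singleton_nonempty i) hQs hx
  have hne : ({i}ᶜ : Finset (Fin 4)).Nonempty := ⟨j, by simp [hij.symm]⟩
  have hs : ∀ x ∈ Q, 0 < x j + x k + x l := fun x hx => by
    have h1 := h.compl.sum_pos hne hQs hx
    have h2 := sum_add_sum_compl_eq_one (hQs hx) {i}
    rw [Finset.sum_singleton] at h2
    linarith [hsum x hx]
  set l' : Fin 3 → E2 → ℝ := ![fun p => p 0, fun p => p 1, fun p => 1 - p 0 - p 1] with hl'
  set Ψ : (Fin 4 → ℝ) → E2 := fun x =>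
    !₂[x j / (x j + x k + x l), x k / (x j + x k + x l)] with hΨ
  have hlast : ∀ x ∈ Q, 1 - x j / (x j + x k + x l) - x k / (x j + x k + x l) =
      x l / (x j + x k + x l) := fun x hx => by
    have := (hs x hx).ne'
    field_simp
    ring
  have hset : {p : E2 | ∀ m, 0 ≤ l' m p} = {p : E2 | 0 ≤ p 0 ∧ 0 ≤ p 1 ∧ 0 ≤ 1 - p 0 - p 1} := by
    ext p
    change (∀ m, 0 ≤ l' m p) ↔ _
    rw [Fin.forall_fin_succ, Fin.forall_fin_two]
    rfl
  refine (exists_ball_parametrization (l := l') (Ψ := Ψ) hQ hB hBi ?_ ?_ ?_ ?_ ?_ ?_).imp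
    fun g hg z => ?_
  rotate_left 6
  · obtain ⟨x, hx, h1, h2⟩ := hg z
    refine ⟨x, hx, h1, ?_⟩
    rw [← h2]
    have hsx := (hs x hx).ne'
    constructor
    · rintro ⟨m, hm⟩
      rcases hcases m with rfl | rfl | rfl | rfl
      · exact absurd hm (hi x hx).ne'
      · exact ⟨0, by simp [hl', hΨ, hm]⟩
      · exact ⟨1, by simp [hl', hΨ, hm]⟩
      · exact ⟨2, (hlast x hx).trans (by rw [hm, zero_div])⟩
    · rintro ⟨m, hm⟩
      fin_cases m
      · exact ⟨j, by simpa [hl', hΨ, hsx] using hm⟩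
      · exact ⟨k, by simpa [hl', hΨ, hsx] using hm⟩
      · exact ⟨l, by simpa [hl', hΨ, hlast x hx, hsx] using hm⟩
  · rw [Fin.forall_fin_succ, Fin.forall_fin_two]
    have hc0 : Continuous fun p : E2 => p 0 := by fun_prop
    have hc1 : Continuous fun p : E2 => p 1 := by fun_prop
    exact ⟨hc0, hc1, (continuous_const.sub hc0).sub hc1⟩
  · rw [Fin.forall_fin_succ, Fin.forall_fin_two]
    refine ⟨⟨!₂[-1, 0], fun p s => ?_⟩, ⟨!₂[0, -1], fun p s => ?_⟩, ⟨!₂[1, 0], fun p s => ?_⟩⟩ <;>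
    (simp [hl']; ring)
  · rw [hset]
    intro p hp q hq a b ha hb hab
    obtain ⟨p1, p2, p3⟩ := hp
    obtain ⟨q1, q2, q3⟩ := hq
    refine ⟨?_, ?_, ?_⟩ <;> simp only [PiLp.add_apply, PiLp.smul_apply, smul_eq_mul]
    · positivity
    · positivity
    · nlinarith [mul_nonneg ha p3, mul_nonneg hb q3]
  · refine ⟨!₂[1 / 4, 1 / 4], ?_⟩
    rw [Fin.forall_fin_succ, Fin.forall_fin_two]
    exact ⟨by simp [hl'], by simp [hl'], by simp [hl']; norm_num⟩
  · have h0 : ∀ m, ContinuousOn (fun x : Fin 4 → ℝ => x m / (x j + x k + x l)) Q := fun m =>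
      ContinuousOn.div (by fun_prop) (by fun_prop) fun x hx => (hs x hx).ne'
    refine (PiLp.continuous_toLp 2 _).comp_continuousOn (continuousOn_pi.2 fun m => ?_)
    fin_cases m
    · exact h0 j
    · exact h0 k
  · rw [hset]
    refine ⟨fun x hx => ?_, fun x hx y hy hxy => ?_, fun p hp => ?_⟩
    · have hsx := hs x hx
      refine ⟨div_nonneg ((hQs hx).1 j) hsx.le, div_nonneg ((hQs hx).1 k) hsx.le, ?_⟩
      exact (hlast x hx).symm ▸ div_nonneg ((hQs hx).1 l) hsx.le
    · have hsx := (hs x hx).ne'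
      have hsy := (hs y hy).ne'
      have e1 : x j / (x j + x k + x l) = y j / (y j + y k + y l) := congrArg (fun p : E2 => p 0) hxy
      have e2 : x k / (x j + x k + x l) = y k / (y j + y k + y l) := congrArg (fun p : E2 => p 1) hxy
      have e3 : x l / (x j + x k + x l) = y l / (y j + y k + y l) := by
        rw [← hlast x hx, ← hlast y hy, e1, e2]
      have hcon : ∀ m, x m / (x j + x k + x l) = y m / (y j + y k + y l) →
          x m = (x j + x k + x l) / (y j + y k + y l) * y m := fun m hm => by
        rw [div_eq_iff hsx] at hm
        rw [hm]; ring
      refine h.eq_of_proportional (c := x i / y i) (Finset.singleton_nonempty i) hne hQs hx hy ?_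
        (d := (x j + x k + x l) / (y j + y k + y l)) ?_
      · intro m hm
        rw [Finset.mem_singleton.1 hm, div_mul_cancel₀ _ (hi y hy).ne']
      · intro m hm
        rcases hcases m with rfl | rfl | rfl | rfl
        · exact absurd (Finset.mem_singleton_self _) hm
        · exact hcon _ e1
        · exact hcon _ e2
        · exact hcon _ e3
    · obtain ⟨p1, p2, p3⟩ := hp
      set b : Fin 4 → ℝ := fun m => if m = j then p 0 else if m = k then p 1 else
        if m = l then 1 - p 0 - p 1 else 0 with hb
      have bi : b i = 0 := by simp [hb, hij, hik, hil]
      have bj : b j = p 0 := by simp [hb]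
      have bk : b k = p 1 := by simp [hb, hjk.symm]
      have bl : b l = 1 - p 0 - p 1 := by simp [hb, hjl.symm, hkl.symm]
      obtain ⟨x, hx, t, ht, -, h2⟩ := h.exists_mem (single_mem_stdSimplex ℝ i) (b := b)
        ⟨fun m => by
            rcases hcases m with rfl | rfl | rfl | rfl
            · exact bi.ge
            · rw [bj]; exact p1
            · rw [bk]; exact p2
            · rw [bl]; exact p3,
          by rw [sum_fin_four hij hik hil hjk hjl hkl, bi, bj, bk, bl]; ring⟩
        (fun m hm => Pi.single_eq_of_ne (by simpa using hm) 1)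
        (fun m hm => by rw [Finset.mem_singleton.1 hm, bi])
      have xj := h2 j (by simpa using hij.symm)
      have xk := h2 k (by simpa using hik.symm)
      have xl := h2 l (by simpa using hil.symm)
      have ht0 := ht.1.ne'
      have es : x j + x k + x l = t := by rw [xj, xk, xl, bj, bk, bl]; ring
      refine ⟨x, hx, ?_⟩
      ext m
      fin_cases m
      · change x j / (x j + x k + x l) = p 0
        rw [es, xj, bj, mul_div_cancel_left₀ _ ht0]
      · change x k / (x j + x k + x l) = p 1
        rw [es, xk, bk, mul_div_cancel_left₀ _ ht0]

/-- Both opposite faces are segments, so their product is a square whose four sides are given by the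
vanishing of the four coordinates. -/
theorem exists_disc_of_pair (hQ : IsCompact Q) (hQs : Q ⊆ stdSimplex ℝ (Fin 4))
    (hB : ContinuousOn B Q) (hBi : InjOn B Q) {i j : Fin 4} (hij : i ≠ j)
    (h : MeetsJoinsOnce Q {i, j}) :
    ∃ g : Metric.closedBall (0 : E2) 1 ≃ₜ B '' Q, ∀ z, ∃ x ∈ Q, (g z : Y) = B x ∧
      ((∃ m, x m = 0) ↔ ‖(z : E2)‖ = 1) := by
  obtain ⟨k, l, hik, hil, hjk, hjl, hkl⟩ : ∃ k l : Fin 4, i ≠ k ∧ i ≠ l ∧ j ≠ k ∧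
      j ≠ l ∧ k ≠ l := by
    clear h; revert i j; decide
  have hcases := eq_or_eq_of_distinct hij hik hil hjk hjl hkl
  have hsum : ∀ x ∈ Q, x i + x j + x k + x l = 1 := fun x hx => by
    rw [← sum_fin_four hij hik hil hjk hjl hkl, (hQs hx).2]
  have hne0 : ({i, j} : Finset (Fin 4)).Nonempty := ⟨i, by simp⟩
  have hne : ({i, j}ᶜ : Finset (Fin 4)).Nonempty := ⟨k, by simp [hik.symm, hjk.symm]⟩
  have hi : ∀ x ∈ Q, 0 < x i + x j := fun x hx => by
    simpa [Finset.sum_pair hij] using h.sum_pos hne0 hQs hx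
  have hs : ∀ x ∈ Q, 0 < x k + x l := fun x hx => by
    have h1 := h.compl.sum_pos hne hQs hx
    have h2 := sum_add_sum_compl_eq_one (hQs hx) {i, j}
    rw [Finset.sum_pair hij] at h2
    linarith [hsum x hx]
  set l' : Fin 4 → E2 → ℝ := ![fun p => p 0, fun p => 1 - p 0, fun p => p 1, fun p => 1 - p 1]
    with hl'
  set Ψ : (Fin 4 → ℝ) → E2 := fun x => !₂[x i / (x i + x j), x k / (x k + x l)] with hΨ
  have hlast1 : ∀ x ∈ Q, 1 - x i / (x i + x j) = x j / (x i + x j) := fun x hx => by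
    have := (hi x hx).ne'
    field_simp
    ring
  have hlast2 : ∀ x ∈ Q, 1 - x k / (x k + x l) = x l / (x k + x l) := fun x hx => by
    have := (hs x hx).ne'
    field_simp
    ring
  have hset : {p : E2 | ∀ m, 0 ≤ l' m p} =
      {p : E2 | 0 ≤ p 0 ∧ 0 ≤ 1 - p 0 ∧ 0 ≤ p 1 ∧ 0 ≤ 1 - p 1} := by
    ext p
    change (∀ m, 0 ≤ l' m p) ↔ _
    rw [Fin.forall_fin_succ, Fin.forall_fin_succ, Fin.forall_fin_two]
    rfl
  refine (exists_ball_parametrization (l := l') (Ψ := Ψ) hQ hB hBi ?_ ?_ ?_ ?_ ?_ ?_).imp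
    fun g hg z => ?_
  rotate_left 6
  · obtain ⟨x, hx, h1, h2⟩ := hg z
    refine ⟨x, hx, h1, ?_⟩
    rw [← h2]
    have hix := (hi x hx).ne'
    have hsx := (hs x hx).ne'
    constructor
    · rintro ⟨m, hm⟩
      rcases hcases m with rfl | rfl | rfl | rfl
      · exact ⟨0, by simp [hl', hΨ, hm]⟩
      · exact ⟨1, (hlast1 x hx).trans (by rw [hm, zero_div])⟩
      · exact ⟨2, by simp [hl', hΨ, hm]⟩
      · exact ⟨3, (hlast2 x hx).trans (by rw [hm, zero_div])⟩
    · rintro ⟨m, hm⟩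
      fin_cases m
      · exact ⟨i, by simpa [hl', hΨ, hix] using hm⟩
      · exact ⟨j, by simpa [hl', hΨ, hlast1 x hx, hix] using hm⟩
      · exact ⟨k, by simpa [hl', hΨ, hsx] using hm⟩
      · exact ⟨l, by simpa [hl', hΨ, hlast2 x hx, hsx] using hm⟩
  · rw [Fin.forall_fin_succ, Fin.forall_fin_succ, Fin.forall_fin_two]
    have hc0 : Continuous fun p : E2 => p 0 := by fun_prop
    have hc1 : Continuous fun p : E2 => p 1 := by fun_prop
    exact ⟨hc0, continuous_const.sub hc0, hc1, continuous_const.sub hc1⟩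
  · rw [Fin.forall_fin_succ, Fin.forall_fin_succ, Fin.forall_fin_two]
    refine ⟨⟨!₂[-1, 0], fun p s => ?_⟩, ⟨!₂[1, 0], fun p s => ?_⟩, ⟨!₂[0, -1], fun p s => ?_⟩,
      ⟨!₂[0, 1], fun p s => ?_⟩⟩ <;>
    (simp [hl']; ring)
  · rw [hset]
    intro p hp q hq a b ha hb hab
    obtain ⟨p1, p2, p3, p4⟩ := hp
    obtain ⟨q1, q2, q3, q4⟩ := hq
    refine ⟨?_, ?_, ?_, ?_⟩ <;> simp only [PiLp.add_apply, PiLp.smul_apply, smul_eq_mul]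
    · positivity
    · nlinarith [mul_nonneg ha p2, mul_nonneg hb q2]
    · positivity
    · nlinarith [mul_nonneg ha p4, mul_nonneg hb q4]
  · refine ⟨!₂[1 / 4, 1 / 4], ?_⟩
    rw [Fin.forall_fin_succ, Fin.forall_fin_succ, Fin.forall_fin_two]
    refine ⟨?_, ?_, ?_, ?_⟩ <;> simp [hl'] <;> norm_num
  · have h0 : ∀ m m' m'' : Fin 4, (∀ x ∈ Q, 0 < x m' + x m'') →
        ContinuousOn (fun x : Fin 4 → ℝ => x m / (x m' + x m'')) Q := fun m m' m'' h0 =>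
      ContinuousOn.div (by fun_prop) (by fun_prop) fun x hx => (h0 x hx).ne'
    refine (PiLp.continuous_toLp 2 _).comp_continuousOn (continuousOn_pi.2 fun m => ?_)
    fin_cases m
    · exact h0 i i j hi
    · exact h0 k k l hs
  · rw [hset]
    refine ⟨fun x hx => ?_, fun x hx y hy hxy => ?_, fun p hp => ?_⟩
    · have hix := hi x hx
      have hsx := hs x hx
      refine ⟨div_nonneg ((hQs hx).1 i) hix.le, ?_, div_nonneg ((hQs hx).1 k) hsx.le, ?_⟩
      · exact (hlast1 x hx).symm ▸ div_nonneg ((hQs hx).1 j) hix.le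
      · exact (hlast2 x hx).symm ▸ div_nonneg ((hQs hx).1 l) hsx.le
    · have e1 : x i / (x i + x j) = y i / (y i + y j) := congrArg (fun p : E2 => p 0) hxy
      have e2 : x j / (x i + x j) = y j / (y i + y j) := by
        rw [← hlast1 x hx, ← hlast1 y hy, e1]
      have e3 : x k / (x k + x l) = y k / (y k + y l) := congrArg (fun p : E2 => p 1) hxy
      have e4 : x l / (x k + x l) = y l / (y k + y l) := by
        rw [← hlast2 x hx, ← hlast2 y hy, e3]
      have hcon : ∀ (m : Fin 4) (r s : ℝ), 0 < r → x m / r = y m / s → x m = r / s * y m :=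
        fun m r s hr hm => by
          rw [div_eq_iff hr.ne'] at hm
          rw [hm]; ring
      refine h.eq_of_proportional (c := (x i + x j) / (y i + y j)) hne0 hne hQs hx hy ?_
        (d := (x k + x l) / (y k + y l)) ?_
      · intro m hm
        rcases Finset.mem_insert.1 hm with rfl | hm
        · exact hcon _ _ _ (hi x hx) e1
        · rw [Finset.mem_singleton.1 hm]
          exact hcon _ _ _ (hi x hx) e2
      · intro m hm
        rcases hcases m with rfl | rfl | rfl | rfl
        · exact absurd (by simp) hm
        · exact absurd (by simp) hm
        · exact hcon _ _ _ (hs x hx) e3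
        · exact hcon _ _ _ (hs x hx) e4
    · obtain ⟨p1, p2, p3, p4⟩ := hp
      set a : Fin 4 → ℝ := fun m => if m = i then p 0 else if m = j then 1 - p 0 else 0 with ha
      set b : Fin 4 → ℝ := fun m => if m = k then p 1 else if m = l then 1 - p 1 else 0 with hb
      have ai : a i = p 0 := by simp [ha]
      have aj : a j = 1 - p 0 := by simp [ha, hij.symm]
      have ak : a k = 0 := by simp [ha, hik.symm, hjk.symm]
      have al : a l = 0 := by simp [ha, hil.symm, hjl.symm]
      have bi : b i = 0 := by simp [hb, hik, hil]
      have bj : b j = 0 := by simp [hb, hjk, hjl]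
      have bk : b k = p 1 := by simp [hb]
      have bl : b l = 1 - p 1 := by simp [hb, hkl.symm]
      obtain ⟨x, hx, t, ht, h1, h2⟩ := h.exists_mem (a := a) (b := b)
        ⟨fun m => by
            rcases hcases m with rfl | rfl | rfl | rfl
            · rw [ai]; exact p1
            · rw [aj]; exact p2
            · exact ak.ge
            · exact al.ge,
          by rw [sum_fin_four hij hik hil hjk hjl hkl, ai, aj, ak, al]; ring⟩
        ⟨fun m => by
            rcases hcases m with rfl | rfl | rfl | rfl
            · exact bi.ge
            · exact bj.ge
            · rw [bk]; exact p3
            · rw [bl]; exact p4,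
          by rw [sum_fin_four hij hik hil hjk hjl hkl, bi, bj, bk, bl]; ring⟩
        (fun m hm => by
          rcases hcases m with rfl | rfl | rfl | rfl
          · exact absurd (by simp) hm
          · exact absurd (by simp) hm
          · exact ak
          · exact al)
        (fun m hm => by
          rcases Finset.mem_insert.1 hm with rfl | hm
          · exact bi
          · rw [Finset.mem_singleton.1 hm, bj])
      have xi := h1 i (by simp)
      have xj := h1 j (by simp)
      have xk := h2 k (by simp [hik.symm, hjk.symm])
      have xl := h2 l (by simp [hil.symm, hjl.symm])
      have ht0 := ht.1.ne'
      have ht1 : 1 - t ≠ 0 := by linarith [ht.2]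
      have es : x i + x j = 1 - t := by rw [xi, xj, ai, aj]; ring
      have es' : x k + x l = t := by rw [xk, xl, bk, bl]; ring
      refine ⟨x, hx, ?_⟩
      ext m
      fin_cases m
      · change x i / (x i + x j) = p 0
        rw [es, xi, ai, mul_div_cancel_left₀ _ ht1]
      · change x k / (x k + x l) = p 1
        rw [es', xk, bk, mul_div_cancel_left₀ _ ht0]

/-- The arc in which `Q` meets the triangle with vertices `c` on one side and `a`, `b` on the
other. -/
theorem exists_arc (hQ : IsCompact Q) (hQs : Q ⊆ stdSimplex ℝ (Fin 4))
    (hB : ContinuousOn B Q) (hBi : InjOn B Q) {P : Finset (Fin 4)} (h : MeetsJoinsOnce Q P)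
    {a b c k : Fin 4} (hab : a ≠ b) (hac : a ≠ c) (hbc : b ≠ c) (hak : a ≠ k) (hbk : b ≠ k)
    (hck : c ≠ k) (ha : a ∉ P) (hb : b ∉ P) (hc : c ∈ P) :
    ∃ g : unitInterval ≃ₜ B '' {x ∈ Q | x k = 0}, ∀ z, ∃ x ∈ Q, (g z : Y) = B x ∧ x k = 0 ∧
      0 < x c ∧ (x a = 0 ↔ z = 1) ∧ (x b = 0 ↔ z = 0) := by
  have hcases := eq_or_eq_of_distinct hab hac hak hbc hbk hck
  have hsum : ∀ x ∈ Q, x a + x b + x c + x k = 1 := fun x hx => by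
    rw [← sum_fin_four hab hac hak hbc hbk hck, (hQs hx).2]
  have hPne : P.Nonempty := ⟨c, hc⟩
  have hne : (Pᶜ : Finset (Fin 4)).Nonempty := ⟨a, by simpa using ha⟩
  set Q' := {x ∈ Q | x k = 0} with hQ'
  have hQ'Q : Q' ⊆ Q := sep_subset _ _
  have hQ'c : IsCompact Q' := hQ.inter_right (isClosed_eq (by fun_prop) continuous_const)
  have hcpos : ∀ x ∈ Q', 0 < x c := fun x hx => by
    have h1 := h.sum_pos hPne hQs hx.1
    refine h1.trans_le ?_
    rw [Finset.sum_eq_single_of_mem c hc]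
    intro m hm hmc
    rcases hcases m with rfl | rfl | rfl | rfl
    · exact absurd hm ha
    · exact absurd hm hb
    · exact absurd rfl hmc
    · exact hx.2
  have hs : ∀ x ∈ Q', 0 < x a + x b := fun x hx => by
    have h1 := h.compl.sum_pos hne hQs hx.1
    obtain ⟨m, hm, hm0⟩ := Finset.exists_ne_zero_of_sum_ne_zero h1.ne'
    have hpos := lt_of_le_of_ne ((hQs hx.1).1 m) hm0.symm
    rcases hcases m with rfl | rfl | rfl | rfl
    · linarith [(hQs hx.1).1 b]
    · linarith [(hQs hx.1).1 a]
    · exact absurd hc (by simpa using hm)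
    · exact absurd hx.2 hm0
  set Ψ : (Fin 4 → ℝ) → ℝ := fun x => x b / (x a + x b) with hΨ
  have hlast : ∀ x ∈ Q', 1 - x b / (x a + x b) = x a / (x a + x b) := fun x hx => by
    have := (hs x hx).ne'
    field_simp
    ring
  have hΨc : ContinuousOn Ψ Q' :=
    ContinuousOn.div (by fun_prop) (by fun_prop) fun x hx => (hs x hx).ne'
  have hbij : BijOn Ψ Q' unitInterval := by
    refine ⟨fun x hx => ?_, fun x hx y hy hxy => ?_, fun p hp => ?_⟩
    · refine ⟨div_nonneg ((hQs hx.1).1 b) (hs x hx).le, ?_⟩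
      have := div_nonneg ((hQs hx.1).1 a) (hs x hx).le
      rw [← hlast x hx] at this
      exact sub_nonneg.1 this
    · have e1 : x b / (x a + x b) = y b / (y a + y b) := hxy
      have e2 : x a / (x a + x b) = y a / (y a + y b) := by
        rw [← hlast x hx, ← hlast y hy, e1]
      have hcon : ∀ (m : Fin 4), x m / (x a + x b) = y m / (y a + y b) →
          x m = (x a + x b) / (y a + y b) * y m := fun m hm => by
        rw [div_eq_iff (hs x hx).ne'] at hm
        rw [hm]; ring
      have hk : ∀ r : ℝ, x k = r * y k := fun r => by rw [hx.2, hy.2, mul_zero]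
      refine h.eq_of_proportional (c := x c / y c) hPne hne hQs hx.1 hy.1 ?_
        (d := (x a + x b) / (y a + y b)) ?_
      · intro m hm
        rcases hcases m with rfl | rfl | rfl | rfl
        · exact absurd hm ha
        · exact absurd hm hb
        · rw [div_mul_cancel₀ _ (hcpos y hy).ne']
        · exact hk _
      · intro m hm
        rcases hcases m with rfl | rfl | rfl | rfl
        · exact hcon _ e2
        · exact hcon _ e1
        · exact absurd hc hm
        · exact hk _
    · set b' : Fin 4 → ℝ := fun m => if m = a then 1 - p else if m = b then p else 0 with hb'
      have ba : b' a = 1 - p := by simp [hb']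
      have bb : b' b = p := by simp [hb', hab.symm]
      have bc : b' c = 0 := by simp [hb', hac.symm, hbc.symm]
      have bk : b' k = 0 := by simp [hb', hak.symm, hbk.symm]
      obtain ⟨x, hx, t, ht, h1, h2⟩ := h.exists_mem (single_mem_stdSimplex ℝ c) (b := b')
        ⟨fun m => by
            rcases hcases m with rfl | rfl | rfl | rfl
            · rw [ba]; linarith [hp.2]
            · rw [bb]; exact hp.1
            · exact bc.ge
            · exact bk.ge,
          by rw [sum_fin_four hab hac hak hbc hbk hck, ba, bb, bc, bk]; ring⟩
        (fun m hm => Pi.single_eq_of_ne (by rintro rfl; exact hm hc) 1)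
        (fun m hm => by
          rcases hcases m with rfl | rfl | rfl | rfl
          · exact absurd hm ha
          · exact absurd hm hb
          · exact bc
          · exact bk)
      have xk : x k = 0 := by
        by_cases hk : k ∈ P
        · rw [h1 k hk, Pi.single_eq_of_ne hck.symm, mul_zero]
        · rw [h2 k hk, bk, mul_zero]
      have xa := h2 a ha
      have xb := h2 b hb
      have es : x a + x b = t := by rw [xa, xb, ba, bb]; ring
      refine ⟨x, ⟨hx, xk⟩, ?_⟩
      change x b / (x a + x b) = p
      rw [es, xb, bb, mul_div_cancel_left₀ _ ht.1.ne']
  obtain ⟨h1, hh1⟩ := exists_homeomorph_of_bijOn hQ'c hΨc hbij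
  obtain ⟨h2, hh2⟩ := exists_homeomorph_of_bijOn hQ'c (hB.mono hQ'Q) (hBi.mono hQ'Q).bijOn_image
  refine ⟨h1.symm.trans h2, fun z => ?_⟩
  set x := h1.symm z with hx
  have e1 : Ψ x = z := by rw [← hh1 x, hx, h1.apply_symm_apply]
  have hsx := (hs x x.2).ne'
  refine ⟨x, x.2.1, hh2 x, x.2.2, hcpos x x.2, ?_, ?_⟩
  · rw [show z = 1 ↔ (z : ℝ) = 1 from Subtype.ext_iff, ← e1]
    change _ ↔ (x : Fin 4 → ℝ) b / ((x : Fin 4 → ℝ) a + (x : Fin 4 → ℝ) b) = 1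
    rw [div_eq_one_iff_eq hsx]
    exact ⟨fun h => by rw [h, zero_add], fun h => by linarith⟩
  · rw [show z = 0 ↔ (z : ℝ) = 0 from Subtype.ext_iff, ← e1]
    change _ ↔ (x : Fin 4 → ℝ) b / ((x : Fin 4 → ℝ) a + (x : Fin 4 → ℝ) b) = 0
    rw [div_eq_zero_iff, or_iff_left hsx]

end Discs

/-! ### A combinatorial criterion for normal discs. -/

section NormalDiscCriterion

variable {Γ : Subgroup LorentzGroup} {Δ : GeodesicTetrahedron Γ}

/-- A parametrisation of the tetrahedron by the standard simplex that respects the cells. -/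
structure IsCellular (Δ : GeodesicTetrahedron Γ) (B : (Fin 4 → ℝ) → HypManifold Γ) : Prop where
  continuousOn : ContinuousOn B (stdSimplex ℝ (Fin 4))
  injOn : InjOn B (stdSimplex ℝ (Fin 4))
  cell_eq : ∀ S, Δ.cell S = B '' {x ∈ stdSimplex ℝ (Fin 4) | ∀ i ∉ S, x i = 0}
  subset_openCell : ∀ S, B '' {x ∈ stdSimplex ℝ (Fin 4) | (∀ i ∉ S, x i = 0) ∧ ∀ i ∈ S, 0 < x i} ⊆
    Δ.openCell S
  vertex_eq : ∀ i, hypProj Γ (Δ.vertex i) = B (Pi.single i 1)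

variable {B : (Fin 4 → ℝ) → HypManifold Γ} {Q : Set (Fin 4 → ℝ)}

namespace IsCellular

variable (hB : IsCellular Δ B)
include hB

theorem carrier_eq : Δ.carrier = B '' stdSimplex ℝ (Fin 4) := by
  rw [GeodesicTetrahedron.carrier, hB.cell_eq]
  congr 1
  ext x
  exact ⟨fun h => h.1, fun h => ⟨h, fun i hi => absurd (Finset.mem_univ i) hi⟩⟩

theorem mem_cell_iff {x : Fin 4 → ℝ} (hx : x ∈ stdSimplex ℝ (Fin 4)) (S : Finset (Fin 4)) :
    B x ∈ Δ.cell S ↔ ∀ i ∉ S, x i = 0 := by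
  rw [hB.cell_eq]
  constructor
  · rintro ⟨y, hy, hyx⟩
    rw [← hB.injOn hy.1 hx hyx]
    exact hy.2
  · exact fun h => ⟨x, ⟨hx, h⟩, rfl⟩

theorem mem_face_iff {x : Fin 4 → ℝ} (hx : x ∈ stdSimplex ℝ (Fin 4)) (k : Fin 4) :
    B x ∈ Δ.face k ↔ x k = 0 := by
  rw [GeodesicTetrahedron.face, hB.mem_cell_iff hx]
  exact ⟨fun h => h k (by simp), fun h i hi => by
    have : i = k := by simpa using hi
    rw [this, h]⟩

theorem mem_boundary_iff {x : Fin 4 → ℝ} (hx : x ∈ stdSimplex ℝ (Fin 4)) :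
    B x ∈ Δ.boundary ↔ ∃ k, x k = 0 := by
  rw [GeodesicTetrahedron.boundary, mem_iUnion]
  exact exists_congr fun k => hB.mem_face_iff hx k

theorem isNormalArc [T2Space (HypManifold Γ)] (hQ : IsCompact Q)
    (hQs : Q ⊆ stdSimplex ℝ (Fin 4)) {P : Finset (Fin 4)} (h : MeetsJoinsOnce Q P)
    {a b c k : Fin 4} (hab : a ≠ b) (hac : a ≠ c) (hbc : b ≠ c) (hak : a ≠ k) (hbk : b ≠ k)
    (hck : c ≠ k) (ha : a ∉ P) (hb : b ∉ P) (hc : c ∈ P) :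
    IsNormalArc Δ k (B '' Q ∩ Δ.face k) := by
  have hset : B '' Q ∩ Δ.face k = B '' {x ∈ Q | x k = 0} := by
    ext p
    constructor
    · rintro ⟨⟨x, hx, rfl⟩, hk⟩
      exact ⟨x, ⟨hx, (hB.mem_face_iff (hQs hx) k).1 hk⟩, rfl⟩
    · rintro ⟨x, hx, rfl⟩
      exact ⟨mem_image_of_mem _ hx.1, (hB.mem_face_iff (hQs hx.1) k).2 hx.2⟩
  have hcases := eq_or_eq_of_distinct hab hac hak hbc hbk hck
  obtain ⟨g, hg⟩ := exists_arc hQ hQs (hB.continuousOn.mono hQs) (hB.injOn.mono hQs) h hab hac hbc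
    hak hbk hck ha hb hc
  rw [hset]
  have hpos : ∀ x ∈ Q, ∀ i, x i ≠ 0 → 0 < x i := fun x hx i hi =>
    lt_of_le_of_ne ((hQs hx).1 i) hi.symm
  refine ⟨a, b, c, hab, hac, hbc, hak, hbk, hck, g, ?_, ?_, fun t ht0 ht1 => ?_⟩
  · obtain ⟨x, hx, he, hxk, hxc, hxa, hxb⟩ := hg 0
    rw [he]
    refine hB.subset_openCell _ ⟨x, ⟨hQs hx, fun i hi => ?_, fun i hi => ?_⟩, rfl⟩
    · rcases hcases i with rfl | rfl | rfl | rfl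
      · simp at hi
      · exact hxb.2 rfl
      · simp at hi
      · exact hxk
    · rcases Finset.mem_insert.1 hi with rfl | hi
      · exact hxc
      · rw [Finset.mem_singleton.1 hi]
        exact hpos x hx a fun h0 => zero_ne_one (hxa.1 h0)
  · obtain ⟨x, hx, he, hxk, hxc, hxa, hxb⟩ := hg 1
    rw [he]
    refine hB.subset_openCell _ ⟨x, ⟨hQs hx, fun i hi => ?_, fun i hi => ?_⟩, rfl⟩
    · rcases hcases i with rfl | rfl | rfl | rfl
      · exact hxa.2 rfl
      · simp at hi
      · simp at hi
      · exact hxk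
    · rcases Finset.mem_insert.1 hi with rfl | hi
      · exact hxc
      · rw [Finset.mem_singleton.1 hi]
        exact hpos x hx b fun h0 => one_ne_zero (hxb.1 h0)
  · obtain ⟨x, hx, he, hxk, hxc, hxa, hxb⟩ := hg t
    rw [he]
    refine hB.subset_openCell _ ⟨x, ⟨hQs hx, fun i hi => ?_, fun i hi => ?_⟩, rfl⟩
    · have : i = k := by simpa using hi
      rw [this, hxk]
    · rcases hcases i with rfl | rfl | rfl | rfl
      · exact hpos x hx _ fun h0 => ht1 (hxa.1 h0)
      · exact hpos x hx _ fun h0 => ht0 (hxb.1 h0)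
      · exact hxc
      · simp at hi

theorem isNormalDiscOfType [T2Space (HypManifold Γ)] (hQ : IsCompact Q)
    (hQs : Q ⊆ stdSimplex ℝ (Fin 4)) {S : Finset (Fin 4)} (h : MeetsJoinsOnce Q S)
    (hS : S.Nonempty) (hS' : Sᶜ.Nonempty) (hdisc : IsProperDisc Δ (B '' Q)) :
    IsNormalDiscOfType Δ S (B '' Q) := by
  have hposS : ∀ x ∈ Q, ∃ i ∈ S, x i ≠ 0 := fun x hx =>
    Finset.exists_ne_zero_of_sum_ne_zero (h.sum_pos hS hQs hx).ne'
  have hposS' : ∀ x ∈ Q, ∃ i ∉ S, x i ≠ 0 := fun x hx => by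
    obtain ⟨i, hi, h0⟩ := Finset.exists_ne_zero_of_sum_ne_zero (h.compl.sum_pos hS' hQs hx).ne'
    exact ⟨i, Finset.mem_compl.1 hi, h0⟩
  have hedge : ∀ x ∈ Q, ∀ i j, (i ∈ S ↔ j ∈ S) → ¬ ∀ m ∉ ({i, j} : Finset (Fin 4)), x m = 0 := by
    intro x hx i j hij h0
    obtain ⟨m, hm, hm0⟩ := hposS x hx
    obtain ⟨m', hm', hm0'⟩ := hposS' x hx
    have e1 : m = i ∨ m = j := by
      by_contra hcon; exact hm0 (h0 m (by simpa using hcon))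
    have e2 : m' = i ∨ m' = j := by
      by_contra hcon; exact hm0' (h0 m' (by simpa using hcon))
    rcases e1 with rfl | rfl <;> rcases e2 with rfl | rfl <;> tauto
  refine ⟨hdisc, ?_, ?_, ?_, ?_, ?_⟩
  · rintro i ⟨x, hx, hxi⟩
    rw [hB.vertex_eq] at hxi
    -- A vertex is treated as the degenerate edge from `i` to `i`.
    have hxe := hB.injOn (hQs hx) (single_mem_stdSimplex ℝ i) hxi
    refine hedge x hx i i Iff.rfl fun m hm => ?_
    rw [hxe]
    exact Pi.single_eq_of_ne (by simpa using hm) 1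
  · intro i hi j hj
    obtain ⟨x, hx, t, ht, h1, h2⟩ := h.exists_mem (single_mem_stdSimplex ℝ i)
      (single_mem_stdSimplex ℝ j)
      (fun m hm => Pi.single_eq_of_ne (by rintro rfl; exact hm hi) 1)
      (fun m hm => Pi.single_eq_of_ne (by rintro rfl; exact hj hm) 1)
    refine ⟨B x, Subset.antisymm ?_ (singleton_subset_iff.2 ⟨mem_image_of_mem _ hx, ?_⟩)⟩
    · rintro _ ⟨⟨y, hy, rfl⟩, hye⟩
      have hy0 := (hB.mem_cell_iff (hQs hy) _).1 hye
      rw [mem_singleton_iff]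
      congr 1
      refine h.eq_of_proportional (c := y i / x i) (d := y j / x j) hS hS' hQs hy hx ?_ ?_
      · intro m hm
        by_cases hmi : m = i
        · have : x m ≠ 0 := by
            rw [h1 m hm, hmi, Pi.single_eq_same, mul_one]; linarith [ht.2]
          rw [← hmi, div_mul_cancel₀ _ this]
        · have hmj : m ≠ j := by rintro rfl; exact hj hm
          rw [hy0 m (by simp [hmi, hmj]), h1 m hm, Pi.single_eq_of_ne hmi]
          simp
      · intro m hm
        by_cases hmj : m = j
        · have : x m ≠ 0 := by
            rw [h2 m hm, hmj, Pi.single_eq_same, mul_one]; exact ht.1.ne'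
          rw [← hmj, div_mul_cancel₀ _ this]
        · have hmi : m ≠ i := by rintro rfl; exact hm hi
          rw [hy0 m (by simp [hmi, hmj]), h2 m hm, Pi.single_eq_of_ne hmj]
          simp
    · refine (hB.mem_cell_iff (hQs hx) _).2 fun m hm => ?_
      have hm' : m ≠ i ∧ m ≠ j := by simpa using hm
      by_cases hmS : m ∈ S
      · rw [h1 m hmS, Pi.single_eq_of_ne hm'.1, mul_zero]
      · rw [h2 m hmS, Pi.single_eq_of_ne hm'.2, mul_zero]
  · intro i j hij
    refine eq_empty_of_forall_notMem ?_
    rintro _ ⟨⟨x, hx, rfl⟩, hxe⟩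
    exact hedge x hx i j hij ((hB.mem_cell_iff (hQs hx) _).1 hxe)
  · rintro k ⟨i, j, hik, hjk, hi, hj⟩
    have hij : i ≠ j := by rintro rfl; exact hj hi
    obtain ⟨m, hmi, hmj, hmk⟩ : ∃ m : Fin 4, m ≠ i ∧ m ≠ j ∧ m ≠ k := by
      revert i j k; clear * -; decide +revert
    -- The third vertex of the face decides which of `i` and `j` is alone on its side; the arc cuts
    -- off this one. If it is `j`, the roles of `S` and its complement are exchanged.
    by_cases hm : m ∈ S
    · exact hB.isNormalArc hQ hQs h.compl hmi.symm hij hmj hik hmk hjk (by simpa using hi)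
        (by simpa using hm) (by simpa using hj)
    · exact hB.isNormalArc hQ hQs h hmj.symm hij.symm hmi hjk hmk hik hj hm hi
  · intro k hk
    refine eq_empty_of_forall_notMem ?_
    rintro _ ⟨⟨x, hx, rfl⟩, hxe⟩
    have hxk := (hB.mem_face_iff (hQs hx) k).1 hxe
    obtain ⟨m, hm, hm0⟩ := hposS x hx
    obtain ⟨m', hm', hm0'⟩ := hposS' x hx
    exact hk ⟨m, m', by rintro rfl; exact hm0 hxk, by rintro rfl; exact hm0' hxk, hm, hm'⟩

theorem isProperDisc (hQs : Q ⊆ stdSimplex ℝ (Fin 4))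
    (h : ∃ g : Metric.closedBall (0 : E2) 1 ≃ₜ B '' Q, ∀ z, ∃ x ∈ Q,
      (g z : HypManifold Γ) = B x ∧ ((∃ m, x m = 0) ↔ ‖(z : E2)‖ = 1)) :
    IsProperDisc Δ (B '' Q) := by
  obtain ⟨g, hg⟩ := h
  refine ⟨by rw [hB.carrier_eq]; exact image_mono hQs, g, fun z => ?_⟩
  obtain ⟨x, hx, he, h1⟩ := hg z
  rw [he, hB.mem_boundary_iff (hQs hx), h1]

/-- A compact subset of the simplex that meets each join segment between two opposite faces
exactly once is a normal disc. -/
theorem isNormal_of_meetsJoinsOnce [T2Space (HypManifold Γ)] (hQ : IsCompact Q)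
    (hQs : Q ⊆ stdSimplex ℝ (Fin 4)) {S : Finset (Fin 4)} (h : MeetsJoinsOnce Q S)
    (hS : S.Nonempty) (hS' : Sᶜ.Nonempty) :
    IsNormalTriangle Δ (B '' Q) ∨ IsNormalSquare Δ (B '' Q) := by
  have hc := hB.continuousOn.mono hQs
  have hi := hB.injOn.mono hQs
  have htri : ∀ S : Finset (Fin 4), MeetsJoinsOnce Q S → S.Nonempty → Sᶜ.Nonempty → S.card = 1 →
      IsNormalTriangle Δ (B '' Q) := by
    intro S h hS hS' hcard
    obtain ⟨i, rfl⟩ := Finset.card_eq_one.1 hcard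
    exact ⟨i, hB.isNormalDiscOfType hQ hQs h hS hS'
      (hB.isProperDisc hQs (exists_disc_of_singleton hQ hQs hc hi h))⟩
  have hcc : S.card + Sᶜ.card = 4 := by rw [Finset.card_add_card_compl, Fintype.card_fin]
  have h1 := hS.card_pos
  have h2 := hS'.card_pos
  -- Three vertices on one side leave a single one on the other, which gives a triangle again.
  obtain hcard | hcard | hcard : S.card = 1 ∨ S.card = 2 ∨ Sᶜ.card = 1 := by omega
  · exact Or.inl (htri S h hS hS' hcard)
  · obtain ⟨i, j, hij, rfl⟩ := Finset.card_eq_two.1 hcard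
    exact Or.inr ⟨_, hcard, hB.isNormalDiscOfType hQ hQs h hS hS'
      (hB.isProperDisc hQs (exists_disc_of_pair hQ hQs hc hi hij h))⟩
  · exact Or.inl (htri _ h.compl hS' (by rwa [compl_compl]) hcard)

end IsCellular

end NormalDiscCriterion

/-! ### The quotient manifold, its distance and its exponential map. -/

section HyperbolicQuotient

variable {Γ : Subgroup LorentzGroup}

theorem mink_lorentz (g : LorentzGroup) (u v : MinkSpace) :
    mink (g.1 u) (g.1 v) = mink u v := g.2.1 u v

theorem continuous_lorentz (g : LorentzGroup) : Continuous g.1 :=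
  g.1.toLinearMap.continuous_of_finiteDimensional

theorem coe_lorentz_smul (g : LorentzGroup) (u : Hyp3) : ((g • u : Hyp3) : MinkSpace) = g.1 u :=
  rfl

theorem continuous_lorentz_smul (g : LorentzGroup) : Continuous fun u : Hyp3 => g • u :=
  Continuous.subtype_mk ((continuous_lorentz g).comp continuous_subtype_val) _

theorem continuous_mink_self : Continuous fun u : MinkSpace => mink u u := by
  unfold mink; fun_prop

theorem isLocallyClosed_hyp3 : IsLocallyClosed Hyp3 := by
  have : Hyp3 = {u : MinkSpace | mink u u = -1} ∩ {u | 0 < u.1} := rfl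
  rw [this]
  exact (isClosed_eq continuous_mink_self continuous_const).isLocallyClosed.inter
    (isOpen_lt continuous_const continuous_fst).isLocallyClosed

theorem IsFreeKleinian.t2Space (hΓ : IsFreeKleinian Γ) : T2Space (HypManifold Γ) := by
  have := hΓ.properlyDiscontinuous
  have : LocallyCompactSpace Hyp3 := isLocallyClosed_hyp3.locallyCompactSpace
  have : ContinuousConstSMul Γ Hyp3 := ⟨fun γ => continuous_lorentz_smul γ.1⟩
  exact t2Space_of_properlyDiscontinuousSMul_of_t2Space

theorem continuous_hypProj : Continuous (hypProj Γ) := continuous_quot_mk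

theorem hypProj_eq_iff {u v : Hyp3} : hypProj Γ u = hypProj Γ v ↔ ∃ γ ∈ Γ, γ • v = u := by
  unfold hypProj
  rw [Quotient.eq, MulAction.orbitRel_apply]
  exact ⟨fun ⟨γ, h⟩ => ⟨γ.1, γ.2, h⟩, fun ⟨γ, h, h'⟩ => ⟨⟨γ, h⟩, h'⟩⟩

theorem hypProj_smul {γ : LorentzGroup} (hγ : γ ∈ Γ) (u : Hyp3) :
    hypProj Γ (γ • u) = hypProj Γ u := hypProj_eq_iff.2 ⟨γ, hγ, rfl⟩

theorem hypProj_surjective : Function.Surjective (hypProj Γ) := Quot.mk_surjective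

/-- The exponential map of hyperbolic space at the base point of the hyperboloid. -/
noncomputable def hypPt (w : E3) : Hyp3 := ⟨hypVec w, hypVec_mem w⟩

theorem hypPt_hypLog (u : Hyp3) : hypPt (hypLog u) = u := Subtype.ext (hypVec_hypLog u.2)

theorem manifoldExp_eq (A : LorentzGroup) (w : E3) :
    manifoldExp Γ A w = hypProj Γ (A • hypPt w) := rfl

theorem continuous_hypPt : Continuous hypPt :=
  Continuous.subtype_mk (contDiff_hypVec (m := 0)).continuous _

theorem continuous_manifoldExp (A : LorentzGroup) : Continuous (manifoldExp Γ A) :=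
  continuous_hypProj.comp ((continuous_lorentz_smul A).comp continuous_hypPt)

theorem injOn_manifoldExp {A : LorentzGroup} {η : ℝ} (h : ENNReal.ofReal η < injRadius Γ A) :
    InjOn (manifoldExp Γ A) (Metric.ball 0 η) := by
  rw [injRadius] at h
  obtain ⟨r, hr⟩ := lt_iSup_iff.1 h
  obtain ⟨hinj, hr⟩ := lt_iSup_iff.1 hr
  refine hinj.mono (Metric.ball_subset_ball ?_)
  by_contra hcon
  push Not at hcon
  have : (r : ℝ≥0∞) ≤ ENNReal.ofReal η := by
    rw [← ENNReal.ofReal_coe_nnreal]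
    exact ENNReal.ofReal_le_ofReal hcon.le
  exact absurd hr this.not_gt

theorem mem_hypSimplex_smul (g : LorentzGroup) {v : Fin 4 → Hyp3} {S : Finset (Fin 4)} {u : Hyp3}
    (hu : u ∈ hypSimplex v S) : g • u ∈ hypSimplex (fun i => g • v i) S := by
  obtain ⟨a, ha, hu⟩ := hu
  refine ⟨a, ha, ?_⟩
  rw [coe_lorentz_smul, hu, map_sum]
  simp only [map_smul, coe_lorentz_smul]

theorem mem_hypSimplex_smul_iff (g : LorentzGroup) {v : Fin 4 → Hyp3} {S : Finset (Fin 4)}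
    {u : Hyp3} : g • u ∈ hypSimplex (fun i => g • v i) S ↔ u ∈ hypSimplex v S := by
  refine ⟨fun h => ?_, mem_hypSimplex_smul g⟩
  simpa using mem_hypSimplex_smul g⁻¹ h

theorem mem_hypOpenSimplex_smul (g : LorentzGroup) {v : Fin 4 → Hyp3} {S : Finset (Fin 4)}
    {u : Hyp3} (hu : u ∈ hypOpenSimplex v S) : g • u ∈ hypOpenSimplex (fun i => g • v i) S := by
  obtain ⟨a, ha, hu⟩ := hu
  refine ⟨a, ha, ?_⟩
  rw [coe_lorentz_smul, hu, map_sum]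
  simp only [map_smul, coe_lorentz_smul]

theorem hypPt_zero_fst : ((hypPt 0 : Hyp3) : MinkSpace) = (1, 0) := by
  simp [hypPt, hypVec]

theorem hdist_hypPt_zero (w : E3) : hdist (hypPt 0) (hypPt w) = ‖w‖ := by
  rw [hdist, hypPt_zero_fst]
  simp only [mink, inner_zero_left, hypPt, hypVec, one_mul, zero_sub, neg_neg]
  exact Real.arcosh_cosh (norm_nonneg w)

theorem hdist_smul (g : LorentzGroup) (u v : Hyp3) : hdist (g • u) (g • v) = hdist u v := by
  rw [hdist, coe_lorentz_smul, coe_lorentz_smul, mink_lorentz, hdist]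

/-- A point at distance less than `r` from the base point is the image of a tangent vector of
length less than `r`. -/
theorem exists_manifoldExp_of_manifoldDist_lt {A : LorentzGroup} {p : HypManifold Γ} {r : ℝ}
    (h : manifoldDist Γ (manifoldExp Γ A 0) p < r) : ∃ w, manifoldExp Γ A w = p ∧ ‖w‖ < r := by
  obtain ⟨v₀, hv₀⟩ := hypProj_surjective p
  have hne : {d | ∃ u v : Hyp3, hypProj Γ u = manifoldExp Γ A 0 ∧ hypProj Γ v = p ∧
      d = hdist u v}.Nonempty := ⟨_, A • hypPt 0, v₀, rfl, hv₀, rfl⟩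
  obtain ⟨d, ⟨u, v, hu, hv, rfl⟩, hd⟩ := exists_lt_of_csInf_lt hne h
  obtain ⟨γ, hγ, rfl⟩ := hypProj_eq_iff.1 hu
  refine ⟨hypLog (A⁻¹ • γ⁻¹ • v : Hyp3), ?_, ?_⟩
  · rw [manifoldExp_eq, hypPt_hypLog, smul_inv_smul, hypProj_smul (Γ.inv_mem hγ), hv]
  · rw [← hdist_hypPt_zero, hypPt_hypLog, ← hdist_smul A, ← hdist_smul γ, smul_inv_smul,
      smul_inv_smul]
    exact hd

end HyperbolicQuotient

/-! ### Barycentric coordinates on a geodesic simplex in the Klein model. -/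

section KleinParametrization

/-- The affine map to Klein coordinates on a geodesic simplex. -/
noncomputable def kleinComb (v : Fin 4 → Hyp3) (x : Fin 4 → ℝ) : E3 :=
  ∑ i, x i • kleinPt (v i).1

variable {v : Fin 4 → Hyp3}

theorem continuous_kleinComb : Continuous (kleinComb v) := by
  unfold kleinComb; fun_prop

theorem kleinComb_mem {x : Fin 4 → ℝ} (hx : x ∈ stdSimplex ℝ (Fin 4)) {P : Finset (Fin 4)}
    (hP : ∀ i ∉ P, x i = 0) :
    kleinComb v x ∈ convexHull ℝ ((fun i => kleinPt (v i).1) '' P) := by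
  have hsub : ∀ {M : Type} [AddCommMonoid M] (f : Fin 4 → M), (∀ i ∉ P, f i = 0) →
      ∑ i, f i = ∑ i ∈ P, f i := fun f hf =>
    (Finset.sum_subset (Finset.subset_univ P) fun i _ hi => hf i hi).symm
  rw [kleinComb, hsub _ fun i hi => by rw [hP i hi, zero_smul]]
  refine (convex_convexHull ℝ _).sum_mem (fun i _ => hx.1 i) ?_
    fun i hi => subset_convexHull ℝ _ (mem_image_of_mem _ hi)
  rw [← hsub x hP, hx.2]

theorem kleinComb_mem_range {x : Fin 4 → ℝ} (hx : x ∈ stdSimplex ℝ (Fin 4)) :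
    kleinComb v x ∈ convexHull ℝ (range fun i => kleinPt (v i).1) :=
  convexHull_mono (image_subset_range _ _)
    (kleinComb_mem (P := Finset.univ) hx fun i hi => absurd (Finset.mem_univ i) hi)

theorem norm_kleinPt_coe (u : Hyp3) : ‖kleinPt u.1‖ < 1 := Hyp3.norm_kleinPt u.2

theorem norm_lt_one_of_mem_hull {y : E3}
    (hy : y ∈ convexHull ℝ (range fun i => kleinPt (v i).1)) : ‖y‖ < 1 :=
  mem_ball_zero_iff.1 (convexHull_min (by
    rintro _ ⟨i, rfl⟩; exact mem_ball_zero_iff.2 (norm_kleinPt_coe (v i)))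
    (convex_ball (0 : E3) 1) hy)

theorem kleinComb_single (i : Fin 4) : kleinComb v (Pi.single i 1) = kleinPt (v i).1 := by
  rw [kleinComb, Finset.sum_eq_single i]
  · simp
  · intro j _ hj; simp [Pi.single_eq_of_ne hj]
  · simp

theorem exists_kleinComb_of_mem {y : E3}
    (hy : y ∈ convexHull ℝ (range fun i => kleinPt (v i).1)) :
    ∃ x ∈ stdSimplex ℝ (Fin 4), kleinComb v x = y := by
  have hlin : IsLinearMap ℝ (kleinComb v) :=
    ⟨fun x y => by simp only [kleinComb, Pi.add_apply, add_smul, Finset.sum_add_distrib],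
      fun c x => by simp only [kleinComb, Pi.smul_apply, smul_eq_mul, mul_smul, Finset.smul_sum]⟩
  refine convexHull_min ?_ ((convex_stdSimplex ℝ (Fin 4)).is_linear_image hlin) hy
  rintro _ ⟨i, rfl⟩
  exact ⟨Pi.single i 1, single_mem_stdSimplex ℝ i, kleinComb_single i⟩

/-- Translates Klein barycentric coordinates into linear coefficients on the vertices in Minkowski
space: dividing by the time coordinates of the vertices makes the total time coordinate `s`. -/
theorem sum_smul_vertices (x : Fin 4 → ℝ) (s : ℝ) (P : Finset (Fin 4)) (hP : ∀ i ∉ P, x i = 0)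
    (hx : ∑ i, x i = 1) :
    ∑ i ∈ P, (s * x i / (v i).1.1) • (v i).1 = (s, s • kleinComb v x) := by
  have hpos : ∀ i, (v i).1.1 ≠ 0 := fun i => (v i).2.2.ne'
  have hsub : ∑ i ∈ P, (s * x i / (v i).1.1) • (v i).1 =
      ∑ i, (s * x i / (v i).1.1) • (v i).1 :=
    Finset.sum_subset (Finset.subset_univ P) fun i _ hi => by rw [hP i hi]; simp
  rw [hsub]
  refine Prod.ext ?_ ?_
  · rw [Prod.fst_sum]
    simp only [Prod.smul_fst, smul_eq_mul]
    simp only [div_mul_cancel₀ _ (hpos _)]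
    rw [← Finset.mul_sum, hx, mul_one]
  · rw [Prod.snd_sum]
    change _ = s • kleinComb v x
    rw [kleinComb, Finset.smul_sum]
    refine Finset.sum_congr rfl fun i _ => ?_
    rw [Prod.smul_snd, kleinPt, smul_smul, smul_smul]
    congr 1

theorem hypPt_kleinExp_kleinComb {x : Fin 4 → ℝ} (hx : x ∈ stdSimplex ℝ (Fin 4))
    (P : Finset (Fin 4)) (hP : ∀ i ∉ P, x i = 0) : ∃ s : ℝ, 0 < s ∧
      (hypPt (kleinExp (kleinComb v x)) : MinkSpace) =
        ∑ i ∈ P, (s * x i / (v i).1.1) • (v i).1 := by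
  have hlt := norm_lt_one_of_mem_hull (kleinComb_mem_range (v := v) hx)
  refine ⟨(√(1 - ‖kleinComb v x‖ ^ 2))⁻¹,
    inv_pos.2 (Real.sqrt_pos.2 (by linarith [sq_norm_lt_one hlt])), ?_⟩
  rw [sum_smul_vertices x _ P hP hx.2]
  exact hypVec_kleinExp hlt

theorem hypPt_kleinExp_mem {x : Fin 4 → ℝ} (hx : x ∈ stdSimplex ℝ (Fin 4))
    (P : Finset (Fin 4)) (hP : ∀ i ∉ P, x i = 0) :
    hypPt (kleinExp (kleinComb v x)) ∈ hypSimplex v P := by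
  obtain ⟨s, hs, he⟩ := hypPt_kleinExp_kleinComb (v := v) hx P hP
  exact ⟨_, fun i _ => div_nonneg (mul_nonneg hs.le (hx.1 i)) (v i).2.2.le, he⟩

theorem hypPt_kleinExp_mem_open {x : Fin 4 → ℝ} (hx : x ∈ stdSimplex ℝ (Fin 4))
    (P : Finset (Fin 4)) (hP : ∀ i ∉ P, x i = 0) (hpos : ∀ i ∈ P, 0 < x i) :
    hypPt (kleinExp (kleinComb v x)) ∈ hypOpenSimplex v P := by
  obtain ⟨s, hs, he⟩ := hypPt_kleinExp_kleinComb (v := v) hx P hP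
  exact ⟨_, fun i hi => div_pos (mul_pos hs (hpos i hi)) (v i).2.2, he⟩

theorem exists_kleinComb_of_mem_hypSimplex {P : Finset (Fin 4)} {u : Hyp3}
    (hu : u ∈ hypSimplex v P) : ∃ x ∈ stdSimplex ℝ (Fin 4), (∀ i ∉ P, x i = 0) ∧
      kleinComb v x = kleinPt u.1 := by
  obtain ⟨a, ha, hu⟩ := hu
  have hu0 : u.1.1 ≠ 0 := u.2.2.ne'
  have e1 : u.1.1 = ∑ i ∈ P, a i * (v i).1.1 := by
    have := congrArg Prod.fst hu
    rwa [Prod.fst_sum] at this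
  have e2 : u.1.2 = ∑ i ∈ P, a i • (v i).1.2 := by
    have := congrArg Prod.snd hu
    rwa [Prod.snd_sum] at this
  refine ⟨fun i => if i ∈ P then a i * (v i).1.1 / u.1.1 else 0, ⟨fun i => ?_, ?_⟩,
    fun i hi => if_neg hi, ?_⟩
  · dsimp only
    split_ifs with hi
    · exact div_nonneg (mul_nonneg (ha i hi) (v i).2.2.le) u.2.2.le
    · exact le_rfl
  · rw [Finset.sum_ite_mem, Finset.univ_inter, ← Finset.sum_div, ← e1, div_self hu0]
  · rw [kleinComb, kleinPt, e2, Finset.smul_sum]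
    simp only [ite_smul, zero_smul]
    rw [Finset.sum_ite_mem, Finset.univ_inter]
    refine Finset.sum_congr rfl fun i _ => ?_
    have : (v i).1.1 ≠ 0 := (v i).2.2.ne'
    rw [kleinPt, smul_smul, smul_smul]
    congr 1
    field_simp

theorem injOn_kleinComb (hv : LinearIndependent ℝ fun i => (v i).1) :
    InjOn (kleinComb v) (stdSimplex ℝ (Fin 4)) := by
  intro x hx y hy hxy
  have hx' := sum_smul_vertices (v := v) x 1 Finset.univ (fun i hi => absurd (Finset.mem_univ i) hi)
    hx.2
  have hy' := sum_smul_vertices (v := v) y 1 Finset.univ (fun i hi => absurd (Finset.mem_univ i) hi)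
    hy.2
  rw [hxy, ← hy'] at hx'
  have h0 : ∑ i, (1 * x i / (v i).1.1 - 1 * y i / (v i).1.1) • (v i).1 = 0 := by
    simp only [sub_smul, Finset.sum_sub_distrib, hx', sub_self]
  ext i
  have h1 := Fintype.linearIndependent_iff.1 hv _ h0 i
  have : (v i).1.1 ≠ 0 := (v i).2.2.ne'
  rw [sub_eq_zero, div_left_inj' this] at h1
  simpa using h1

end KleinParametrization

/-! ### Lifting the tetrahedron to exponential coordinates. -/

section CellularParametrization

variable {Γ : Subgroup LorentzGroup} {Δ : GeodesicTetrahedron Γ} {A : LorentzGroup}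

/-- The vertices of a lift of the tetrahedron to the hyperbolic space around the base point of the
hyperboloid, which covers the manifold by `hypProj Γ ∘ A`. -/
structure IsLift (Δ : GeodesicTetrahedron Γ) (A : LorentzGroup) (v : Fin 4 → Hyp3) : Prop where
  linearIndependent : LinearIndependent ℝ fun i => (v i).1
  base : hypPt 0 ∈ hypSimplex v Finset.univ
  vertex : ∀ i, hypProj Γ (A • v i) = hypProj Γ (Δ.vertex i)
  cell_eq : ∀ S, Δ.cell S = (fun u => hypProj Γ (A • u)) '' hypSimplex v S
  subset_openCell : ∀ S, (fun u => hypProj Γ (A • u)) '' hypOpenSimplex v S ⊆ Δ.openCell S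
  injOn : InjOn (fun u => hypProj Γ (A • u)) (hypSimplex v Finset.univ)

/-- Some `γ` in `Γ` carries the point `A (1, 0)` into the given lift of the tetrahedron; pulling
that lift back by `γ * A` places the base point of the hyperboloid in it. -/
theorem exists_isLift (h : manifoldExp Γ A 0 ∈ Δ.carrier) : ∃ v, IsLift Δ A v := by
  obtain ⟨u, hu, hp⟩ := h
  obtain ⟨γ, hγ, he⟩ := hypProj_eq_iff.1 hp
  have hproj : ∀ x : Hyp3, hypProj Γ (A • x) = hypProj Γ ((γ * A) • x) := fun x => by
    rw [mul_smul, hypProj_smul hγ]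
  set g := γ * A with hg
  have hgv : (fun i => g • g⁻¹ • Δ.vertex i) = Δ.vertex := by
    funext i; rw [smul_inv_smul]
  have hmem : ∀ {S} {x : Hyp3}, x ∈ hypSimplex (fun i => g⁻¹ • Δ.vertex i) S ↔
      g • x ∈ hypSimplex Δ.vertex S := fun {S x} => by
    rw [← mem_hypSimplex_smul_iff g, hgv]
  refine ⟨fun i => g⁻¹ • Δ.vertex i, ?_, ?_, fun i => ?_, fun S => ?_, fun S => ?_, ?_⟩
  · exact Δ.nondegenerate.map' (g⁻¹).1.toLinearMap (g⁻¹).1.ker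
  · rw [hmem, hg, mul_smul]
    exact he ▸ hu
  · rw [hproj, smul_inv_smul]
  · ext p
    constructor
    · rintro ⟨x, hx, rfl⟩
      refine ⟨g⁻¹ • x, mem_hypSimplex_smul g⁻¹ hx, ?_⟩
      dsimp only
      rw [hproj, smul_inv_smul]
    · rintro ⟨x, hx, rfl⟩
      exact ⟨g • x, hmem.1 hx, (hproj x).symm⟩
  · rintro _ ⟨x, hx, rfl⟩
    refine ⟨g • x, ?_, (hproj x).symm⟩
    rw [← hgv]
    exact mem_hypOpenSimplex_smul g hx
  · intro x hx y hy hxy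
    dsimp only at hxy
    rw [hproj, hproj] at hxy
    exact smul_left_cancel g (Δ.embedded (hmem.1 hx) (hmem.1 hy) hxy)

namespace IsLift

variable {v : Fin 4 → Hyp3} (h : IsLift Δ A v)
include h

theorem isCellular : IsCellular Δ fun x => manifoldExp Γ A (kleinExp (kleinComb v x)) := by
  have hnot : ∀ (x : Fin 4 → ℝ), ∀ i ∉ (Finset.univ : Finset (Fin 4)), x i = 0 :=
    fun x i hi => absurd (Finset.mem_univ i) hi
  refine ⟨?_, ?_, fun S => ?_, fun S => ?_, fun i => ?_⟩
  · refine (continuous_manifoldExp A).comp_continuousOn (continuousOn_kleinExp.comp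
      continuous_kleinComb.continuousOn fun x hx => mem_ball_zero_iff.2
        (norm_lt_one_of_mem_hull (kleinComb_mem_range hx)))
  · intro x hx y hy hxy
    have h1 := h.injOn (hypPt_kleinExp_mem hx _ (hnot x)) (hypPt_kleinExp_mem hy _ (hnot y)) hxy
    refine injOn_kleinComb h.linearIndependent hx hy ?_
    have h2 : hypVec (kleinExp (kleinComb v x)) = hypVec (kleinExp (kleinComb v y)) :=
      congrArg Subtype.val h1
    rw [hypVec_kleinExp (norm_lt_one_of_mem_hull (kleinComb_mem_range hx)),
      hypVec_kleinExp (norm_lt_one_of_mem_hull (kleinComb_mem_range hy))] at h2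
    have h3 := congrArg Prod.fst h2
    have h4 := congrArg Prod.snd h2
    dsimp only at h3 h4
    rw [h3] at h4
    refine smul_right_injective E3 ?_ h4
    have := Real.sqrt_pos.2 (show 0 < 1 - ‖kleinComb v y‖ ^ 2 by
      linarith [sq_norm_lt_one (norm_lt_one_of_mem_hull (kleinComb_mem_range (v := v) hy))])
    exact (inv_pos.2 this).ne'
  · rw [h.cell_eq]
    ext p
    constructor
    · rintro ⟨u, hu, rfl⟩
      obtain ⟨x, hx, hxS, he⟩ := exists_kleinComb_of_mem_hypSimplex hu
      refine ⟨x, ⟨hx, hxS⟩, ?_⟩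
      dsimp only
      rw [he, manifoldExp_eq]
      exact congrArg (fun u => hypProj Γ (A • u)) (hypPt_hypLog u)
    · rintro ⟨x, ⟨hx, hxS⟩, rfl⟩
      exact ⟨_, hypPt_kleinExp_mem hx S hxS, rfl⟩
  · rintro _ ⟨x, ⟨hx, hxS, hpos⟩, rfl⟩
    exact h.subset_openCell S ⟨_, hypPt_kleinExp_mem_open hx S hxS hpos, rfl⟩
  · rw [← h.vertex]
    rw [kleinComb_single, manifoldExp_eq]
    exact (congrArg (fun u => hypProj Γ (A • u)) (hypPt_hypLog (v i))).symm

theorem zero_mem : (0 : E3) ∈ convexHull ℝ (range fun i => kleinPt (v i).1) := by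
  obtain ⟨x, hx, -, he⟩ := exists_kleinComb_of_mem_hypSimplex h.base
  rw [hypPt_zero_fst, kleinPt, smul_zero] at he
  exact he ▸ kleinComb_mem_range hx

theorem manifoldExp_mem {y : E3} (hy : y ∈ convexHull ℝ (range fun i => kleinPt (v i).1)) :
    manifoldExp Γ A (kleinExp y) ∈ Δ.carrier := by
  obtain ⟨x, hx, rfl⟩ := exists_kleinComb_of_mem hy
  rw [h.isCellular.carrier_eq]
  exact ⟨x, hx, rfl⟩

/-- If the tetrahedron has radius at most `r`, less than the injectivity radius, then the lift is
within the ball of radius `r`. -/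
theorem norm_kleinExp_le {r η : ℝ} (hr : 0 ≤ r) (hrη : r < η)
    (hinj : ENNReal.ofReal η < injRadius Γ A)
    (hdist : ∀ p ∈ Δ.carrier, manifoldDist Γ (manifoldExp Γ A 0) p ≤ r) {y : E3}
    (hy : y ∈ convexHull ℝ (range fun i => kleinPt (v i).1)) : ‖kleinExp y‖ ≤ r := by
  by_contra! hcon
  have hseg : ∀ s ∈ Icc (0 : ℝ) 1, s • y ∈ convexHull ℝ (range fun i => kleinPt (v i).1) :=
    fun s hs => by
      simpa using add_smul_sub_mem_convexHull h.zero_mem hy hs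
  have hcont : ContinuousOn (fun s : ℝ => ‖kleinExp (s • y)‖) (Icc 0 1) :=
    (continuousOn_kleinExp.comp (by fun_prop) fun s hs =>
      mem_ball_zero_iff.2 (norm_lt_one_of_mem_hull (hseg s hs))).norm
  -- A point of the lift that is too far is joined to the origin inside the lift, and on the way
  -- there is a point whose norm `c` lies strictly between `r` and `η`. Its image also comes from a
  -- vector shorter than `c`, against injectivity.
  set c := min ‖kleinExp y‖ ((r + η) / 2) with hc
  have hrc : r < c := lt_min hcon (by linarith)
  obtain ⟨s, hs, hsc⟩ := intermediate_value_Icc zero_le_one hcont (show c ∈ Icc _ _ by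
    simp only [zero_smul, one_smul]
    refine ⟨?_, min_le_left _ _⟩
    simpa [kleinExp] using hr.trans hrc.le)
  change ‖kleinExp (s • y)‖ = c at hsc
  obtain ⟨w, hw, hwc⟩ := exists_manifoldExp_of_manifoldDist_lt
    ((hdist _ (h.manifoldExp_mem (hseg s hs))).trans_lt hrc)
  have hcη : c < η := (min_le_right _ _).trans_lt (by linarith)
  have := injOn_manifoldExp hinj (mem_ball_zero_iff.2 (hwc.trans hcη))
    (mem_ball_zero_iff.2 (hsc.trans_lt hcη)) hw
  rw [this, hsc] at hwc
  exact lt_irrefl _ hwc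

end IsLift

end CellularParametrization

/-! ### Charts of the surface in exponential coordinates. -/

section Charts

open Real InnerProductGeometry

variable {Γ : Subgroup LorentzGroup} {F : Set (HypManifold Γ)} {A : LorentzGroup} {η : ℝ}

theorem mem_surfaceLift_iff {w : E3} :
    A.1 (hypVec w) ∈ surfaceLift Γ F ↔ manifoldExp Γ A w ∈ F :=
  ⟨fun ⟨_, h⟩ => h, fun h => ⟨(A • hypPt w).2, h⟩⟩

/-- The defining function is composed with `A` and the exponential map. The gradient survives
because the derivative of `hypVec` is onto the tangent space of the hyperboloid, where the given
function has nonzero derivative. -/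
theorem exists_chart_pullBack (hF : IsProperSurface Γ F) {w : E3} (hw : w ∈ pullBack Γ A η F) :
    ∃ (G : E3 → ℝ) (ν : E3), HasStrictFDerivAt G (innerSL ℝ ν) w ∧
      (∀ᶠ x in 𝓝 w, x ∈ pullBack Γ A η F ↔ G x = 0) ∧ ν ≠ 0 := by
  obtain ⟨U, g, hU, hwU, hg, hzero, t, ht, htg⟩ := hF.2 _ (mem_surfaceLift_iff.2 hw.1)
  set L : MinkSpace →L[ℝ] MinkSpace := LinearMap.toContinuousLinearMap A.1.toLinearMap with hL
  have hE : HasStrictFDerivAt (hypVec : E3 → MinkSpace) (fderiv ℝ hypVec w) w :=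
    (contDiff_hypVec (m := 1)).contDiffAt.hasStrictFDerivAt one_ne_zero
  have hgd : HasStrictFDerivAt g (fderiv ℝ g (A.1 (hypVec w))) (A.1 (hypVec w)) :=
    (hg.contDiffAt (hU.mem_nhds hwU)).hasStrictFDerivAt (by simp)
  have hG : HasStrictFDerivAt (fun x => g (A.1 (hypVec x)))
      ((fderiv ℝ g (A.1 (hypVec w))).comp (L.comp (fderiv ℝ hypVec w))) w :=
    HasStrictFDerivAt.comp w hgd (L.hasStrictFDerivAt.comp w hE)
  set D := (fderiv ℝ g (A.1 (hypVec w))).comp (L.comp (fderiv ℝ hypVec w)) with hD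
  have hν : innerSL ℝ ((InnerProductSpace.toDual ℝ E3).symm D) = D := by
    ext y
    rw [innerSL_apply_apply, InnerProductSpace.toDual_symm_apply]
  refine ⟨fun x => g (A.1 (hypVec x)), (InnerProductSpace.toDual ℝ E3).symm D, ?_, ?_, ?_⟩
  · rw [hν]; exact hG
  · have hcont : Continuous fun x : E3 => A.1 (hypVec x) :=
      (continuous_lorentz A).comp (contDiff_hypVec (m := 0)).continuous
    filter_upwards [hcont.continuousAt.eventually (hU.mem_nhds hwU),
      (continuous_norm.isOpen_preimage _ isOpen_Iio).mem_nhds (show w ∈ _ from hw.2)] with x hx hxη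
    rw [← hzero _ ⟨hx, (A • hypPt x).2⟩, mem_surfaceLift_iff]
    exact ⟨fun h => h.1, fun h => ⟨h, hxη⟩⟩
  · intro h0
    have hD0 : D = 0 := by rw [← hν, h0, map_zero]
    obtain ⟨τ, hτ⟩ := exists_fderiv_hypVec_eq (w := w) (t := A.1.symm t) (by
      rw [← mink_lorentz A, LinearEquiv.apply_symm_apply]; exact ht)
    have h1 : D τ = 0 := by rw [hD0]; rfl
    rw [hD] at h1
    change fderiv ℝ g (A.1 (hypVec w)) (A.1 (fderiv ℝ hypVec w τ)) = 0 at h1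
    rw [hτ, LinearEquiv.apply_symm_apply] at h1
    exact htg h1

/-- `G` vanishes on `X`, so its derivative within `X` is also zero; derivatives within a set agree
on its tangent cone. -/
theorem isNormalVector_of_chart {X : Set E3} {w ν : E3} (hw : w ∈ X) {G : E3 → ℝ}
    (hG : HasStrictFDerivAt G (innerSL ℝ ν) w) (hX : ∀ᶠ x in 𝓝 w, x ∈ X ↔ G x = 0) (hν : ν ≠ 0) :
    IsNormalVector X w ν := by
  refine ⟨hw, hν, fun t ht => ?_⟩
  have h1 : HasFDerivWithinAt G (innerSL ℝ ν) X w := hG.hasFDerivAt.hasFDerivWithinAt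
  have h2 : HasFDerivWithinAt G (0 : E3 →L[ℝ] ℝ) X w := by
    refine (hasFDerivWithinAt_const (0 : ℝ) w X).congr_of_eventuallyEq ?_ (hX.self_of_nhds.1 hw)
    filter_upwards [nhdsWithin_le_nhds hX, self_mem_nhdsWithin] with x hx hxX
    exact hx.1 hxX
  have := h1.unique_on h2 ht
  simpa using this

/-- The nonzero vectors that make an angle of at most `δ` with `v`. -/
def normalCone (v : E3) (δ : ℝ) : Set E3 := {ν | ν ≠ 0 ∧ angle ν v ≤ δ}

/-- Normals are controlled only up to sign. Replacing `G` by `-G` where needed orients all charts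
like `v`. -/
theorem hasChartsIn_pullBack (hF : IsProperSurface Γ F) {δ : ℝ}
    (hN : HasAlmostConstantNormals Γ F A η δ) {y v : E3}
    (hv : IsNormalVector (pullBack Γ A η F) y v) :
    HasChartsIn (pullBack Γ A η F) (normalCone v δ) := by
  intro w hw
  obtain ⟨G, ν, hG, hX, hν⟩ := exists_chart_pullBack hF hw
  rcases hN w y ν v (isNormalVector_of_chart hw hG hX hν) hv with h | h
  · exact ⟨G, ν, hG, hX, hν, h⟩
  · refine ⟨fun x => -G x, -ν, ?_, ?_, neg_ne_zero.2 hν, ?_⟩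
    · rw [map_neg]; exact hG.fun_neg
    · filter_upwards [hX] with x hx
      rw [hx, neg_eq_zero]
    · rw [angle_neg_left]; linarith

theorem isSteep_normalCone {v : E3} (hv : ‖v‖ = 1) {δ : ℝ} (hδ : δ < π / 30) :
    IsSteep (normalCone v δ) v := by
  rintro ν ⟨hν, hang⟩
  refine ⟨hν, ?_⟩
  have h1 : (49 : ℝ) / 50 ≤ cos (angle ν v) := by
    have h0 := angle_nonneg ν v
    have hπ := pi_lt_d2
    have := one_sub_sq_div_two_le_cos (x := angle ν v)
    nlinarith
  rw [← cos_angle_mul_norm_mul_norm, hv, mul_one]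
  exact mul_le_mul_of_nonneg_right h1 (norm_nonneg ν)

theorem mem_normalCone_self {v : E3} (hv : ‖v‖ = 1) {δ : ℝ} (hδ : 0 ≤ δ) : v ∈ normalCone v δ := by
  have hv0 : v ≠ 0 := by rintro rfl; simp at hv
  exact ⟨hv0, by rw [angle_self hv0]; exact hδ⟩

/-- The pull-back lives in an open ball and need not be closed; a slightly smaller closed ball
restores compactness. -/
theorem isCompact_pullBack_inter (hF : IsClosed F) (hη : 0 < η) :
    IsCompact (pullBack Γ A η F ∩ Metric.closedBall 0 (19 / 20 * η)) := by
  have : pullBack Γ A η F ∩ Metric.closedBall 0 (19 / 20 * η) =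
      manifoldExp Γ A ⁻¹' F ∩ Metric.closedBall 0 (19 / 20 * η) := by
    ext w
    refine ⟨fun h => ⟨h.1.1, h.2⟩, fun h => ⟨⟨h.1, ?_⟩, h.2⟩⟩
    have := mem_closedBall_zero_iff.1 h.2
    linarith
  rw [this]
  exact (isCompact_closedBall _ _).inter_left (hF.preimage (continuous_manifoldExp A))

end Charts

/-! ### Edges descend with respect to all vectors near `v`. -/

section Edges

open Real InnerProductGeometry

variable {Γ : Subgroup LorentzGroup} {Δ : GeodesicTetrahedron Γ} {A : LorentzGroup} {η : ℝ}

/-- At an end of the interval only one direction is available, so the velocity is tangent up to a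
factor of either sign. That suffices, as nonperpendicularity is symmetric under a change of sign. -/
theorem isTangentVector_of_curve {X : Set E3} {γ : ℝ → E3} {γ' : E3} {t : ℝ}
    (ht : t ∈ Icc (0 : ℝ) 1) (hγ : HasDerivAt γ γ' t) (hX : ∀ s ∈ Icc (0 : ℝ) 1, γ s ∈ X)
    (h0 : γ' ≠ 0) : ∃ c : ℝ, c ≠ 0 ∧ IsTangentVector X (γ t) (c • γ') := by
  have key : ∀ s ∈ Icc (0 : ℝ) 1, s ≠ t → IsTangentVector X (γ t) ((s - t) • γ') := by
    intro s hs hst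
    refine ⟨hX t ht, smul_ne_zero (sub_ne_zero.2 hst) h0, ?_⟩
    have h1 : s - t ∈ tangentConeAt ℝ (Icc (0 : ℝ) 1) t :=
      mem_tangentConeAt_of_segment_subset ((convex_Icc 0 1).segment_subset ht hs)
    have h2 := hγ.hasFDerivAt.hasFDerivWithinAt.mapsTo_tangent_cone h1
    have h3 := tangentConeAt_mono (image_subset_iff.2 hX) h2
    simpa using h3
  rcases eq_or_ne t 0 with rfl | h
  · exact ⟨_, by norm_num, key 1 ⟨zero_le_one, le_rfl⟩ one_ne_zero⟩
  · exact ⟨_, by simpa using h, key 0 ⟨le_rfl, zero_le_one⟩ h.symm⟩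

theorem inner_pos_of_angle {u v ν : E3} {δ ε : ℝ} (hδε : δ ≤ ε) (hν : angle ν v ≤ δ)
    (hu : angle u v < π / 2 - ε) : 0 < inner ℝ ν u := by
  have h1 := angle_le_angle_add_angle ν v u
  rw [angle_comm v u] at h1
  have h2 : angle ν u < π / 2 := by linarith
  have hν0 : ν ≠ 0 := by rintro rfl; rw [angle_zero_left] at h2; exact lt_irrefl _ h2
  have hu0 : u ≠ 0 := by rintro rfl; rw [angle_zero_right] at h2; exact lt_irrefl _ h2
  rw [← cos_angle_mul_norm_mul_norm]
  have := cos_pos_of_mem_Ioo ⟨by linarith [angle_nonneg ν u, pi_pos], h2⟩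
  have := norm_pos_iff.2 hν0
  have := norm_pos_iff.2 hu0
  positivity

theorem inner_neg_of_angle {u v ν : E3} {δ ε : ℝ} (hδε : δ ≤ ε) (hν : angle ν v ≤ δ)
    (hu : π / 2 + ε < angle u v) : inner ℝ ν u < 0 := by
  have := inner_pos_of_angle (u := -u) hδε hν (by rw [angle_neg_left]; linarith)
  rw [inner_neg_right] at this
  linarith

theorem angle_far_of_smul {u v : E3} {c ε : ℝ} (hc : c ≠ 0)
    (h : angle (c • u) v < π / 2 - ε ∨ π / 2 + ε < angle (c • u) v) :
    angle u v < π / 2 - ε ∨ π / 2 + ε < angle u v := by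
  rcases lt_or_gt_of_ne hc with hc | hc
  · rw [angle_smul_left_of_neg _ _ hc, angle_neg_left] at h
    rcases h with h | h
    · right; linarith
    · left; linarith
  · rwa [angle_smul_left_of_pos _ _ hc] at h

/-- An edge that is nowhere perpendicular to `v` is monotone with respect to all vectors close to
`v`. -/
theorem descends_of_isNonperpendicular {v : E3} (hv : v ≠ 0) {δ ε : ℝ} (hδ : 0 ≤ δ) (hδε : δ ≤ ε)
    {X : Set E3} {a b : E3} (ha : ‖a‖ < 1) (hb : ‖b‖ < 1) (hab : a ≠ b)
    (hmem : ∀ s ∈ Icc (0 : ℝ) 1, kleinExp (a + s • (b - a)) ∈ X)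
    (hperp : ∀ y t : E3, IsTangentVector X y t → angle t v < π / 2 - ε ∨ π / 2 + ε < angle t v) :
    Descends (normalCone v δ) a b ∨ Descends (normalCone v δ) b a := by
  set T : ℝ → E3 := fun t => kleinTangent (a + t • (b - a)) (b - a) with hT
  have hlt : ∀ t ∈ Icc (0 : ℝ) 1, ‖a + t • (b - a)‖ < 1 := fun t ht =>
    norm_add_smul_sub_lt_one ha hb ht
  have hst : ∀ t ∈ Icc (0 : ℝ) 1, 0 < stretch (‖a + t • (b - a)‖ ^ 2) := fun t ht =>
    stretch_pos (sq_norm_lt_one (hlt t ht))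
  have hang : ∀ t ∈ Icc (0 : ℝ) 1, angle (T t) v < π / 2 - ε ∨ π / 2 + ε < angle (T t) v := by
    intro t ht
    have hT0 : T t ≠ 0 := kleinTangent_ne_zero (hlt t ht) (sub_ne_zero.2 hab.symm)
    obtain ⟨c, hc, htan⟩ := isTangentVector_of_curve ht (hasDerivAt_kleinExp_line (hlt t ht)) hmem
      (smul_ne_zero (hst t ht).ne' hT0)
    have := hperp _ _ htan
    rw [smul_smul] at this
    exact angle_far_of_smul (mul_ne_zero hc (hst t ht).ne') this
  have hvN : angle v v ≤ δ := by rw [angle_self hv]; exact hδ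
  have hsign : ∀ t ∈ Icc (0 : ℝ) 1, ∀ ν ∈ normalCone v δ,
      (inner ℝ v (T t) < 0 → inner ℝ ν (T t) < 0) ∧
        (0 < inner ℝ v (T t) → 0 < inner ℝ ν (T t)) := by
    intro t ht ν hν
    rcases hang t ht with h | h
    · exact ⟨fun h0 => absurd h0 (inner_pos_of_angle hδε hvN h).not_gt,
        fun _ => inner_pos_of_angle hδε hν.2 h⟩
    · exact ⟨fun _ => inner_neg_of_angle hδε hν.2 h,
        fun h0 => absurd h0 (inner_neg_of_angle hδε hvN h).not_gt⟩
  have hd : ∀ t ∈ Icc (0 : ℝ) 1,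
      HasDerivWithinAt (fun t : ℝ => inner ℝ v (kleinExp (a + t • (b - a))))
        (stretch (‖a + t • (b - a)‖ ^ 2) * inner ℝ v (T t)) (Icc 0 1) t := by
    intro t ht
    have h1 := (innerSL ℝ v).hasFDerivAt.comp_hasDerivAt t (hasDerivAt_kleinExp_line (hlt t ht))
    have h2 := h1.hasDerivWithinAt (s := Icc 0 1)
    rwa [innerSL_apply_apply, inner_smul_right] at h2
  -- By Darboux's theorem a derivative without zeros has constant sign, so the edge is monotone as a
  -- whole with respect to `v`; the angular margin then carries the sign over to the cone.
  rcases hasDerivWithinAt_forall_lt_or_forall_gt_of_forall_ne (convex_Icc 0 1) hd (m := 0)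
    (fun t ht => mul_ne_zero (hst t ht).ne' (by
      rcases hang t ht with h | h
      · exact (inner_pos_of_angle hδε hvN h).ne'
      · exact (inner_neg_of_angle hδε hvN h).ne)) with h | h
  · left
    intro ν hν t ht
    exact (hsign t ht ν hν).1 ((pos_iff_neg_of_mul_neg (h t ht)).1 (hst t ht))
  · right
    intro ν hν t ht
    have ht' : 1 - t ∈ Icc (0 : ℝ) 1 := ⟨by linarith [ht.2], by linarith [ht.1]⟩
    have h1 := (hsign _ ht' ν hν).2 ((mul_pos_iff_of_pos_left (hst _ ht')).1 (h _ ht'))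
    have e1 : b + t • (a - b) = a + (1 - t) • (b - a) := by module
    have e2 : a - b = (-1 : ℝ) • (b - a) := by module
    rw [e1, e2, kleinTangent_smul, inner_smul_right]
    linarith

end Edges

/-! ### From sufficient transversality to a sheet through each intersection point. -/

section TransverseSimplex

open Real InnerProductGeometry

variable {Γ : Subgroup LorentzGroup} {Δ : GeodesicTetrahedron Γ} {F : Set (HypManifold Γ)}
  {A : LorentzGroup} {η : ℝ}

/-- A surface and a tetrahedron in position for the analysis of their intersection, in exponential
coordinates of radius `η`. -/
structure IsTransversePosition (F : Set (HypManifold Γ)) (Δ : GeodesicTetrahedron Γ)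
    (A : LorentzGroup) (η : ℝ) (v : E3) (δ : ℝ) (V : Fin 4 → Hyp3) : Prop where
  pos : 0 < η
  isLift : IsLift Δ A V
  injOn : InjOn (manifoldExp Γ A) (Metric.ball 0 η)
  norm_le : ∀ y ∈ convexHull ℝ (range fun i => kleinPt (V i).1), ‖kleinExp y‖ ≤ η / 4
  isClosed : IsClosed F
  norm_eq : ‖v‖ = 1
  mem : v ∈ normalCone v δ
  steep : IsSteep (normalCone v δ) v
  charts : HasChartsIn (pullBack Γ A η F) (normalCone v δ)
  edge : ∀ i j, i ≠ j → Descends (normalCone v δ) (kleinPt (V i).1) (kleinPt (V j).1) ∨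
    Descends (normalCone v δ) (kleinPt (V j).1) (kleinPt (V i).1)
  vertex : ∀ i, manifoldExp Γ A (kleinExp (kleinPt (V i).1)) ∉ F

theorem IsLift.kleinExp_mem_pullBack_edge {V : Fin 4 → Hyp3} (h : IsLift Δ A V) (hη : 0 < η)
    (hle : ∀ y ∈ convexHull ℝ (range fun i => kleinPt (V i).1), ‖kleinExp y‖ ≤ η / 4)
    (i j : Fin 4) {s : ℝ} (hs : s ∈ Icc (0 : ℝ) 1) :
    kleinExp (kleinPt (V i).1 + s • (kleinPt (V j).1 - kleinPt (V i).1)) ∈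
      pullBack Γ A η (Δ.edge i j) := by
  set x : Fin 4 → ℝ := (1 - s) • Pi.single i 1 + s • Pi.single j 1 with hx
  have hxs : x ∈ stdSimplex ℝ (Fin 4) :=
    convex_stdSimplex ℝ (Fin 4) (single_mem_stdSimplex ℝ i) (single_mem_stdSimplex ℝ j)
      (by linarith [hs.2]) hs.1 (by ring)
  have e : kleinComb V x = kleinPt (V i).1 + s • (kleinPt (V j).1 - kleinPt (V i).1) := by
    have hadd : kleinComb V x = (1 - s) • kleinComb V (Pi.single i 1) +
        s • kleinComb V (Pi.single j 1) := by
      simp only [kleinComb, hx, Finset.smul_sum, ← Finset.sum_add_distrib, Pi.add_apply,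
        Pi.smul_apply, smul_eq_mul, add_smul, mul_smul]
    rw [hadd, kleinComb_single, kleinComb_single]
    module
  rw [← e]
  refine ⟨(h.isCellular.mem_cell_iff hxs _).2 fun m hm => ?_, ?_⟩
  · have hm' : m ≠ i ∧ m ≠ j := by simpa using hm
    simp [hx, Pi.single_eq_of_ne hm'.1, Pi.single_eq_of_ne hm'.2]
  · linarith [hle _ (kleinComb_mem_range hxs)]

theorem exists_isTransversePosition (hF : IsProperSurface Γ F)
    (hT : IsSufficientlyTransverse Γ F Δ η) (hne : (F ∩ Δ.carrier).Nonempty) :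
    ∃ A v δ V, IsTransversePosition F Δ A η v δ V := by
  obtain ⟨hη, hvert, h | ⟨A, δ, hx, hδ, hδ6, hinj, hdist, hconst, ⟨y, v, -, hv, hv1, hperp⟩, -⟩⟩ := hT
  · exact absurd h hne.ne_empty
  obtain ⟨V, hV⟩ := exists_isLift hx
  have hle : ∀ y ∈ convexHull ℝ (range fun i => kleinPt (V i).1), ‖kleinExp y‖ ≤ η / 4 :=
    fun y hy => hV.norm_kleinExp_le (by positivity) (by linarith) hinj hdist hy
  have hδ0 : 0 ≤ δ / 5 := by positivity
  refine ⟨A, v, δ / 5, V, hη, hV, injOn_manifoldExp hinj, hle, hF.1, hv1,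
    mem_normalCone_self hv1 hδ0, isSteep_normalCone hv1 (by linarith),
    hasChartsIn_pullBack hF hconst hv, fun i j hij => ?_, fun i => ?_⟩
  · refine descends_of_isNonperpendicular hv.2.1 hδ0 (show δ / 5 ≤ 2 * δ by linarith)
      (norm_kleinPt_coe (V i)) (norm_kleinPt_coe (V j)) ?_
      (fun s hs => hV.kleinExp_mem_pullBack_edge hη hle i j hs) (hperp i j hij)
    intro he
    refine hij ?_
    rw [← kleinComb_single, ← kleinComb_single] at he
    have := injOn_kleinComb hV.linearIndependent (single_mem_stdSimplex ℝ i)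
      (single_mem_stdSimplex ℝ j) he
    by_contra hne
    have h1 := congrFun this i
    rw [Pi.single_eq_same, Pi.single_eq_of_ne hne] at h1
    exact one_ne_zero h1
  · have := hV.isCellular.vertex_eq i
    rw [kleinComb_single] at this
    rw [← this]
    exact hvert i

namespace IsTransversePosition

variable {v : E3} {δ : ℝ} {V : Fin 4 → Hyp3} (h : IsTransversePosition F Δ A η v δ V)
include h

/-- Through each point of the surface in the tetrahedron there is a sheet. -/
theorem exists_sheet {y : E3} (hy : y ∈ convexHull ℝ (range fun i => kleinPt (V i).1))
    (hyF : manifoldExp Γ A (kleinExp y) ∈ F) :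
    ∃ f, IsTransverseSimplex (pullBack Γ A η F) (normalCone v δ) v (3 / 4 * η) f
      (fun i => kleinPt (V i).1) ∧ height v f (kleinExp y) = 0 := by
  have hη := h.pos
  have hy4 := h.norm_le y hy
  obtain ⟨f, hf, hf0⟩ := exists_isSheet h.norm_eq h.steep h.charts hη
    (isCompact_pullBack_inter h.isClosed hη) ⟨hyF, by linarith⟩ hy4
  refine ⟨f, ⟨h.norm_eq, h.mem, h.steep, h.charts, hf, fun i => norm_kleinPt_coe (V i),
    fun x hx => ?_, h.edge, fun i h0 => ?_⟩, hf0⟩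
  · have := h.norm_le x hx
    linarith
  · have hi := h.norm_le _ (subset_convexHull ℝ _ (mem_range_self i))
    refine h.vertex i (hf.mem_of_height_eq_zero ⟨inner_flat h.norm_eq _, ?_⟩ h0).1
    have := norm_flat_le h.norm_eq (kleinExp (kleinPt (V i).1))
    linarith

end IsTransversePosition

end TransverseSimplex

/-! ### Curves do not outrun their length. -/

section Lengths

/-- The time coordinate is the hyperbolic cosine of the distance from the base point, so this is the
infinitesimal form of that distance being 1-Lipschitz. The proof is the Cauchy–Schwarz inequality
for the space components. -/
theorem sq_fst_le_of_tangent {u t : MinkSpace} (hu : u ∈ Hyp3) (ht : mink u t = 0) :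
    t.1 ^ 2 ≤ (u.1 ^ 2 - 1) * mink t t := by
  have h1 := hu.1
  rw [mink_self] at h1
  have h2 : inner ℝ u.2 t.2 = u.1 * t.1 := by rw [mink] at ht; linarith
  have h4 : (u.1 * t.1) ^ 2 ≤ ‖u.2‖ ^ 2 * ‖t.2‖ ^ 2 := by
    rw [← h2, ← mul_pow, ← sq_abs]
    exact pow_le_pow_left₀ (abs_nonneg _) (abs_real_inner_le_norm _ _) 2
  rw [mink_self]
  nlinarith

theorem abs_fst_le_of_tangent {u t : MinkSpace} (hu : u ∈ Hyp3) (ht : mink u t = 0) :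
    |t.1| ≤ √(u.1 ^ 2 - 1) * √(mink t t) := by
  have h0 : 0 ≤ u.1 ^ 2 - 1 := by
    have h1 := hu.1
    rw [mink_self] at h1
    nlinarith [sq_nonneg ‖u.2‖]
  rw [← Real.sqrt_mul h0]
  exact Real.abs_le_sqrt (sq_fst_le_of_tangent hu ht)

theorem one_le_fst_of_mem {u : MinkSpace} (hu : u ∈ Hyp3) : 1 ≤ u.1 := by
  rw [← cosh_norm_hypLog hu]
  exact Real.one_le_cosh _

theorem norm_hypLog_eq {u : MinkSpace} (hu : u ∈ Hyp3) :
    ‖hypLog u‖ = Real.log (u.1 + √(u.1 ^ 2 - 1)) := by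
  rw [← cosh_norm_hypLog hu]
  exact (Real.arcosh_cosh (norm_nonneg _)).symm

/-- For `ε = 0` the function is `arcosh` of `f`, which need not be differentiable where `f = 1`;
positive `ε` removes the singularity at the base point. -/
theorem hasDerivAt_log_add_sqrt {f : ℝ → ℝ} {f' x ε : ℝ} (hf : HasDerivAt f f' x)
    (h1 : 1 ≤ f x) (hε : 0 < ε) :
    HasDerivAt (fun t => Real.log (f t + √(f t ^ 2 - 1 + ε))) (f' / √(f x ^ 2 - 1 + ε)) x := by
  have hp : 0 < f x ^ 2 - 1 + ε := by nlinarith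
  have hr := Real.sqrt_pos.2 hp
  have h2 : HasDerivAt (fun t => f t ^ 2 - 1 + ε) (2 * f x * f') x := by
    have := ((hf.fun_pow 2).sub_const 1).add_const ε
    simpa using this
  refine ((hf.fun_add (h2.sqrt hp.ne')).log (by positivity)).congr_deriv ?_
  field_simp
  ring

theorem hasDerivAt_mink {c : ℝ → MinkSpace} {c' : MinkSpace} {x : ℝ} (hc : HasDerivAt c c' x) :
    HasDerivAt (fun t => mink (c t) (c t)) (2 * mink (c x) c') x := by
  have h1 : HasDerivAt (fun t => (c t).1) c'.1 x :=
    (ContinuousLinearMap.fst ℝ ℝ E3).hasFDerivAt.comp_hasDerivAt x hc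
  have h2 : HasDerivAt (fun t => (c t).2) c'.2 x :=
    (ContinuousLinearMap.snd ℝ ℝ E3).hasFDerivAt.comp_hasDerivAt x hc
  refine ((h2.inner ℝ h2).fun_sub (h1.fun_mul h1)).congr_deriv ?_
  rw [mink, real_inner_comm (c x).2 c'.2]
  ring

/-- A curve in hyperbolic space does not move away from its endpoint by more than its length. -/
theorem norm_hypLog_le_add_hypLength {c : ℝ → MinkSpace} (hc : ContDiffOn ℝ 1 c (Icc 0 1))
    (hmem : MapsTo c (Icc 0 1) Hyp3) {s : ℝ} (hs : s ∈ Icc (0 : ℝ) 1) :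
    ‖hypLog (c s)‖ ≤ ‖hypLog (c 1)‖ + hypLength c := by
  set c' := derivWithin c (Icc 0 1) with hc'
  set φ : ℝ → ℝ := fun t => √(mink (c' t) (c' t)) with hφ
  have hc'cont : ContinuousOn c' (Icc 0 1) :=
    hc.continuousOn_derivWithin (uniqueDiffOn_Icc zero_lt_one) le_rfl
  have hφcont : ContinuousOn φ (Icc 0 1) :=
    (continuous_mink_self.comp_continuousOn hc'cont).sqrt
  have hφ0 : ∀ t, 0 ≤ φ t := fun t => Real.sqrt_nonneg _
  have hsub : Icc s 1 ⊆ Icc (0 : ℝ) 1 := Icc_subset_Icc hs.1 le_rfl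
  have hderiv : ∀ x ∈ Ioo (0 : ℝ) 1, HasDerivAt c (c' x) x := fun x hx =>
    ((hc.differentiableOn one_ne_zero x (Ioo_subset_Icc_self hx)).hasDerivWithinAt).hasDerivAt
      (Icc_mem_nhds hx.1 hx.2)
  have htan : ∀ x ∈ Ioo (0 : ℝ) 1, mink (c x) (c' x) = 0 := by
    intro x hx
    have h1 := hasDerivAt_mink (hderiv x hx)
    have h2 : HasDerivAt (fun t => mink (c t) (c t)) 0 x := by
      refine (hasDerivAt_const x (-1 : ℝ)).congr_of_eventuallyEq ?_
      filter_upwards [Icc_mem_nhds hx.1 hx.2] with t ht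
      exact (hmem ht).1
    linarith [h1.unique h2]
  have hint : ∫ x in s..1, φ x ≤ hypLength c := by
    have hi : IntervalIntegrable φ MeasureTheory.volume 0 1 :=
      hφcont.intervalIntegrable_of_Icc zero_le_one
    rw [hypLength]
    exact intervalIntegral.integral_mono_interval hs.1 hs.2 le_rfl
      (Filter.Eventually.of_forall hφ0) hi
  have hcont1 : ContinuousOn (fun t => (c t).1) (Icc s 1) :=
    continuous_fst.comp_continuousOn (hc.continuousOn.mono hsub)
  -- The regularised distance grows no faster than arc length; the claim follows as `ε` tends to
  -- `0`.
  have key : ∀ ε : ℝ, 0 < ε → Real.log ((c s).1 + √((c s).1 ^ 2 - 1 + ε)) ≤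
      Real.log ((c 1).1 + √((c 1).1 ^ 2 - 1 + ε)) + hypLength c := by
    intro ε hε
    have h := intervalIntegral.sub_le_integral_of_hasDeriv_right_of_le hs.2
      (g := fun t => -Real.log ((c t).1 + √((c t).1 ^ 2 - 1 + ε)))
      (g' := fun t => -((c' t).1 / √((c t).1 ^ 2 - 1 + ε))) (φ := φ) ?_ ?_ ?_ ?_
    · linarith
    · refine (ContinuousOn.log (hcont1.add (((hcont1.pow 2).sub continuousOn_const).add
        continuousOn_const).sqrt) fun x hx => ?_).neg
      have := one_le_fst_of_mem (hmem (hsub hx))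
      exact (add_pos_of_pos_of_nonneg (by linarith) (Real.sqrt_nonneg _)).ne'
    · intro x hx
      have hx' : x ∈ Ioo (0 : ℝ) 1 := ⟨hs.1.trans_lt hx.1, hx.2⟩
      have h1 : HasDerivAt (fun t => (c t).1) (c' x).1 x :=
        (ContinuousLinearMap.fst ℝ ℝ E3).hasFDerivAt.comp_hasDerivAt x (hderiv x hx')
      exact (hasDerivAt_log_add_sqrt h1 (one_le_fst_of_mem (hmem (Ioo_subset_Icc_self hx')))
        hε).neg.hasDerivWithinAt
    · exact (hφcont.mono hsub).integrableOn_Icc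
    · intro x hx
      have hx' : x ∈ Ioo (0 : ℝ) 1 := ⟨hs.1.trans_lt hx.1, hx.2⟩
      have hxm := hmem (Ioo_subset_Icc_self hx')
      have h1 := abs_fst_le_of_tangent hxm (htan x hx')
      have h2 := one_le_fst_of_mem hxm
      have hp : 0 < (c x).1 ^ 2 - 1 + ε := by nlinarith
      have hr := Real.sqrt_pos.2 hp
      rw [← neg_div, div_le_iff₀ hr]
      have h3 : √((c x).1 ^ 2 - 1) ≤ √((c x).1 ^ 2 - 1 + ε) := Real.sqrt_le_sqrt (by linarith)
      have h4 := mul_le_mul_of_nonneg_right h3 (hφ0 x)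
      have h5 := neg_abs_le (c' x).1
      change |(c' x).1| ≤ √((c x).1 ^ 2 - 1) * φ x at h1
      linarith
  have hlim : ∀ u ∈ Hyp3, Filter.Tendsto (fun ε : ℝ => Real.log (u.1 + √(u.1 ^ 2 - 1 + ε)))
      (𝓝[>] 0) (𝓝 ‖hypLog u‖) := by
    intro u hu
    have h1 := one_le_fst_of_mem hu
    have : ContinuousAt (fun ε : ℝ => Real.log (u.1 + √(u.1 ^ 2 - 1 + ε))) 0 := by
      refine ContinuousAt.log (by fun_prop) ?_
      positivity
    have := this.tendsto.mono_left (nhdsWithin_le_nhds (s := Ioi 0))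
    rw [add_zero, ← norm_hypLog_eq hu] at this
    exact this
  refine le_of_tendsto_of_tendsto (hlim _ (hmem hs))
    ((hlim _ (hmem ⟨zero_le_one, le_rfl⟩)).add_const _) ?_
  filter_upwards [self_mem_nhdsWithin] with ε hε
  exact key ε hε

theorem hypLength_lorentz (g : LorentzGroup) {c : ℝ → MinkSpace}
    (hc : ContDiffOn ℝ 1 c (Icc 0 1)) : hypLength (fun t => g.1 (c t)) = hypLength c := by
  have h1 : ∀ t ∈ Icc (0 : ℝ) 1, derivWithin (fun t => g.1 (c t)) (Icc 0 1) t =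
      g.1 (derivWithin c (Icc 0 1) t) := by
    intro t ht
    have hd := (hc.differentiableOn one_ne_zero t ht).hasDerivWithinAt
    exact ((LinearMap.toContinuousLinearMap g.1.toLinearMap).hasFDerivAt.comp_hasDerivWithinAt t
      hd).derivWithin (uniqueDiffOn_Icc zero_lt_one t ht)
  rw [hypLength, hypLength]
  refine intervalIntegral.integral_congr fun t ht => ?_
  rw [uIcc_of_le zero_le_one] at ht
  rw [h1 t ht, mink_lorentz]

end Lengths

/-! ### Components of the intersection are the discs cut out by sheets. -/

section Intersection

variable {Γ : Subgroup LorentzGroup} {Δ : GeodesicTetrahedron Γ} {F : Set (HypManifold Γ)}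
  {A : LorentzGroup} {η : ℝ} {v : E3} {δ : ℝ} {V : Fin 4 → Hyp3} {f : E3 → ℝ}

theorem kleinComb_join (a b : Fin 4 → ℝ) (t : ℝ) :
    kleinComb V (a + t • (b - a)) = kleinComb V a + t • (kleinComb V b - kleinComb V a) := by
  simp only [kleinComb, ← Finset.sum_sub_distrib, Finset.smul_sum, ← Finset.sum_add_distrib]
  refine Finset.sum_congr rfl fun i _ => ?_
  simp only [Pi.add_apply, Pi.smul_apply, Pi.sub_apply, smul_eq_mul]
  module

/-- The barycentric coordinates of the points in which a sheet meets the tetrahedron. -/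
def sheetSet (V : Fin 4 → Hyp3) (v : E3) (f : E3 → ℝ) : Set (Fin 4 → ℝ) :=
  {x ∈ stdSimplex ℝ (Fin 4) | height v f (kleinExp (kleinComb V x)) = 0}

theorem sheetSet_subset : sheetSet V v f ⊆ stdSimplex ℝ (Fin 4) := fun _ hx => hx.1

theorem continuousOn_kleinExp_kleinComb :
    ContinuousOn (fun x => kleinExp (kleinComb V x)) (stdSimplex ℝ (Fin 4)) :=
  continuousOn_kleinExp.comp continuous_kleinComb.continuousOn fun _ hx =>
    mem_ball_zero_iff.2 (norm_lt_one_of_mem_hull (kleinComb_mem_range hx))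

namespace IsTransverseSimplex

variable {X N : Set E3} {ρ : ℝ} (hs : IsTransverseSimplex X N v ρ f fun i => kleinPt (V i).1)
include hs

theorem isCompact_sheetSet : IsCompact (sheetSet V v f) := by
  have hc : ContinuousOn (fun x => height v f (kleinExp (kleinComb V x))) (stdSimplex ℝ (Fin 4)) :=
    hs.continuousOn_height.comp continuous_kleinComb.continuousOn fun _ hx => kleinComb_mem_range hx
  exact (isCompact_stdSimplex ℝ (Fin 4)).of_isClosed_subset
    (hc.preimage_isClosed_of_isClosed (isClosed_stdSimplex ℝ (Fin 4)) isClosed_singleton)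
    sheetSet_subset

/-- A sheet that meets the tetrahedron meets the joins of the set of vertices above it with the
set of vertices below it exactly once. -/
theorem exists_meetsJoinsOnce (hne : (sheetSet V v f).Nonempty) :
    ∃ S : Finset (Fin 4), S.Nonempty ∧ Sᶜ.Nonempty ∧ MeetsJoinsOnce (sheetSet V v f) S := by
  classical
  set S : Finset (Fin 4) := {i | 0 < height v f (kleinExp (kleinPt (V i).1))} with hS
  have hcoe : (S : Set (Fin 4)) = {i | 0 < height v f (kleinExp (kleinPt (V i).1))} := by
    ext i; simp [hS]
  obtain ⟨x₀, hx₀, hx₀0⟩ := hne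
  refine ⟨S, ?_, ?_, fun a ha b hb haS hbS => ?_⟩
  -- With no vertex above the sheet, the whole tetrahedron would lie strictly below it, although it
  -- meets the sheet.
  · by_contra hemp
    have hemp' := Finset.not_nonempty_iff_eq_empty.1 hemp
    have := hs.height_neg_of_vertices univ (fun i _ => ?_) _
      (by rw [image_univ]; exact kleinComb_mem_range hx₀)
    · exact this.ne hx₀0
    · have hi : i ∉ S := by rw [hemp']; exact Finset.notMem_empty i
      exact lt_of_le_of_ne (not_lt.1 fun h => hi (by simp [hS, h])) (hs.vertex i)
  · by_contra hemp
    have hemp' := Finset.not_nonempty_iff_eq_empty.1 hemp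
    have := hs.height_pos_of_vertices univ (fun i _ => ?_) _
      (by rw [image_univ]; exact kleinComb_mem_range hx₀)
    · exact this.ne' hx₀0
    · have hi : i ∉ Sᶜ := by rw [hemp']; exact Finset.notMem_empty i
      simpa [hS] using hi
  · have ha' := kleinComb_mem (v := V) ha haS
    have hb' := kleinComb_mem (v := V) hb (P := Sᶜ) fun i hi => hbS i (by simpa using hi)
    rw [hcoe] at ha'
    rw [Finset.coe_compl, hcoe] at hb'
    obtain ⟨t, ht, ht0, huniq⟩ := hs.existsUnique_join ha' hb'
    have hmem : ∀ s ∈ Icc (0 : ℝ) 1, a + s • (b - a) ∈ stdSimplex ℝ (Fin 4) := fun s hs =>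
      (convex_stdSimplex ℝ (Fin 4)).add_smul_sub_mem ha hb hs
    refine ⟨t, ht, ⟨hmem t (Ioo_subset_Icc_self ht), by rw [kleinComb_join]; exact ht0⟩,
      fun s hs hsQ => huniq s hs ?_⟩
    rw [← kleinComb_join]
    exact hsQ.2

end IsTransverseSimplex

theorem IsProperDisc.isPreconnected {D : Set (HypManifold Γ)} (h : IsProperDisc Δ D) :
    IsPreconnected D := by
  obtain ⟨-, g, -⟩ := h
  have : PreconnectedSpace (Metric.closedBall (0 : E2) 1) :=
    Subtype.preconnectedSpace (convex_closedBall _ _).isPreconnected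
  have hr : range (fun z => (g z : HypManifold Γ)) = D := by
    rw [range_comp' Subtype.val g, g.surjective.range_eq, image_univ, Subtype.range_coe]
  rw [← hr]
  exact isPreconnected_range (continuous_subtype_val.comp g.continuous)

namespace IsTransversePosition

variable (h : IsTransversePosition F Δ A η v δ V)
include h

theorem norm_kleinExp_kleinComb_le {x : Fin 4 → ℝ} (hx : x ∈ stdSimplex ℝ (Fin 4)) :
    ‖kleinExp (kleinComb V x)‖ ≤ η / 4 := h.norm_le _ (kleinComb_mem_range hx)

theorem mem_pullBack {x : Fin 4 → ℝ} (hx : x ∈ stdSimplex ℝ (Fin 4))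
    (hxF : manifoldExp Γ A (kleinExp (kleinComb V x)) ∈ F) :
    kleinExp (kleinComb V x) ∈ pullBack Γ A η F :=
  ⟨hxF, by linarith [h.norm_kleinExp_kleinComb_le hx, h.pos]⟩

theorem flat_mem_of_norm_le {y : E3} (hy : ‖y‖ ≤ 3 / 4 * η) : flat v y ∈ flatDisc v (3 / 4 * η) :=
  ⟨inner_flat h.norm_eq y, (norm_flat_le h.norm_eq y).trans hy⟩

theorem flat_mem {x : Fin 4 → ℝ} (hx : x ∈ stdSimplex ℝ (Fin 4)) :
    flat v (kleinExp (kleinComb V x)) ∈ flatDisc v (3 / 4 * η) :=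
  h.flat_mem_of_norm_le (by linarith [h.norm_kleinExp_kleinComb_le hx, h.pos])

theorem exists_sheet_of_mem {p : HypManifold Γ} (hp : p ∈ F ∩ Δ.carrier) :
    ∃ x f, IsTransverseSimplex (pullBack Γ A η F) (normalCone v δ) v (3 / 4 * η) f
      (fun i => kleinPt (V i).1) ∧ x ∈ sheetSet V v f ∧
      manifoldExp Γ A (kleinExp (kleinComb V x)) = p := by
  obtain ⟨hpF, hpΔ⟩ := hp
  rw [h.isLift.isCellular.carrier_eq] at hpΔ
  obtain ⟨x, hx, rfl⟩ := hpΔ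
  obtain ⟨f, hf, hf0⟩ := h.exists_sheet (kleinComb_mem_range hx) hpF
  exact ⟨x, f, hf, ⟨hx, hf0⟩, rfl⟩

variable (hs : IsTransverseSimplex (pullBack Γ A η F) (normalCone v δ) v (3 / 4 * η) f
  fun i => kleinPt (V i).1)
include hs

theorem isNormal_image_sheetSet [T2Space (HypManifold Γ)] (hne : (sheetSet V v f).Nonempty) :
    IsNormalTriangle Δ ((fun x => manifoldExp Γ A (kleinExp (kleinComb V x))) '' sheetSet V v f) ∨
    IsNormalSquare Δ
      ((fun x => manifoldExp Γ A (kleinExp (kleinComb V x))) '' sheetSet V v f) := by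
  obtain ⟨S, hS, hS', hQ⟩ := hs.exists_meetsJoinsOnce hne
  exact h.isLift.isCellular.isNormal_of_meetsJoinsOnce hs.isCompact_sheetSet sheetSet_subset hQ hS
    hS'

theorem image_sheetSet_subset :
    (fun x => manifoldExp Γ A (kleinExp (kleinComb V x))) '' sheetSet V v f ⊆ F ∩ Δ.carrier := by
  rintro _ ⟨x, ⟨hx, hx0⟩, rfl⟩
  refine ⟨(hs.sheet.mem_of_height_eq_zero (h.flat_mem hx) hx0).1, ?_⟩
  rw [h.isLift.isCellular.carrier_eq]
  exact mem_image_of_mem _ hx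

/-- The component, pulled back to the simplex, stays connected because the parametrisation is a
closed embedding; a connected part of the surface cannot leave the sheet. Conversely the sheet cuts
out a disc, which is connected. -/
theorem connectedComponentIn_eq_image [T2Space (HypManifold Γ)] {x : Fin 4 → ℝ}
    (hx : x ∈ sheetSet V v f) :
    connectedComponentIn (F ∩ Δ.carrier) (manifoldExp Γ A (kleinExp (kleinComb V x))) =
      (fun x => manifoldExp Γ A (kleinExp (kleinComb V x))) '' sheetSet V v f := by
  set B : (Fin 4 → ℝ) → HypManifold Γ := fun x => manifoldExp Γ A (kleinExp (kleinComb V x)) with hB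
  have hBc : IsCellular Δ B := h.isLift.isCellular
  have hsub := h.image_sheetSet_subset hs
  refine Subset.antisymm ?_ ?_
  · set C := connectedComponentIn (F ∩ Δ.carrier) (B x) with hC
    have hCsub : C ⊆ F ∩ Δ.carrier := connectedComponentIn_subset _ _
    have hxC : B x ∈ C := mem_connectedComponentIn (hsub (mem_image_of_mem _ hx))
    have : CompactSpace (stdSimplex ℝ (Fin 4)) :=
      isCompact_iff_compactSpace.1 (isCompact_stdSimplex ℝ (Fin 4))
    have hcont : Continuous fun x : stdSimplex ℝ (Fin 4) => B x :=
      continuousOn_iff_continuous_domRestrict.1 hBc.continuousOn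
    have hpre : IsPreconnected ((fun x : stdSimplex ℝ (Fin 4) => B x) ⁻¹' C) := by
      refine isPreconnected_connectedComponentIn.preimage_of_isClosedMap
        (fun a b hab => Subtype.ext (hBc.injOn a.2 b.2 hab)) hcont.isClosedMap ?_
      intro p hp
      have := (hCsub hp).2
      rw [hBc.carrier_eq] at this
      obtain ⟨y, hy, rfl⟩ := this
      exact ⟨⟨y, hy⟩, rfl⟩
    have hE : Continuous fun x : stdSimplex ℝ (Fin 4) => kleinExp (kleinComb V x) :=
      continuousOn_iff_continuous_domRestrict.1 continuousOn_kleinExp_kleinComb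
    have hpre' := hpre.image _ hE.continuousOn
    have hzero := hs.sheet.height_eq_zero_of_isPreconnected hpre' (by
        rintro _ ⟨y, hy, rfl⟩
        exact h.mem_pullBack y.2 (hCsub hy).1) (by
        rintro _ ⟨y, hy, rfl⟩
        exact h.flat_mem y.2) (x₀ := kleinExp (kleinComb V x)) ⟨⟨x, hx.1⟩, hxC, rfl⟩ hx.2
    intro p hp
    have := (hCsub hp).2
    rw [hBc.carrier_eq] at this
    obtain ⟨y, hy, rfl⟩ := this
    exact ⟨y, ⟨hy, hzero _ ⟨⟨y, hy⟩, hp, rfl⟩⟩, rfl⟩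
  · refine IsPreconnected.subset_connectedComponentIn ?_ (mem_image_of_mem _ hx) hsub
    rcases h.isNormal_image_sheetSet hs ⟨x, hx⟩ with ⟨i, hi⟩ | ⟨S, -, hS⟩
    · exact hi.1.isPreconnected
    · exact hS.1.isPreconnected

omit hs in
theorem isNormal_of_mem_components [T2Space (HypManifold Γ)] {D : Set (HypManifold Γ)}
    (hD : D ∈ componentsOf (F ∩ Δ.carrier)) : IsNormalTriangle Δ D ∨ IsNormalSquare Δ D := by
  obtain ⟨p, hp, rfl⟩ := hD
  obtain ⟨x, f, hs, hx, rfl⟩ := h.exists_sheet_of_mem hp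
  rw [h.connectedComponentIn_eq_image hs hx]
  exact h.isNormal_image_sheetSet hs ⟨x, hx⟩

-- Near each of its points the intersection lies on a single sheet, hence in a single component.
-- Compactness of the intersection does the rest.
omit hs in
theorem finite_components [T2Space (HypManifold Γ)] :
    (componentsOf (F ∩ Δ.carrier)).Finite := by
  set B : (Fin 4 → ℝ) → HypManifold Γ := fun x => manifoldExp Γ A (kleinExp (kleinComb V x)) with hB
  have hBc : IsCellular Δ B := h.isLift.isCellular
  set Y := {x ∈ stdSimplex ℝ (Fin 4) | B x ∈ F} with hY
  have hYc : IsCompact Y := (isCompact_stdSimplex ℝ (Fin 4)).of_isClosed_subset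
    (hBc.continuousOn.preimage_isClosed_of_isClosed (isClosed_stdSimplex ℝ (Fin 4)) h.isClosed)
    (sep_subset _ _)
  have key : {D | D ∈ componentsOf (F ∩ Δ.carrier) ∧ (D ∩ B '' Y).Nonempty}.Finite := by
    refine hYc.induction_on
      (p := fun s => {D | D ∈ componentsOf (F ∩ Δ.carrier) ∧ (D ∩ B '' s).Nonempty}.Finite)
      ?_ ?_ ?_ ?_
    · simp
    · exact fun s t hst ht => ht.subset fun D hD =>
        ⟨hD.1, hD.2.mono (inter_subset_inter_right _ (image_mono hst))⟩
    · refine fun s t hsf htf => (hsf.union htf).subset ?_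
      rintro D ⟨hD, p, hpD, x, hx | hx, rfl⟩
      · exact Or.inl ⟨hD, _, hpD, mem_image_of_mem _ hx⟩
      · exact Or.inr ⟨hD, _, hpD, mem_image_of_mem _ hx⟩
    · intro x hx
      obtain ⟨f, hs, hf0⟩ := h.exists_sheet (kleinComb_mem_range hx.1) hx.2
      refine ⟨sheetSet V v f, ?_, ?_⟩
      · have h1 := hs.sheet.eventually_height_eq_zero (h.flat_mem hx.1) hf0
        have h2 := (continuousOn_kleinExp_kleinComb (V := V) x hx.1).mono
          (sep_subset _ _ : Y ⊆ stdSimplex ℝ (Fin 4))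
        filter_upwards [h2.eventually h1, self_mem_nhdsWithin] with y hy hyY
        exact ⟨hyY.1, hy (h.mem_pullBack hyY.1 hyY.2) (h.flat_mem hyY.1)⟩
      · refine (finite_singleton (B '' sheetSet V v f)).subset ?_
        rintro D ⟨⟨p, hp, rfl⟩, _, hqD, y, hy, rfl⟩
        rw [mem_singleton_iff, ← h.connectedComponentIn_eq_image hs hy]
        exact connectedComponentIn_eq hqD
  refine key.subset ?_
  rintro D ⟨p, hp, rfl⟩
  refine ⟨⟨p, hp, rfl⟩, p, mem_connectedComponentIn hp, ?_⟩
  have := hp.2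
  rw [hBc.carrier_eq] at this
  obtain ⟨x, hx, rfl⟩ := this
  exact ⟨x, ⟨hx, hp.1⟩, rfl⟩

omit hs in
/-- A short curve in the surface that ends in the tetrahedron, in exponential coordinates. -/
theorem exists_curve_of_mem_surfaceBall {p : HypManifold Γ} {w : E3} (hw : ‖w‖ ≤ η / 4)
    (hq : manifoldExp Γ A w ∈ surfaceBall Γ F p (η / 2)) :
    ∃ e : ℝ → E3, ContinuousOn e (Icc 0 1) ∧
      (∀ t ∈ Icc (0 : ℝ) 1, e t ∈ pullBack Γ A η F ∧ ‖e t‖ ≤ 3 / 4 * η) ∧ e 1 = w ∧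
      manifoldExp Γ A (e 0) = p := by
  obtain ⟨-, hdist⟩ := hq
  rw [surfaceDist] at hdist
  obtain ⟨c, hc⟩ := iInf_lt_iff.1 hdist
  obtain ⟨⟨hcd, hcF, ⟨h0, hc0⟩, ⟨h1, hc1⟩⟩, hlen⟩ := iInf_lt_iff.1 hc
  rw [ENNReal.ofReal_lt_ofReal_iff (by linarith [h.pos])] at hlen
  obtain ⟨γ, hγ, hγe⟩ := hypProj_eq_iff.1 hc1
  -- The lift of the curve is moved by `g` so that it ends exactly at the point with exponential
  -- coordinates `w`, near the base point.
  set g : LorentzGroup := (γ * A)⁻¹ with hg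
  set d : ℝ → MinkSpace := fun t => g.1 (c t) with hd
  have hcH : ∀ t ∈ Icc (0 : ℝ) 1, c t ∈ Hyp3 := fun t ht => (hcF ht).1
  have hdH : MapsTo d (Icc 0 1) Hyp3 := fun t ht => (g • (⟨c t, hcH t ht⟩ : Hyp3)).2
  have hd1 : d 1 = hypVec w := by
    have : g • (⟨c 1, h1⟩ : Hyp3) = hypPt w := by
      rw [hg, inv_smul_eq_iff, mul_smul]
      exact hγe.symm
    exact congrArg Subtype.val this
  have hdc : ContDiffOn ℝ 1 d (Icc 0 1) :=
    (LinearMap.toContinuousLinearMap g.1.toLinearMap).contDiff.comp_contDiffOn hcd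
  have hproj : ∀ t (ht : t ∈ Icc (0 : ℝ) 1),
      manifoldExp Γ A (hypLog (d t)) = hypProj Γ ⟨c t, hcH t ht⟩ := by
    intro t ht
    have e1 : d t = (g • (⟨c t, hcH t ht⟩ : Hyp3) : Hyp3).1 := rfl
    rw [e1, manifoldExp_eq, hypPt_hypLog, hg, mul_inv_rev, mul_smul, smul_inv_smul, hypProj_smul (Γ.inv_mem hγ)]
  refine ⟨fun t => hypLog (d t), continuousOn_hypLog.comp hdc.continuousOn hdH, fun t ht => ?_, ?_,
    ?_⟩
  -- The endpoint is within `η / 4` of the origin and the length is below `η / 2`.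
  · have hn := norm_hypLog_le_add_hypLength hdc hdH ht
    rw [hd1, hypLog_hypVec, hypLength_lorentz g hcd] at hn
    refine ⟨⟨?_, ?_⟩, ?_⟩
    · rw [hproj t ht]
      exact (hcF ht).2
    · linarith [h.pos]
    · linarith
  · dsimp only
    rw [hd1, hypLog_hypVec]
  · rw [hproj 0 ⟨le_rfl, zero_le_one⟩]
    exact hc0

-- Two short curves from `p` to the two discs give a path between them that stays over the domain of
-- the sheet through the first disc. So the second disc lies on the same sheet.
omit hs in
theorem subsingleton_components_meeting_ball [T2Space (HypManifold Γ)] (p : HypManifold Γ) :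
    {D | D ∈ componentsOf (F ∩ Δ.carrier) ∧
      (D ∩ surfaceBall Γ F p (η / 2)).Nonempty}.Subsingleton := by
  rintro _ ⟨⟨p₁, hp₁, rfl⟩, q₁, hq₁, hb₁⟩ _ ⟨⟨p₂, hp₂, rfl⟩, q₂, hq₂, hb₂⟩
  rw [connectedComponentIn_eq hq₁, connectedComponentIn_eq hq₂]
  obtain ⟨x₁, f, hs, hx₁, rfl⟩ := h.exists_sheet_of_mem (connectedComponentIn_subset _ _ hq₁)
  obtain ⟨x₂, _, _, hx₂, rfl⟩ := h.exists_sheet_of_mem (connectedComponentIn_subset _ _ hq₂)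
  obtain ⟨e₁, hc₁, hm₁, he₁, h0₁⟩ :=
    h.exists_curve_of_mem_surfaceBall (h.norm_kleinExp_kleinComb_le hx₁.1) hb₁
  obtain ⟨e₂, hc₂, hm₂, he₂, h0₂⟩ :=
    h.exists_curve_of_mem_surfaceBall (h.norm_kleinExp_kleinComb_le hx₂.1) hb₂
  have hI0 : (0 : ℝ) ∈ Icc (0 : ℝ) 1 := ⟨le_rfl, zero_le_one⟩
  have hI1 : (1 : ℝ) ∈ Icc (0 : ℝ) 1 := ⟨zero_le_one, le_rfl⟩
  -- The curves come from independent lifts; below the injectivity radius their starting points,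
  -- which both represent `p`, must agree.
  have he0 : e₁ 0 = e₂ 0 := h.injOn (mem_ball_zero_iff.2 (hm₁ 0 hI0).1.2)
    (mem_ball_zero_iff.2 (hm₂ 0 hI0).1.2) (h0₁.trans h0₂.symm)
  have key : ∀ e : ℝ → E3, ContinuousOn e (Icc 0 1) →
      (∀ t ∈ Icc (0 : ℝ) 1, e t ∈ pullBack Γ A η F ∧ ‖e t‖ ≤ 3 / 4 * η) →
      ∀ s ∈ Icc (0 : ℝ) 1, height v f (e s) = 0 → ∀ t ∈ Icc (0 : ℝ) 1, height v f (e t) = 0 := by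
    intro e hc hm s hs' hs0 t ht
    refine hs.sheet.height_eq_zero_of_isPreconnected (isPreconnected_Icc.image e hc) ?_ ?_
      (mem_image_of_mem e hs') hs0 _ (mem_image_of_mem e ht)
    · rintro _ ⟨r, hr, rfl⟩
      exact (hm r hr).1
    · rintro _ ⟨r, hr, rfl⟩
      exact h.flat_mem_of_norm_le (hm r hr).2
  have h1 := key e₁ hc₁ hm₁ 1 hI1 (by rw [he₁]; exact hx₁.2) 0 hI0
  rw [he0] at h1
  have h2 := key e₂ hc₂ hm₂ 0 hI0 h1 1 hI1
  rw [he₂] at h2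
  rw [h.connectedComponentIn_eq_image hs hx₁, h.connectedComponentIn_eq_image hs ⟨hx₂.1, h2⟩]

end IsTransversePosition

end Intersection

theorem mainTheorem7 (Γ : Subgroup LorentzGroup) (hΓ : IsFreeKleinian Γ)
    (Δ : GeodesicTetrahedron Γ) (F : Set (HypManifold Γ))
    (hF : IsProperSurface Γ F) (hF2 : IsTwoSided Γ F)
    (η : ℝ) (hT : IsSufficientlyTransverse Γ F Δ η) :
    (componentsOf (F ∩ Δ.carrier)).Finite ∧
    (∀ D ∈ componentsOf (F ∩ Δ.carrier), IsNormalTriangle Δ D ∨ IsNormalSquare Δ D) ∧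
    ∀ p ∈ F, {D | D ∈ componentsOf (F ∩ Δ.carrier) ∧
      (D ∩ surfaceBall Γ F p (η / 2)).Nonempty}.Subsingleton := by
  have := hΓ.t2Space
  rcases (F ∩ Δ.carrier).eq_empty_or_nonempty with he | hne
  · have h0 : componentsOf (F ∩ Δ.carrier) = ∅ := by
      rw [he]
      exact eq_empty_of_forall_notMem fun D ⟨p, hp, _⟩ => hp
    rw [h0]
    exact ⟨finite_empty, fun D hD => absurd hD (notMem_empty D),
      fun p _ D hD => absurd hD.1 (notMem_empty D)⟩
  · obtain ⟨A, v, δ, V, h⟩ := exists_isTransversePosition hF hT hne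
    exact ⟨h.finite_components, fun D hD => h.isNormal_of_mem_components hD,
      fun p _ => h.subsingleton_components_meeting_ball p⟩
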